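/- Throughout, "manifold" means a $C^\infty$, real analytic or complex manifold, $\mathcal{O}_X$ is its sheaf of real or complex valued $C^\infty$, real analytic or holomorphic functions (values in a field $K\in\{\mathbb{R},\mathbb{C}\}$, fixed once and for all), $\mathcal{T}_X$ and $\Omega^1_X$ are the sheaves of vector fields and of one-forms with coefficients in $K$, and $f^*\mathcal{E}=\mathcal{O}_Y\otimes_{f^{-1}\mathcal{O}_X}f^{-1}\mathcal{E}$ for a map $f\colon Y\to X$ of manifolds and a sheaf $\mathcal{E}$ of $\mathcal{O}_X$-modules. **Definitions.** An $\mathcal{O}_X$-*Lie algebroid* is a sheaf $\mathcal{A}$ of $\mathcal{O}_X$-modules with a $K$-linear Lie bracket and an $\mathcal{O}_X$-linear map of Lie algebras $\sigma\colon\mathcal{A}\to\mathcal{T}_X$ such that $[a,gb]=\sigma(a)(g)b+g[a,b]$. A *Courant algebroid* on $X$ is a sheaf $\mathcal{Q}$ of $\mathcal{O}_X$-modules with a $K$-bilinear Leibniz bracket $\{\ ,\ \}$ (i.e. $\{a,\{b,c\}\}=\{\{a,b\},c\}+\{b,\{a,c\}\}$), an $\mathcal{O}_X$-linear map of Leibniz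 algebras $\pi\colon\mathcal{Q}\to\mathcal{T}_X$, a symmetric $\mathcal{O}_X$-bilinear (possibly degenerate) pairing $\langle\ ,\ \rangle$ with values in $\mathcal{O}_X$ and an $\mathcal{O}_X$-linear map $\pi^\dagger\colon\Omega^1_X\to\mathcal{Q}$ such that $$\pi\pi^\dagger=0,\qquad \{q,gp\}=g\{q,p\}+\pi(q)(g)p,\qquad \langle\{q,p\},r\rangle+\langle p,\{q,r\}\rangle=\pi(q)(\langle p,r\rangle),$$ $$\{q,\pi^\dagger\alpha\}=\pi^\dagger(L_{\pi(q)}\alpha),\qquad \langle q,\pi^\dagger\alpha\rangle=\iota_{\pi(q)}\alpha,\qquad \{q,p\}+\{p,q\}=\pi^\dagger(d\langle q,p\rangle).$$ A *Courant extension* of a Lie algebroid $\mathcal{A}$ is a Courant algebroid $\mathcal{Q}$ with an $\mathcal{O}_X$-linear map $p\colon\mathcal{Q}\to\mathcal{A}$, compatible with brackets and anchors, such that $0\to\Omega^1_X\xrightarrow{\pi^\dagger}\mathcal{Q}\xrightarrow{p}\mathcal{A}\to0$ is exact. A *morphism* of Courant extensions of $\mathcal{A}$ is an $\mathcal{O}_X$-linear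 map compatible with brackets, pairings, anchors, co-anchors and the projections to $\mathcal{A}$. They form the category $\mathrm{CExt}(\mathcal{A})$. **Inverse images.** Let $f\colon Y\to X$ be a map of manifolds. For a Lie algebroid $\mathcal{A}$ on $X$ let $f^+\mathcal{A}=f^*\mathcal{A}\times_{f^*\mathcal{T}_X}\mathcal{T}_Y$, with anchor the projection to $\mathcal{T}_Y$ and bracket $$\Big[\Big(\sum_i g_i\otimes a_i,\xi\Big),\Big(\sum_j h_j\otimes b_j,\eta\Big)\Big]=\Big(\sum_{i,j}g_ih_j\otimes[a_i,b_j]+\sum_j\xi(h_j)\otimes b_j-\sum_i\eta(g_i)\otimes a_i,\ [\xi,\eta]\Big).$$ For a Courant algebroid $\mathcal{Q}$ on $X$ let $f^{++}\mathcal{Q}$ be the quotient of $\Omega^1_Y\oplus(f^*\mathcal{Q}\times_{f^*\mathcal{T}_X}\mathcal{T}_Y)$ by the $\mathcal{O}_Y$-submodule generated by the elements $(f^*\alpha,-1\otimes\pi^\dagger\alpha,0)$, $\alpha\in\Omega^1_X$; write $[\alpha,s,\xi]$ for the class of $(\alpha,s,\xi)$. Its anchor is $[\alpha,s,\xi]\mapsto\xi$,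 its co-anchor is $\beta\mapsto[\beta,0,0]$, and for $u=[\alpha,\sum_i g_i\otimes q_i,\xi]$ and $v=[\beta,\sum_j h_j\otimes p_j,\eta]$ $$\langle u,v\rangle=\iota_\xi\beta+\iota_\eta\alpha+\sum_{i,j}g_ih_j\,f^*\langle q_i,p_j\rangle,$$ $$\{u,v\}=\Big[-\iota_\eta d\alpha+L_\xi\beta+\sum_{i,j}h_j\,f^*\langle q_i,p_j\rangle\,dg_i,\ \ \sum_{i,j}g_ih_j\otimes\{q_i,p_j\}+\sum_j\xi(h_j)\otimes p_j-\sum_i\eta(g_i)\otimes q_i,\ \ [\xi,\eta]\Big].$$ **Lemma.** Let $f\colon Y\to X$ be a map of manifolds and let $\mathcal{A}$ be an $\mathcal{O}_X$-Lie algebroid which is locally free of finite rank over $\mathcal{O}_X$. Then the formulas above determine a unique Lie algebroid structure on $f^+\mathcal{A}$ and, for each Courant extension $p\colon\mathcal{Q}\to\mathcal{A}$, a unique Courant algebroid structure on $f^{++}\mathcal{Q}$. The map $[\alpha,\sum_i g_i\otimes q_i,\xi]\mapsto(\sum_i g_i\otimes p(q_i),\xi)$ is well defined and makes $f^{++}\mathcal{Q}$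 a Courant extension of $f^+\mathcal{A}$. Consequently $f^{++}$ induces a functor $\mathrm{CExt}(\mathcal{A})\to\mathrm{CExt}(f^+\mathcal{A})$, which sends a morphism $\phi\colon\mathcal{Q}\to\mathcal{Q}'$ to $[\alpha,\sum_i g_i\otimes q_i,\xi]\mapsto[\alpha,\sum_i g_i\otimes\phi(q_i),\xi]$. -/

import Mathlib

open TopologicalSpace
open scoped Manifold ContDiff TensorProduct CategoryTheory

universe u

noncomputable section

/-- A manifold of class `n` over `𝕜`, modelled on a finite-dimensional coordinate space.
For `𝕜 = ℝ` and `n = ∞` or `n = ω` this is a smooth or a real analytic manifold, for `𝕜 = ℂ`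
it is a complex manifold.  (No separation or countability axiom is imposed.) -/
structure Mfd (𝕜 : Type) [RCLike 𝕜] (n : WithTop ℕ∞) where
  carrier : Type u
  dim : ℕ
  [topology : TopologicalSpace carrier]
  [charted : ChartedSpace (EuclideanSpace 𝕜 (Fin dim)) carrier]
  [smooth : IsManifold 𝓘(𝕜, EuclideanSpace 𝕜 (Fin dim)) n carrier]

namespace Mfd

section Basic

variable {𝕜 : Type} [RCLike 𝕜] {n : WithTop ℕ∞}

instance : CoeSort (Mfd.{u} 𝕜 n) (Type u) := ⟨Mfd.carrier⟩

attribute [instance] Mfd.topology Mfd.charted Mfd.smooth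

/-- The model with corners (without boundary) of a manifold. -/
abbrev model (X : Mfd.{u} 𝕜 n) :
    ModelWithCorners 𝕜 (EuclideanSpace 𝕜 (Fin X.dim)) (EuclideanSpace 𝕜 (Fin X.dim)) :=
  𝓘(𝕜, EuclideanSpace 𝕜 (Fin X.dim))

/-- Maps of manifolds. -/
structure Hom (Y X : Mfd.{u} 𝕜 n) where
  toFun : Y → X
  contMDiff : ContMDiff Y.model X.model n toFun

instance (Y X : Mfd.{u} 𝕜 n) : CoeFun (Hom Y X) (fun _ ↦ Y → X) := ⟨Hom.toFun⟩

/-- The preimage of an open set under a map of manifolds. -/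
def Hom.preim {Y X : Mfd.{u} 𝕜 n} (f : Hom Y X) (U : Opens X) : Opens Y :=
  ⟨f ⁻¹' U, U.2.preimage f.contMDiff.continuous⟩

end Basic

/-! ### Functions, vector fields and one-forms with values in `K` -/

section Sheaves

variable {𝕜 : Type} [RCLike 𝕜] {n : WithTop ℕ∞}
variable (K : Type) [RCLike K] [NormedAlgebra 𝕜 K]

variable {K} in
/-- Extension by zero of a function on an open set. -/
def ext {X : Mfd.{u} 𝕜 n} {U : Opens X} (g : U → K) : X → K := Function.extend Subtype.val g 0

variable {K} in
lemma ext_apply {X : Mfd.{u} 𝕜 n} {U : Opens X} (g : U → K) {x : X} (hx : x ∈ U) :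
    ext g x = g ⟨x, hx⟩ :=
  Subtype.val_injective.extend_apply g 0 ⟨x, hx⟩

variable {K} in
lemma ext_eventuallyEq {X : Mfd.{u} 𝕜 n} {U V : Opens X} (g : U → K) (k : V → K) (h : V ≤ U)
    (hk : ∀ x : V, k x = g ⟨x, h x.2⟩) {x : X} (hx : x ∈ V) : ext k =ᶠ[nhds x] ext g := by
  filter_upwards [V.2.mem_nhds hx] with z hz
  rw [ext_apply k hz, ext_apply g (h hz), hk]

/-- The algebra of `K`-valued functions of class `n` on the open set `U`. -/
def reg (X : Mfd.{u} 𝕜 n) (U : Opens X) : Subalgebra K (U → K) where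
  carrier := {g | ∀ x : U, ContMDiffAt X.model 𝓘(𝕜, K) n (ext g) (x : X)}
  mul_mem' {a b} ha hb x := by
    have h : ContDiff 𝕜 n (fun p : K × K ↦ p.1 * p.2) := contDiff_mul
    refine (h.contMDiff.contMDiffAt.comp (x : X)
      ((ha x).prodMk_space (hb x))).congr_of_eventuallyEq ?_
    filter_upwards [U.2.mem_nhds x.2] with z hz
    simp [ext_apply _ hz]
  add_mem' {a b} ha hb x := by
    refine ((ha x).add (hb x)).congr_of_eventuallyEq ?_
    filter_upwards [U.2.mem_nhds x.2] with z hz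
    simp [ext_apply _ hz]
  algebraMap_mem' c x := by
    refine (contMDiffAt_const (c := c)).congr_of_eventuallyEq ?_
    filter_upwards [U.2.mem_nhds x.2] with z hz
    simp [ext_apply _ hz]

/-- Sections over `U` of the structure sheaf `𝒪_X`. -/
def O (X : Mfd.{u} 𝕜 n) (U : Opens X) : Type u := ↥(X.reg K U)

instance (X : Mfd.{u} 𝕜 n) (U : Opens X) : CommRing (X.O K U) :=
  inferInstanceAs (CommRing ↥(X.reg K U))

variable {K} in
/-- The constant functions. -/
def const {X : Mfd.{u} 𝕜 n} (U : Opens X) (k : K) : X.O K U := algebraMap K (X.reg K U) k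

instance {X : Mfd.{u} 𝕜 n} {U : Opens X} {N : U → Type*} [∀ x, AddCommGroup (N x)]
    [∀ x, Module K (N x)] : Module (X.O K U) (∀ x, N x) :=
  Module.compHom _ (show X.O K U →+* (U → K) from (X.reg K U).val.toRingHom)

/-- A function is in `𝒪_X` when it is so locally. -/
lemma O_local {X : Mfd.{u} 𝕜 n} {U : Opens X} (g : U → K)
    (hg : ∀ x : U, ∃ (V : Opens X) (h : V ≤ U), (x : X) ∈ V ∧
      (fun z : V ↦ g ⟨z, h z.2⟩) ∈ X.reg K V) : g ∈ X.reg K U := fun x ↦ by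
  obtain ⟨V, h, hx, hV⟩ := hg x
  exact (hV ⟨x, hx⟩).congr_of_eventuallyEq (ext_eventuallyEq g _ h (fun _ ↦ rfl) hx).symm

/-- Restriction of functions. -/
def resO {X : Mfd.{u} 𝕜 n} {U V : Opens X} (h : V ≤ U) : X.O K U →+* X.O K V where
  toFun g := ⟨fun x ↦ g.1 ⟨x, h x.2⟩, fun x ↦ (g.2 ⟨x, h x.2⟩).congr_of_eventuallyEq
    (ext_eventuallyEq g.1 _ h (fun _ ↦ rfl) x.2)⟩
  map_one' := rfl
  map_mul' _ _ := rfl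
  map_zero' := rfl
  map_add' _ _ := rfl

/-- The value at a point, as a ring homomorphism. -/
def evalO {X : Mfd.{u} 𝕜 n} {U : Opens X} (x : U) : X.O K U →+* K where
  toFun g := g.1 x
  map_one' := rfl
  map_mul' _ _ := rfl
  map_zero' := rfl
  map_add' _ _ := rfl

/-- Pull-back of functions `f^* : 𝒪_X(U) → 𝒪_Y(V)` for `f(V) ⊆ U`. -/
def Hom.pullO {Y X : Mfd.{u} 𝕜 n} (f : Hom Y X) {U : Opens X} {V : Opens Y}
    (h : V ≤ f.preim U) : X.O K U →+* Y.O K V where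
  toFun g := ⟨fun y ↦ g.1 ⟨f y, h y.2⟩, fun y ↦ by
    refine ((g.2 ⟨f y, h y.2⟩).comp (y : Y) (f.contMDiff y)).congr_of_eventuallyEq ?_
    filter_upwards [V.2.mem_nhds y.2] with z hz
    rw [ext_apply _ hz, Function.comp_apply, ext_apply g.1 (h hz)]⟩
  map_one' := rfl
  map_mul' _ _ := rfl
  map_zero' := rfl
  map_add' _ _ := rfl

/-- Tangent vectors with coefficients in `K`: the space `K ⊗ T_x X`. -/
abbrev Tan (X : Mfd.{u} 𝕜 n) (x : X) : Type := K ⊗[𝕜] TangentSpace X.model x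

/-- The `K`-linear extension `K ⊗ T_y Y → K ⊗ T_{f(y)} X` of the derivative of `f`. -/
def Hom.push {Y X : Mfd.{u} 𝕜 n} (f : Hom Y X) (y : Y) : Y.Tan K y →ₗ[K] X.Tan K (f y) :=
  (mfderiv Y.model X.model f y).toLinearMap.baseChange K

variable {K} in
/-- The differential of a function at a point, extended `K`-linearly to `K ⊗ T_x X`. -/
def dAt {X : Mfd.{u} 𝕜 n} {U : Opens X} (g : U → K) (x : X) : Module.Dual K (X.Tan K x) :=
  LinearMap.liftBaseChange K
    (show TangentSpace X.model x →ₗ[𝕜] K from (mfderiv X.model 𝓘(𝕜, K) (ext g) x).toLinearMap)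

lemma dAt_res {X : Mfd.{u} 𝕜 n} {U V : Opens X} (h : V ≤ U) (g : X.O K U) {x : X} (hx : x ∈ V) :
    dAt (resO K h g).1 x = dAt g.1 x := by
  have e := ext_eventuallyEq g.1 (resO K h g).1 h (fun _ ↦ rfl) hx
  unfold dAt
  congr 1
  exact congrArg (fun L ↦ ContinuousLinearMap.toLinearMap L) e.mfderiv_eq

/-- Vector fields with coefficients in `K` on an open set `U`: families of vectors
`ξ_x ∈ K ⊗ T_x X` such that `ξ(g) = dg(ξ)` is of class `n` for each local function `g` of class
`n`. -/
def VF (X : Mfd.{u} 𝕜 n) (U : Opens X) : Submodule (X.O K U) (∀ x : U, X.Tan K x) where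
  carrier := {ξ | ∀ (V : Opens X) (h : V ≤ U) (g : X.O K V),
    (fun x : V ↦ dAt g.1 x (ξ ⟨x, h x.2⟩)) ∈ X.reg K V}
  add_mem' {a b} ha hb V h g := by
    convert (X.reg K V).add_mem (ha V h g) (hb V h g) using 1
    funext x
    exact map_add (dAt g.1 (x : X)) _ _
  zero_mem' V h g := by
    convert (X.reg K V).zero_mem using 1
    funext x
    exact map_zero (dAt g.1 (x : X))
  smul_mem' c a ha V h g := by
    convert (X.reg K V).mul_mem (resO K h c).2 (ha V h g) using 1
    funext x
    exact map_smul (dAt g.1 (x : X)) (c.1 ⟨x, h x.2⟩) (a ⟨x, h x.2⟩)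

/-- One-forms with coefficients in `K` on an open set `U`: families of `K`-linear functionals on
`K ⊗ T_x X` whose values on each local vector field are of class `n`. -/
def Form (X : Mfd.{u} 𝕜 n) (U : Opens X) :
    Submodule (X.O K U) (∀ x : U, Module.Dual K (X.Tan K x)) where
  carrier := {α | ∀ (V : Opens X) (h : V ≤ U) (ξ : X.VF K V),
    (fun x : V ↦ α ⟨x, h x.2⟩ (ξ.1 x)) ∈ X.reg K V}
  add_mem' {a b} ha hb V h ξ := (X.reg K V).add_mem (ha V h ξ) (hb V h ξ)
  zero_mem' V h ξ := (X.reg K V).zero_mem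
  smul_mem' c a ha V h ξ := (X.reg K V).mul_mem (resO K h c).2 (ha V h ξ)

instance (X : Mfd.{u} 𝕜 n) (U : Opens X) : AddCommGroup (X.VF K U) :=
  Submodule.addCommGroup (X.VF K U)

instance (X : Mfd.{u} 𝕜 n) (U : Opens X) : Module (X.O K U) (X.VF K U) :=
  Submodule.module (X.VF K U)

instance (X : Mfd.{u} 𝕜 n) (U : Opens X) : AddCommGroup (X.Form K U) :=
  Submodule.addCommGroup (X.Form K U)

instance (X : Mfd.{u} 𝕜 n) (U : Opens X) : Module (X.O K U) (X.Form K U) :=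
  Submodule.module (X.Form K U)

end Sheaves

end Mfd

open Mfd

/-! ### Sheaves of `𝒪_X`-modules -/

/-- Presheaves of `𝒪_X`-modules. -/
structure PreMod {𝕜 : Type} [RCLike 𝕜] {n : WithTop ℕ∞} (K : Type) [RCLike K] [NormedAlgebra 𝕜 K]
    (X : Mfd.{u} 𝕜 n) where
  sec : Opens X → Type u
  [group : ∀ U, AddCommGroup (sec U)]
  [module : ∀ U, Module (X.O K U) (sec U)]
  res : ∀ {U V : Opens X} (h : V ≤ U), sec U →ₛₗ[resO K h] sec V
  res_refl : ∀ {U : Opens X} (s : sec U), res le_rfl s = s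
  res_res : ∀ {U V W : Opens X} (h : V ≤ U) (k : W ≤ V) (s : sec U),
    res k (res h s) = res (k.trans h) s

attribute [instance] PreMod.group PreMod.module

/-- Sheaves of `𝒪_X`-modules. -/
structure OMod {𝕜 : Type} [RCLike 𝕜] {n : WithTop ℕ∞} (K : Type) [RCLike K] [NormedAlgebra 𝕜 K]
    (X : Mfd.{u} 𝕜 n) extends PreMod K X where
  sep : ∀ {U : Opens X} (s t : sec U),
    (∀ x ∈ U, ∃ (V : Opens X) (h : V ≤ U), x ∈ V ∧ res h s = res h t) → s = t
  glue : ∀ {ι : Type u} (V : ι → Opens X) (s : ∀ i, sec (V i)),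
    (∀ i j, res (inf_le_left : V i ⊓ V j ≤ V i) (s i) = res inf_le_right (s j)) →
    ∃ t : sec (⨆ i, V i), ∀ i, res (le_iSup V i) t = s i

section Modules

variable {𝕜 : Type} [RCLike 𝕜] {n : WithTop ℕ∞} {K : Type} [RCLike K] [NormedAlgebra 𝕜 K]
variable {X Y : Mfd.{u} 𝕜 n}

/-- Morphisms of sheaves of `𝒪_X`-modules. -/
@[ext] structure OMod.Hom (M N : OMod K X) where
  app : ∀ U : Opens X, M.sec U →ₗ[X.O K U] N.sec U
  naturality : ∀ {U V : Opens X} (h : V ≤ U) (s : M.sec U),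
    app V (M.res h s) = N.res h (app U s)

/-- The identity morphism. -/
def OMod.Hom.id (M : OMod K X) : OMod.Hom M M := ⟨fun _ ↦ LinearMap.id, fun _ _ ↦ rfl⟩

/-- Composition of morphisms. -/
def OMod.Hom.comp {M N P : OMod K X} (ψ : OMod.Hom N P) (φ : OMod.Hom M N) : OMod.Hom M P :=
  ⟨fun U ↦ (ψ.app U).comp (φ.app U), fun h s ↦ by
    simp [φ.naturality, ψ.naturality]⟩

/-- A sheaf of `𝒪_X`-modules is locally free of finite rank if each point has a neighbourhood on
which finitely many sections form a basis. -/
def OMod.LocallyFree (M : OMod K X) : Prop :=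
  ∀ x : X, ∃ (U : Opens X) (_ : x ∈ U) (r : ℕ) (e : Fin r → M.sec U),
    ∀ (V : Opens X) (h : V ≤ U) (s : M.sec V),
      ∃! c : Fin r → X.O K V, s = ∑ i, c i • M.res h (e i)

/-- The sheaf `𝒯_X` of vector fields with coefficients in `K`. -/
def tangentSheaf (K : Type) [RCLike K] [NormedAlgebra 𝕜 K] (X : Mfd.{u} 𝕜 n) : OMod K X where
  sec U := X.VF K U
  res {U V} h :=
    { toFun := fun ξ ↦ ⟨fun x ↦ ξ.1 ⟨x, h x.2⟩, fun W k g ↦ ξ.2 W (k.trans h) g⟩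
      map_add' := fun _ _ ↦ rfl
      map_smul' := fun _ _ ↦ rfl }
  res_refl _ := rfl
  res_res _ _ _ := rfl
  sep s t hst := Subtype.ext <| funext fun x ↦ by
    obtain ⟨V, h, hx, e⟩ := hst x x.2
    exact congrFun (congrArg Subtype.val e) ⟨x, hx⟩
  glue {ι} V s hs := by
    have hmem : ∀ x : (⨆ i, V i : Opens X), ∃ i, (x : X) ∈ V i := fun x ↦
      Opens.mem_iSup.1 x.2
    choose i hi using hmem
    have key : ∀ (j : ι) (x : (⨆ i, V i : Opens X)) (hx : (x : X) ∈ V j),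
        (s (i x)).1 ⟨x, hi x⟩ = (s j).1 ⟨x, hx⟩ := fun j x hx ↦
      congrFun (congrArg Subtype.val (hs (i x) j)) ⟨x, hi x, hx⟩
    refine ⟨⟨fun x ↦ (s (i x)).1 ⟨x, hi x⟩, fun W h g ↦ O_local K _ fun x ↦ ?_⟩, fun j ↦ ?_⟩
    · refine ⟨W ⊓ V (i ⟨x, h x.2⟩), inf_le_left, ⟨x.2, hi ⟨x, h x.2⟩⟩, ?_⟩
      have := (s (i ⟨x, h x.2⟩)).2 (W ⊓ V (i ⟨x, h x.2⟩)) inf_le_right (resO K inf_le_left g)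
      convert this using 1
      funext z
      rw [dAt_res K inf_le_left g z.2]
      exact congrArg _ (key _ ⟨z, h z.2.1⟩ z.2.2)
    · exact Subtype.ext <| funext fun x ↦ key j ⟨x, le_iSup V j x.2⟩ x.2

/-- The sheaf `Ω¹_X` of one-forms with coefficients in `K`. -/
def formSheaf (K : Type) [RCLike K] [NormedAlgebra 𝕜 K] (X : Mfd.{u} 𝕜 n) : OMod K X where
  sec U := X.Form K U
  res {U V} h :=
    { toFun := fun α ↦ ⟨fun x ↦ α.1 ⟨x, h x.2⟩, fun W k ξ ↦ α.2 W (k.trans h) ξ⟩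
      map_add' := fun _ _ ↦ rfl
      map_smul' := fun _ _ ↦ rfl }
  res_refl _ := rfl
  res_res _ _ _ := rfl
  sep s t hst := Subtype.ext <| funext fun x ↦ by
    obtain ⟨V, h, hx, e⟩ := hst x x.2
    exact congrFun (congrArg Subtype.val e) ⟨x, hx⟩
  glue {ι} V s hs := by
    have hmem : ∀ x : (⨆ i, V i : Opens X), ∃ i, (x : X) ∈ V i := fun x ↦
      Opens.mem_iSup.1 x.2
    choose i hi using hmem
    have key : ∀ (j : ι) (x : (⨆ i, V i : Opens X)) (hx : (x : X) ∈ V j),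
        (s (i x)).1 ⟨x, hi x⟩ = (s j).1 ⟨x, hx⟩ := fun j x hx ↦
      congrFun (congrArg Subtype.val (hs (i x) j)) ⟨x, hi x, hx⟩
    refine ⟨⟨fun x ↦ (s (i x)).1 ⟨x, hi x⟩, fun W h ξ ↦ O_local K _ fun x ↦ ?_⟩, fun j ↦ ?_⟩
    · refine ⟨W ⊓ V (i ⟨x, h x.2⟩), inf_le_left, ⟨x.2, hi ⟨x, h x.2⟩⟩, ?_⟩
      have := (s (i ⟨x, h x.2⟩)).2 (W ⊓ V (i ⟨x, h x.2⟩)) inf_le_right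
        ((tangentSheaf K X).res inf_le_left ξ)
      convert this using 1
      funext z
      exact congrArg (fun (L : Module.Dual K (X.Tan K z)) ↦ L (ξ.1 ⟨z, z.2.1⟩))
        (key _ ⟨z, h z.2.1⟩ z.2.2)
    · exact Subtype.ext <| funext fun x ↦ key j ⟨x, le_iSup V j x.2⟩ x.2

/-! ### The calculus of vector fields and one-forms -/

/-- The function `ξ(g)`. -/
def Mfd.VF.app {U : Opens X} (ξ : X.VF K U) (g : X.O K U) : X.O K U :=
  ⟨fun x ↦ dAt g.1 x (ξ.1 x), ξ.2 U le_rfl g⟩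

/-- The function `ι_ξ α = α(ξ)`. -/
def Mfd.Form.contract {U : Opens X} (ξ : X.VF K U) (α : X.Form K U) : X.O K U :=
  ⟨fun x ↦ α.1 x (ξ.1 x), α.2 U le_rfl ξ⟩

/-- The one-form `dg`. -/
def Mfd.d {U : Opens X} (g : X.O K U) : X.Form K U :=
  ⟨fun x ↦ dAt g.1 x, fun V h ξ ↦ by
    convert ξ.2 V le_rfl (resO K h g) using 1
    funext x
    rw [dAt_res K h g x.2]⟩

/-- `ζ = [ξ, η]`, i.e. `ζ(g) = ξ(η(g)) - η(ξ(g))` for all local functions `g`. -/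
def Mfd.IsBracket {U : Opens X} (ζ ξ η : (tangentSheaf K X).sec U) : Prop :=
  ∀ (V : Opens X) (h : V ≤ U) (g : X.O K V),
    VF.app ((tangentSheaf K X).res h ζ) g =
      VF.app ((tangentSheaf K X).res h ξ) (VF.app ((tangentSheaf K X).res h η) g) -
      VF.app ((tangentSheaf K X).res h η) (VF.app ((tangentSheaf K X).res h ξ) g)

/-- `β = L_ξ α`, i.e. `β(η) = ξ(α(η)) - α([ξ, η])` for all local vector fields `η`. -/
def Mfd.IsLieDeriv {U : Opens X} (β : (formSheaf K X).sec U) (ξ : (tangentSheaf K X).sec U)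
    (α : (formSheaf K X).sec U) : Prop :=
  ∀ (V : Opens X) (h : V ≤ U) (η ζ : (tangentSheaf K X).sec V),
    IsBracket ζ ((tangentSheaf K X).res h ξ) η →
    Form.contract η ((formSheaf K X).res h β) =
      VF.app ((tangentSheaf K X).res h ξ) (Form.contract η ((formSheaf K X).res h α)) -
      Form.contract ζ ((formSheaf K X).res h α)

/-- `β = ι_η dα`, i.e. `β(ζ) = η(α(ζ)) - ζ(α(η)) - α([η, ζ])` for all local vector fields `ζ`. -/
def Mfd.IsContractD {U : Opens X} (β : (formSheaf K X).sec U) (η : (tangentSheaf K X).sec U)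
    (α : (formSheaf K X).sec U) : Prop :=
  ∀ (V : Opens X) (h : V ≤ U) (ζ θ : (tangentSheaf K X).sec V),
    IsBracket θ ((tangentSheaf K X).res h η) ζ →
    Form.contract ζ ((formSheaf K X).res h β) =
      VF.app ((tangentSheaf K X).res h η) (Form.contract ζ ((formSheaf K X).res h α)) -
      VF.app ζ (Form.contract ((tangentSheaf K X).res h η) ((formSheaf K X).res h α)) -
      Form.contract θ ((formSheaf K X).res h α)

/-- `β = f^*α` on an open set `V` with `f(V) ⊆ U`, i.e. `β_y = α_{f(y)} ∘ df_y` for `y ∈ V`. -/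
def Mfd.IsFormPullback (f : Mfd.Hom Y X) {U : Opens X} {V : Opens Y} (h : V ≤ f.preim U)
    (β : (formSheaf K Y).sec V) (α : (formSheaf K X).sec U) : Prop :=
  ∀ y : V, β.1 y = (α.1 ⟨f y, h y.2⟩).comp (f.push K y)

/-! ### Lie algebroids, Courant algebroids and Courant extensions -/

/-- The structure of an `𝒪_X`-Lie algebroid on a sheaf of `𝒪_X`-modules.  Bilinearity over `K` is
expressed through the constant functions. -/
structure LieStr (A : OMod K X) where
  anchor : OMod.Hom A (tangentSheaf K X)
  br : ∀ {U : Opens X}, A.sec U → A.sec U → A.sec U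
  res_br : ∀ {U V : Opens X} (h : V ≤ U) (a b : A.sec U),
    A.res h (br a b) = br (A.res h a) (A.res h b)
  add_br : ∀ {U : Opens X} (a b c : A.sec U), br (a + b) c = br a c + br b c
  br_add : ∀ {U : Opens X} (a b c : A.sec U), br a (b + c) = br a b + br a c
  const_br : ∀ {U : Opens X} (k : K) (a b : A.sec U),
    br (Mfd.const U k • a) b = Mfd.const U k • br a b
  br_const : ∀ {U : Opens X} (k : K) (a b : A.sec U),
    br a (Mfd.const U k • b) = Mfd.const U k • br a b
  br_self : ∀ {U : Opens X} (a : A.sec U), br a a = 0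
  jacobi : ∀ {U : Opens X} (a b c : A.sec U), br a (br b c) = br (br a b) c + br b (br a c)
  anchor_br : ∀ {U : Opens X} (a b : A.sec U),
    IsBracket (anchor.app U (br a b)) (anchor.app U a) (anchor.app U b)
  leibniz : ∀ {U : Opens X} (a b : A.sec U) (g : X.O K U),
    br a (g • b) = VF.app (anchor.app U a) g • b + g • br a b

/-- The structure of a Courant algebroid on a sheaf of `𝒪_X`-modules: Leibniz bracket `br`,
anchor, symmetric pairing `pair` (not assumed to be non-degenerate) and co-anchor. -/
structure CourantStr (Q : OMod K X) where
  br : ∀ {U : Opens X}, Q.sec U → Q.sec U → Q.sec U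
  anchor : OMod.Hom Q (tangentSheaf K X)
  pair : ∀ {U : Opens X}, Q.sec U → Q.sec U → X.O K U
  coanchor : OMod.Hom (formSheaf K X) Q
  res_br : ∀ {U V : Opens X} (h : V ≤ U) (a b : Q.sec U),
    Q.res h (br a b) = br (Q.res h a) (Q.res h b)
  add_br : ∀ {U : Opens X} (a b c : Q.sec U), br (a + b) c = br a c + br b c
  br_add : ∀ {U : Opens X} (a b c : Q.sec U), br a (b + c) = br a b + br a c
  const_br : ∀ {U : Opens X} (k : K) (a b : Q.sec U),
    br (Mfd.const U k • a) b = Mfd.const U k • br a b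
  br_const : ∀ {U : Opens X} (k : K) (a b : Q.sec U),
    br a (Mfd.const U k • b) = Mfd.const U k • br a b
  jacobi : ∀ {U : Opens X} (a b c : Q.sec U), br a (br b c) = br (br a b) c + br b (br a c)
  anchor_br : ∀ {U : Opens X} (a b : Q.sec U),
    IsBracket (anchor.app U (br a b)) (anchor.app U a) (anchor.app U b)
  res_pair : ∀ {U V : Opens X} (h : V ≤ U) (a b : Q.sec U),
    resO K h (pair a b) = pair (Q.res h a) (Q.res h b)
  pair_symm : ∀ {U : Opens X} (a b : Q.sec U), pair a b = pair b a
  add_pair : ∀ {U : Opens X} (a b c : Q.sec U), pair (a + b) c = pair a c + pair b c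
  smul_pair : ∀ {U : Opens X} (g : X.O K U) (a b : Q.sec U), pair (g • a) b = g * pair a b
  anchor_coanchor : ∀ {U : Opens X} (α : (formSheaf K X).sec U),
    anchor.app U (coanchor.app U α) = 0
  leibniz : ∀ {U : Opens X} (a b : Q.sec U) (g : X.O K U),
    br a (g • b) = g • br a b + VF.app (anchor.app U a) g • b
  invariance : ∀ {U : Opens X} (a b c : Q.sec U),
    pair (br a b) c + pair b (br a c) = VF.app (anchor.app U a) (pair b c)
  br_coanchor : ∀ {U : Opens X} (a : Q.sec U) (α β : (formSheaf K X).sec U),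
    IsLieDeriv β (anchor.app U a) α → br a (coanchor.app U α) = coanchor.app U β
  pair_coanchor : ∀ {U : Opens X} (a : Q.sec U) (α : (formSheaf K X).sec U),
    pair a (coanchor.app U α) = Form.contract (anchor.app U a) α
  br_add_br_swap : ∀ {U : Opens X} (a b : Q.sec U),
    br a b + br b a = coanchor.app U (d (pair a b))

/-- `p : Q → A` exhibits the Courant algebroid `Q` as a Courant extension of the Lie algebroid
`A`: it is a morphism compatible with anchors and brackets and the sequence of sheaves
`0 → Ω¹_X → Q → A → 0` is exact; thus `p` identifies the Lie algebroid `coker π†` with `A`. -/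
structure IsCourantExtension {Q A : OMod K X} (S : CourantStr Q) (L : LieStr A)
    (p : OMod.Hom Q A) : Prop where
  anchor_comp : ∀ {U : Opens X} (q : Q.sec U), L.anchor.app U (p.app U q) = S.anchor.app U q
  map_br : ∀ {U : Opens X} (q r : Q.sec U),
    p.app U (S.br q r) = L.br (p.app U q) (p.app U r)
  injective : ∀ U : Opens X, Function.Injective (S.coanchor.app U)
  exact : ∀ (U : Opens X) (q : Q.sec U), p.app U q = 0 ↔ ∃ α, S.coanchor.app U α = q
  surjective : ∀ (U : Opens X) (a : A.sec U), ∀ x ∈ U, ∃ (V : Opens X) (h : V ≤ U) (q : Q.sec V),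
    x ∈ V ∧ p.app V q = A.res h a

/-- Courant extensions of a Lie algebroid. -/
structure CExt {A : OMod K X} (L : LieStr A) where
  mod : OMod K X
  str : CourantStr mod
  proj : OMod.Hom mod A
  isExt : IsCourantExtension str L proj

/-- Morphisms of Courant extensions: morphisms of Courant algebroids which are compatible with
the projections. -/
@[ext] structure CExt.Hom {A : OMod K X} {L : LieStr A} (E E' : CExt L) where
  hom : OMod.Hom E.mod E'.mod
  map_br : ∀ {U : Opens X} (q r : E.mod.sec U),
    hom.app U (E.str.br q r) = E'.str.br (hom.app U q) (hom.app U r)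
  map_pair : ∀ {U : Opens X} (q r : E.mod.sec U),
    E'.str.pair (hom.app U q) (hom.app U r) = E.str.pair q r
  anchor_comp : ∀ {U : Opens X} (q : E.mod.sec U),
    E'.str.anchor.app U (hom.app U q) = E.str.anchor.app U q
  map_coanchor : ∀ {U : Opens X} (α : (formSheaf K X).sec U),
    hom.app U (E.str.coanchor.app U α) = E'.str.coanchor.app U α
  proj_comp : ∀ {U : Opens X} (q : E.mod.sec U), E'.proj.app U (hom.app U q) = E.proj.app U q

/-- The category of Courant extensions of a Lie algebroid. -/
instance {A : OMod K X} (L : LieStr A) : CategoryTheory.Category (CExt L) where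
  Hom E E' := CExt.Hom E E'
  id E := ⟨OMod.Hom.id _, fun _ _ ↦ rfl, fun _ _ ↦ rfl, fun _ ↦ rfl, fun _ ↦ rfl, fun _ ↦ rfl⟩
  comp {E E' E''} φ ψ := ⟨ψ.hom.comp φ.hom,
    fun q r ↦ (congrArg _ (φ.map_br q r)).trans (ψ.map_br _ _),
    fun q r ↦ (ψ.map_pair _ _).trans (φ.map_pair q r),
    fun q ↦ (ψ.anchor_comp _).trans (φ.anchor_comp q),
    fun α ↦ (congrArg _ (φ.map_coanchor α)).trans (ψ.map_coanchor α),
    fun q ↦ (ψ.proj_comp _).trans (φ.proj_comp q)⟩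

/-! ### Sheafification -/

namespace PreMod

variable (P : PreMod K X)

/-- The open neighbourhoods of a point, ordered by reverse inclusion. -/
structure Nhd (X : Mfd.{u} 𝕜 n) (x : X) where
  U : Opens X
  mem : x ∈ U

instance (x : X) : Preorder (Nhd X x) where
  le i j := j.U ≤ i.U
  le_refl _ := le_rfl
  le_trans _ _ _ h k := le_trans k h

instance (x : X) : Nonempty (Nhd X x) := ⟨⟨⊤, trivial⟩⟩

instance (x : X) : IsDirectedOrder (Nhd X x) :=
  ⟨fun i j ↦ ⟨⟨i.U ⊓ j.U, i.mem, j.mem⟩, (inf_le_left : i.U ⊓ j.U ≤ i.U),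
    (inf_le_right : i.U ⊓ j.U ≤ j.U)⟩⟩

/-- The restriction maps between neighbourhoods. -/
def nhdRes (x : X) (i j : Nhd X x) (h : i ≤ j) : P.sec i.U →+ P.sec j.U :=
  (P.res (U := i.U) (V := j.U) h).toAddMonoidHom

instance (x : X) : DirectedSystem (fun i : Nhd X x ↦ P.sec i.U) (P.nhdRes x · · ·) where
  map_self _ s := P.res_refl s
  map_map _ _ _ h k s := P.res_res _ _ s

/-- The stalk of a presheaf of modules. -/
abbrev stalk (x : X) : Type u := DirectLimit (fun i : Nhd X x ↦ P.sec i.U) (P.nhdRes x)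

/-- The germ of a section. -/
def germ {U : Opens X} {x : X} (hx : x ∈ U) (s : P.sec U) : P.stalk x :=
  Quotient.mk _ ⟨⟨U, hx⟩, s⟩

lemma germ_res {U V : Opens X} (h : V ≤ U) {x : X} (hx : x ∈ V) (s : P.sec U) :
    P.germ hx (P.res h s) = P.germ (h hx) s :=
  (DirectLimit.eq_of_le (f := P.nhdRes x) (⟨⟨U, h hx⟩, s⟩ : Σ i : Nhd X x, P.sec i.U)
    ⟨V, hx⟩ h).symm

lemma germ_add {U : Opens X} {x : X} (hx : x ∈ U) (s t : P.sec U) :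
    P.germ hx (s + t) = P.germ hx s + P.germ hx t :=
  (DirectLimit.add_def (f := P.nhdRes x) (G := fun i : Nhd X x ↦ P.sec i.U) ⟨U, hx⟩ s t).symm

lemma germ_zero {U : Opens X} {x : X} (hx : x ∈ U) : P.germ hx (0 : P.sec U) = 0 :=
  (DirectLimit.zero_def (f := P.nhdRes x) (⟨U, hx⟩ : Nhd X x)).symm

lemma germ_neg {U : Opens X} {x : X} (hx : x ∈ U) (s : P.sec U) :
    P.germ hx (-s) = -P.germ hx s :=
  (DirectLimit.neg_def (f := P.nhdRes x) (G := fun i : Nhd X x ↦ P.sec i.U) ⟨U, hx⟩ s).symm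

lemma exists_germ {x : X} (z : P.stalk x) (V : Opens X) (hV : x ∈ V) :
    ∃ (U : Opens X) (_ : U ≤ V) (hx : x ∈ U) (s : P.sec U), z = P.germ hx s := by
  obtain ⟨i, s, rfl⟩ := DirectLimit.exists_eq_mk (P.nhdRes x) z
  have hx : x ∈ i.U ⊓ V := ⟨i.mem, hV⟩
  exact ⟨i.U ⊓ V, inf_le_right, hx, P.res inf_le_left s, (P.germ_res inf_le_left hx s).symm⟩

/-- Multiplication by a function on a germ. -/
def smulGerm {V : Opens X} (g : X.O K V) {x : X} (hx : x ∈ V) : P.stalk x → P.stalk x :=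
  DirectLimit.lift (P.nhdRes x)
    (fun i s ↦ P.germ (U := i.U ⊓ V) (x := x) (show x ∈ i.U ∧ x ∈ V from ⟨i.mem, hx⟩)
      (resO K (inf_le_right : i.U ⊓ V ≤ V) g • P.res (inf_le_left : i.U ⊓ V ≤ i.U) s))
    (fun i j h s ↦ by
      have h' : j.U ⊓ V ≤ i.U ⊓ V := inf_le_inf_right V h
      have hx' : x ∈ j.U ⊓ V := ⟨j.mem, hx⟩
      have e := P.germ_res h' hx'
        (resO K (inf_le_right : i.U ⊓ V ≤ V) g • P.res (inf_le_left : i.U ⊓ V ≤ i.U) s)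
      rw [map_smulₛₗ, P.res_res] at e
      refine e.symm.trans ?_
      change P.germ hx' _ = P.germ hx'
        (resO K (inf_le_right : j.U ⊓ V ≤ V) g • P.res (inf_le_left : j.U ⊓ V ≤ j.U) (P.res h s))
      rw [P.res_res]
      rfl)

lemma smulGerm_germ {V U : Opens X} (g : X.O K V) (h : U ≤ V) {x : X} (hx : x ∈ U)
    (s : P.sec U) : P.smulGerm g (h hx) (P.germ hx s) = P.germ hx (resO K h g • s) := by
  have hx' : x ∈ U ⊓ V := ⟨hx, h hx⟩
  change P.germ hx' (resO K (inf_le_right : U ⊓ V ≤ V) g • P.res (inf_le_left : U ⊓ V ≤ U) s) = _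
  rw [← P.germ_res (inf_le_left : U ⊓ V ≤ U) hx' (resO K h g • s), map_smulₛₗ]
  rfl

/-- Sections over `V` of the sheaf associated with `P`: families of germs which are locally given
by sections of `P`. -/
def shSec (V : Opens X) : AddSubgroup (∀ x : V, P.stalk x) where
  carrier := {t | ∀ x : V, ∃ (W : Opens X) (h : W ≤ V) (_ : (x : X) ∈ W) (s : P.sec W),
    ∀ z : W, t ⟨z, h z.2⟩ = P.germ z.2 s}
  add_mem' {a b} ha hb x := by
    obtain ⟨W, h, hx, s, hs⟩ := ha x
    obtain ⟨W', h', hx', s', hs'⟩ := hb x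
    refine ⟨W ⊓ W', inf_le_left.trans h, ⟨hx, hx'⟩, P.res inf_le_left s + P.res inf_le_right s',
      fun z ↦ ?_⟩
    rw [germ_add, germ_res, germ_res, ← hs ⟨z, z.2.1⟩, ← hs' ⟨z, z.2.2⟩]
    rfl
  zero_mem' x := ⟨V, le_rfl, x.2, 0, fun z ↦ (P.germ_zero z.2).symm⟩
  neg_mem' {a} ha x := by
    obtain ⟨W, h, hx, s, hs⟩ := ha x
    refine ⟨W, h, hx, -s, fun z ↦ ?_⟩
    rw [germ_neg, ← hs z]
    rfl

instance (V : Opens X) : Module (X.O K V) (P.shSec V) where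
  smul g t := ⟨fun x ↦ P.smulGerm g x.2 (t.1 x), fun x ↦ by
    obtain ⟨W, h, hx, s, hs⟩ := t.2 x
    refine ⟨W, h, hx, resO K h g • s, fun z ↦ ?_⟩
    rw [← P.smulGerm_germ g h z.2, ← hs z]⟩
  one_smul t := Subtype.ext <| funext fun x ↦ by
    obtain ⟨U, h, hx, s, hs⟩ := P.exists_germ (t.1 x) V x.2
    change P.smulGerm 1 x.2 (t.1 x) = t.1 x
    rw [hs, P.smulGerm_germ _ h, map_one, one_smul]
  mul_smul a b t := Subtype.ext <| funext fun x ↦ by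
    obtain ⟨U, h, hx, s, hs⟩ := P.exists_germ (t.1 x) V x.2
    change P.smulGerm (a * b) x.2 (t.1 x) = P.smulGerm a x.2 (P.smulGerm b x.2 (t.1 x))
    rw [hs, P.smulGerm_germ _ h, P.smulGerm_germ _ h, P.smulGerm_germ _ h, map_mul, mul_smul]
  smul_zero a := Subtype.ext <| funext fun x ↦ by
    change P.smulGerm a x.2 (0 : P.stalk x) = 0
    rw [← P.germ_zero x.2, P.smulGerm_germ _ le_rfl, smul_zero]
  zero_smul t := Subtype.ext <| funext fun x ↦ by
    obtain ⟨U, h, hx, s, hs⟩ := P.exists_germ (t.1 x) V x.2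
    change P.smulGerm 0 x.2 (t.1 x) = 0
    rw [hs, P.smulGerm_germ _ h, map_zero, zero_smul, germ_zero]
  smul_add a t t' := Subtype.ext <| funext fun x ↦ by
    obtain ⟨U, h, hx, s, hs⟩ := P.exists_germ (t.1 x) V x.2
    obtain ⟨U', h', hx', s', hs'⟩ := P.exists_germ (t'.1 x) U hx
    rw [← P.germ_res h' hx'] at hs
    change P.smulGerm a x.2 (t.1 x + t'.1 x) = P.smulGerm a x.2 (t.1 x) + P.smulGerm a x.2 (t'.1 x)
    rw [hs, hs', ← germ_add, P.smulGerm_germ _ (h'.trans h), P.smulGerm_germ _ (h'.trans h),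
      P.smulGerm_germ _ (h'.trans h), smul_add, germ_add]
  add_smul a b t := Subtype.ext <| funext fun x ↦ by
    obtain ⟨U, h, hx, s, hs⟩ := P.exists_germ (t.1 x) V x.2
    change P.smulGerm (a + b) x.2 (t.1 x) = P.smulGerm a x.2 (t.1 x) + P.smulGerm b x.2 (t.1 x)
    rw [hs, P.smulGerm_germ _ h, P.smulGerm_germ _ h, P.smulGerm_germ _ h, map_add, add_smul,
      germ_add]

/-- The sheaf of `𝒪_X`-modules associated with a presheaf of `𝒪_X`-modules. -/
def sheafify : OMod K X where
  sec V := P.shSec V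
  res {U V} h :=
    { toFun := fun t ↦ ⟨fun x ↦ t.1 ⟨x, h x.2⟩, fun x ↦ by
        obtain ⟨W, k, hx, s, hs⟩ := t.2 ⟨x, h x.2⟩
        refine ⟨W ⊓ V, inf_le_right, ⟨hx, x.2⟩, P.res inf_le_left s, fun z ↦ ?_⟩
        rw [germ_res, ← hs ⟨z, z.2.1⟩]⟩
      map_add' := fun _ _ ↦ rfl
      map_smul' := fun g t ↦ Subtype.ext <| funext fun x ↦ by
        obtain ⟨W, k, hx, s, hs⟩ := P.exists_germ (t.1 ⟨x, h x.2⟩) V x.2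
        change P.smulGerm g (h x.2) (t.1 ⟨x, h x.2⟩) = P.smulGerm (resO K h g) x.2 (t.1 ⟨x, h x.2⟩)
        rw [hs, P.smulGerm_germ _ (k.trans h), P.smulGerm_germ _ k]
        rfl }
  res_refl _ := rfl
  res_res _ _ _ := rfl
  sep s t hst := Subtype.ext <| funext fun x ↦ by
    obtain ⟨V, h, hx, e⟩ := hst x x.2
    exact congrFun (congrArg Subtype.val e) ⟨x, hx⟩
  glue {ι} V s hs := by
    have hmem : ∀ x : (⨆ i, V i : Opens X), ∃ i, (x : X) ∈ V i := fun x ↦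
      Opens.mem_iSup.1 x.2
    choose i hi using hmem
    have key : ∀ (j : ι) (x : (⨆ i, V i : Opens X)) (hx : (x : X) ∈ V j),
        (s (i x)).1 ⟨x, hi x⟩ = (s j).1 ⟨x, hx⟩ := fun j x hx ↦
      congrFun (congrArg Subtype.val (hs (i x) j)) ⟨x, hi x, hx⟩
    refine ⟨⟨fun x ↦ (s (i x)).1 ⟨x, hi x⟩, fun x ↦ ?_⟩, fun j ↦ ?_⟩
    · obtain ⟨W, k, hx, p, hp⟩ := (s (i x)).2 ⟨x, hi x⟩
      exact ⟨W, k.trans (le_iSup V (i x)), hx, p, fun z ↦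
        (key (i x) ⟨z, _⟩ (k z.2)).trans (hp z)⟩
    · exact Subtype.ext <| funext fun x ↦ key j ⟨x, le_iSup V j x.2⟩ x.2

/-- The section of the associated sheaf defined by a section of the presheaf. -/
def toSheaf {V : Opens X} (s : P.sec V) : P.sheafify.sec V :=
  (⟨fun x ↦ P.germ x.2 s, fun x ↦ ⟨V, le_rfl, x.2, s, fun _ ↦ rfl⟩⟩ : P.shSec V)

end PreMod

/-! ### Inverse images of modules -/

namespace Pull

variable (f : Mfd.Hom Y X) (M : OMod K X)

/-- Sections of `M` over the open sets containing `f(V)`. -/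
abbrev Gen (V : Opens Y) : Type u := Σ U : {U : Opens X // V ≤ f.preim U}, M.sec U.1

/-- The relations which present `colim_{U ⊇ f(V)} 𝒪_Y(V) ⊗_{𝒪_X(U)} M(U)` as a quotient of the free
`𝒪_Y(V)`-module on the pairs `(U, q)`. -/
inductive Rel (V : Opens Y) : (Gen f M V →₀ Y.O K V) → Prop
  | res {U U' : Opens X} (h : V ≤ f.preim U) (k : U ≤ U') (h' : V ≤ f.preim U') (q : M.sec U') :
      Rel V (Finsupp.single ⟨⟨U', h'⟩, q⟩ 1 - Finsupp.single ⟨⟨U, h⟩, M.res k q⟩ 1)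
  | add {U : Opens X} (h : V ≤ f.preim U) (q q' : M.sec U) :
      Rel V (Finsupp.single ⟨⟨U, h⟩, q + q'⟩ 1 - Finsupp.single ⟨⟨U, h⟩, q⟩ 1 -
        Finsupp.single ⟨⟨U, h⟩, q'⟩ 1)
  | smul {U : Opens X} (h : V ≤ f.preim U) (g : X.O K U) (q : M.sec U) :
      Rel V (Finsupp.single ⟨⟨U, h⟩, g • q⟩ 1 - Finsupp.single ⟨⟨U, h⟩, q⟩ (f.pullO K h g))

/-- The module `colim_{U ⊇ f(V)} 𝒪_Y(V) ⊗_{𝒪_X(U)} M(U)`; the sheaf associated with the presheaf of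
these modules is `f^*M = 𝒪_Y ⊗_{f⁻¹𝒪_X} f⁻¹M`. -/
abbrev PSec (V : Opens Y) : Type u :=
  (Gen f M V →₀ Y.O K V) ⧸ Submodule.span (Y.O K V) {c | Rel f M V c}

/-- The element `1 ⊗ q`. -/
def pure {U : Opens X} {V : Opens Y} (h : V ≤ f.preim U) (q : M.sec U) : PSec f M V :=
  Submodule.Quotient.mk (Finsupp.single ⟨⟨U, h⟩, q⟩ 1)

variable {f M}

lemma pure_res {U U' : Opens X} {V : Opens Y} (h : V ≤ f.preim U) (k : U ≤ U')
    (h' : V ≤ f.preim U') (q : M.sec U') : pure f M h (M.res k q) = pure f M h' q :=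
  ((Submodule.Quotient.eq _).2 (Submodule.subset_span (Rel.res h k h' q))).symm

lemma pure_add {U : Opens X} {V : Opens Y} (h : V ≤ f.preim U) (q q' : M.sec U) :
    pure f M h (q + q') = pure f M h q + pure f M h q' := by
  have := (Submodule.Quotient.mk_eq_zero (Submodule.span (Y.O K V) {c | Rel f M V c})).2
    (Submodule.subset_span (Rel.add h q q'))
  rw [Submodule.Quotient.mk_sub, Submodule.Quotient.mk_sub, sub_sub, sub_eq_zero] at this
  exact this

lemma pure_smul {U : Opens X} {V : Opens Y} (h : V ≤ f.preim U) (g : X.O K U) (q : M.sec U) :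
    pure f M h (g • q) = f.pullO K h g • pure f M h q := by
  have := (Submodule.Quotient.mk_eq_zero (Submodule.span (Y.O K V) {c | Rel f M V c})).2
    (Submodule.subset_span (Rel.smul h g q))
  rw [Submodule.Quotient.mk_sub, sub_eq_zero] at this
  refine this.trans ?_
  rw [pure, ← Submodule.Quotient.mk_smul, Finsupp.smul_single, smul_eq_mul, mul_one]

/-- The semilinear map out of `PSec` determined by its values on the elements `1 ⊗ q`. -/
def lift {V : Opens Y} {R : Type*} [CommRing R] (τ : Y.O K V →+* R) {N : Type*} [AddCommGroup N]
    [Module R N] (φ : ∀ {U : Opens X}, V ≤ f.preim U → M.sec U → N)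
    (hres : ∀ {U U' : Opens X} (h : V ≤ f.preim U) (k : U ≤ U') (h' : V ≤ f.preim U')
      (q : M.sec U'), φ h (M.res k q) = φ h' q)
    (hadd : ∀ {U : Opens X} (h : V ≤ f.preim U) (q q' : M.sec U), φ h (q + q') = φ h q + φ h q')
    (hsmul : ∀ {U : Opens X} (h : V ≤ f.preim U) (g : X.O K U) (q : M.sec U),
      φ h (g • q) = τ (f.pullO K h g) • φ h q) : PSec f M V →ₛₗ[τ] N :=
  Submodule.liftQ _
    { toFun := fun c ↦ c.sum fun i a ↦ τ a • φ i.1.2 i.2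
      map_add' := fun c c' ↦ Finsupp.sum_add_index' (by simp) (by simp [add_smul])
      map_smul' := fun a c ↦ by
        rw [Finsupp.sum_smul_index (by simp), Finsupp.smul_sum]
        simp [mul_smul] }
    (Submodule.span_le.2 <| by
      rintro c (⟨h, k, h', q⟩ | ⟨h, q, q'⟩ | ⟨h, g, q⟩) <;>
      simp only [SetLike.mem_coe, LinearMap.mem_ker, map_sub]
      · simp [hres h k h']
      · simp [hadd]
      · simp [hsmul])

lemma lift_pure {V : Opens Y} {R : Type*} [CommRing R] (τ : Y.O K V →+* R) {N : Type*}
    [AddCommGroup N] [Module R N] (φ : ∀ {U : Opens X}, V ≤ f.preim U → M.sec U → N) (hres hadd)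
    (hsmul) {U : Opens X} (h : V ≤ f.preim U) (q : M.sec U) :
    lift τ φ hres hadd hsmul (pure f M h q) = φ h q := by
  refine (Finsupp.sum_single_index (a := (⟨⟨U, h⟩, q⟩ : Gen f M V)) (b := (1 : Y.O K V))
    (h := fun (i : Gen f M V) a ↦ τ a • φ i.1.2 i.2) (by simp)).trans ?_
  simp

/-- The module `PSec` is generated by the elements `1 ⊗ q`. -/
lemma induct {V : Opens Y} {C : PSec f M V → Prop} (s : PSec f M V) (zero : C 0)
    (add : ∀ s t, C s → C t → C (s + t))
    (smul : ∀ {U : Opens X} (h : V ≤ f.preim U) (g : Y.O K V) (q : M.sec U),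
      C (g • pure f M h q)) : C s := by
  obtain ⟨c, rfl⟩ := Submodule.Quotient.mk_surjective _ s
  induction c using Finsupp.induction_linear with
  | zero => exact zero
  | add c c' hc hc' => rw [Submodule.Quotient.mk_add]; exact add _ _ hc hc'
  | single i a =>
    have e : (Submodule.Quotient.mk (Finsupp.single i a) : PSec f M V) =
        a • pure f M i.1.2 i.2 := by
      rw [pure, ← Submodule.Quotient.mk_smul, Finsupp.smul_single, smul_eq_mul, mul_one]
    rw [e]
    exact smul _ _ _

variable (f M) in
/-- Restriction of the modules `PSec`. -/
def res {V W : Opens Y} (k : W ≤ V) : PSec f M V →ₛₗ[resO K k] PSec f M W :=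
  lift (resO K k) (fun h q ↦ pure f M (k.trans h) q)
    (fun _ j _ q ↦ pure_res _ j _ q) (fun _ q q' ↦ pure_add _ q q')
    (fun _ g q ↦ pure_smul _ g q)

lemma res_pure {U : Opens X} {V W : Opens Y} (k : W ≤ V) (h : V ≤ f.preim U) (q : M.sec U) :
    res f M k (pure f M h q) = pure f M (k.trans h) q := lift_pure ..

/-- The value at `y` of the section `f^*(σ)(s)` of `f^*𝒯_X`, for a morphism `σ : M → 𝒯_X`: the
tangent vector `∑ h_i(y) σ(q_i)_{f(y)}` for `s = ∑ h_i ⊗ q_i`. -/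
def anchorAt (σ : OMod.Hom M (tangentSheaf K X)) {V : Opens Y} (y : V) :
    PSec f M V →ₛₗ[evalO K y] X.Tan K (f y) :=
  lift (evalO K y) (fun {U} h q ↦ (σ.app U q).1 ⟨f y, h y.2⟩)
    (fun _ k _ q ↦ by rw [σ.naturality k q]; rfl) (fun _ q q' ↦ by rw [map_add]; rfl)
    (fun _ g q ↦ by rw [map_smul]; rfl)

lemma anchorAt_pure (σ : OMod.Hom M (tangentSheaf K X)) {U : Opens X} {V : Opens Y} (y : V)
    (h : V ≤ f.preim U) (q : M.sec U) :
    anchorAt σ y (pure f M h q) = (σ.app U q).1 ⟨f y, h y.2⟩ := lift_pure ..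

end Pull

open Pull

lemma Pull.res_refl (f : Mfd.Hom Y X) {M : OMod K X} {V : Opens Y} (s : PSec f M V) :
    Pull.res f M le_rfl s = s := by
  induction s using Pull.induct with
  | zero => rw [map_zero]
  | add s t hs ht => rw [map_add, hs, ht]
  | smul h g q => rw [map_smulₛₗ, res_pure]; rfl

lemma Pull.res_res (f : Mfd.Hom Y X) {M : OMod K X} {V W W' : Opens Y} (h : W ≤ V) (k : W' ≤ W)
    (s : PSec f M V) : Pull.res f M k (Pull.res f M h s) = Pull.res f M (k.trans h) s := by
  induction s using Pull.induct with
  | zero => simp only [map_zero]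
  | add s t hs ht => simp only [map_add, hs, ht]
  | smul j g q => rw [map_smulₛₗ, map_smulₛₗ, map_smulₛₗ, res_pure, res_pure, res_pure]; rfl

lemma Pull.anchorAt_res (f : Mfd.Hom Y X) {M : OMod K X} (σ : OMod.Hom M (tangentSheaf K X))
    {V W : Opens Y} (k : W ≤ V) (y : W) (s : PSec f M V) :
    anchorAt σ y (Pull.res f M k s) = anchorAt σ (⟨y, k y.2⟩ : V) s := by
  induction s using Pull.induct with
  | zero => simp only [map_zero]
  | add s t hs ht => simp only [map_add, hs, ht]
  | smul j g q =>
    rw [map_smulₛₗ, map_smulₛₗ, map_smulₛₗ, res_pure, anchorAt_pure, anchorAt_pure]; rfl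

/-- The pairs `(s, ξ)` of `s = ∑ h_i ⊗ q_i` in `colim_{U ⊇ f(V)} 𝒪_Y(V) ⊗_{𝒪_X(U)} M(U)` and a
vector field `ξ` on `V` with `f^*(σ)(s) = df(ξ)` (an equality of vector fields along `f`, i.e. of
sections of `f^*𝒯_X`). -/
def plusSub (f : Mfd.Hom Y X) {M : OMod K X} (σ : OMod.Hom M (tangentSheaf K X)) (V : Opens Y) :
    Submodule (Y.O K V) (PSec f M V × (tangentSheaf K Y).sec V) where
  carrier := {t | ∀ y : V, anchorAt σ y t.1 = f.push K y (t.2.1 y)}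
  add_mem' {a b} ha hb y := by
    change anchorAt σ y (a.1 + b.1) = f.push K y (a.2.1 y + b.2.1 y)
    rw [map_add, map_add, ha, hb]
  zero_mem' y := by
    change anchorAt σ y 0 = f.push K y 0
    rw [map_zero, map_zero]
  smul_mem' g a ha y := by
    change anchorAt σ y (g • a.1) = f.push K y (evalO K y g • a.2.1 y)
    rw [map_smulₛₗ, map_smul, ha]

/-- The presheaf of the pairs `(s, ξ)` above. -/
def prePlus (f : Mfd.Hom Y X) {M : OMod K X} (σ : OMod.Hom M (tangentSheaf K X)) : PreMod K Y where
  sec V := plusSub f σ V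
  group V := Submodule.addCommGroup _
  module V := Submodule.module _
  res {V W} k :=
    { toFun := fun t ↦ ⟨(Pull.res f M k t.1.1, (tangentSheaf K Y).res k t.1.2), fun y ↦
        (Pull.anchorAt_res f σ k y t.1.1).trans (t.2 ⟨y, k y.2⟩)⟩
      map_add' := fun a b ↦ Subtype.ext (Prod.ext (map_add _ _ _) rfl)
      map_smul' := fun g a ↦ Subtype.ext (Prod.ext (map_smulₛₗ (Pull.res f M k) g a.1.1) rfl) }
  res_refl t := Subtype.ext <| Prod.ext (Pull.res_refl f t.1.1) rfl
  res_res h k t := Subtype.ext <| Prod.ext (Pull.res_res f h k t.1.1) rfl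

/-- The inverse image `f^+M = 𝒯_Y ×_{f^*𝒯_X} f^*M` of a sheaf of modules with an anchor
`σ : M → 𝒯_X`.  (Sheafification commutes with fibre products.) -/
def plus (f : Mfd.Hom Y X) {M : OMod K X} (σ : OMod.Hom M (tangentSheaf K X)) : OMod K Y :=
  (prePlus f σ).sheafify

/-- The submodule of `Ω¹_Y(V) × f^+Q(V)` generated by the elements `(f^*α, -(1 ⊗ π†α), 0)` for
one-forms `α` on open sets `U` with `f(V) ⊆ U`. -/
def courSub (f : Mfd.Hom Y X) {Q : OMod K X} (S : CourantStr Q) (V : Opens Y) :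
    Submodule (Y.O K V) ((formSheaf K Y).sec V × (prePlus f S.anchor).sec V) :=
  Submodule.span _ {t | ∃ (U : Opens X) (h : V ≤ f.preim U) (α : (formSheaf K X).sec U),
    IsFormPullback f h t.1 α ∧ t.2.1.1 = -Pull.pure f Q h (S.coanchor.app U α) ∧ t.2.1.2 = 0}

lemma courSub_res (f : Mfd.Hom Y X) {Q : OMod K X} (S : CourantStr Q) {V W : Opens Y} (k : W ≤ V)
    {t} (ht : t ∈ courSub f S V) :
    ((formSheaf K Y).res k t.1, (prePlus f S.anchor).res k t.2) ∈ courSub f S W := by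
  induction ht using Submodule.span_induction with
  | mem t ht =>
    obtain ⟨U, h, α, h1, h2, h3⟩ := ht
    refine Submodule.subset_span ⟨U, k.trans h, α, fun y ↦ h1 ⟨y, k y.2⟩, ?_, ?_⟩
    · change Pull.res f Q k t.2.1.1 = _
      rw [h2, map_neg, res_pure]
    · change (tangentSheaf K Y).res k t.2.1.2 = _
      rw [h3, map_zero]
  | zero =>
    convert (courSub f S W).zero_mem using 1
    exact Prod.ext (map_zero _) (map_zero _)
  | add a b _ _ ha hb => simpa using (courSub f S W).add_mem ha hb
  | smul g a _ ha => simpa [map_smulₛₗ] using (courSub f S W).smul_mem (resO K k g) ha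

/-- The presheaf quotient of `Ω¹_Y × f^+Q` by the submodules `courSub`. -/
def preCour (f : Mfd.Hom Y X) {Q : OMod K X} (S : CourantStr Q) : PreMod K Y where
  sec V := ((formSheaf K Y).sec V × (prePlus f S.anchor).sec V) ⧸ courSub f S V
  group V := Submodule.Quotient.addCommGroup _
  module V := Submodule.Quotient.module _
  res {V W} k := Submodule.mapQ _ _
    { toFun := fun t ↦ ((formSheaf K Y).res k t.1, (prePlus f S.anchor).res k t.2)
      map_add' := fun a b ↦ Prod.ext (map_add _ _ _) (map_add _ _ _)
      map_smul' := fun g a ↦ Prod.ext (map_smulₛₗ _ _ _) (map_smulₛₗ _ _ _) }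
    (fun _ ht ↦ courSub_res f S k ht)
  res_refl t := by
    obtain ⟨t, rfl⟩ := Submodule.Quotient.mk_surjective _ t
    exact congrArg _ (Prod.ext (PreMod.res_refl _ _) (PreMod.res_refl _ _))
  res_res h k t := by
    obtain ⟨t, rfl⟩ := Submodule.Quotient.mk_surjective _ t
    exact congrArg _ (Prod.ext (PreMod.res_res _ _ _ _) (PreMod.res_res _ _ _ _))

/-- The sheaf `f^{++}Q`: the quotient of `Ω¹_Y ⊕ (𝒯_Y ×_{f^*𝒯_X} f^*Q)` by the image of
`f^*Ω¹_X` under `(df^∨, -f^*π†, 0)`. -/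
def plusPlus (f : Mfd.Hom Y X) {Q : OMod K X} (S : CourantStr Q) : OMod K Y :=
  (preCour f S).sheafify

/-- The finite sum `∑ h_i ⊗ q_i`. -/
def pullSum (f : Mfd.Hom Y X) {M : OMod K X} {U : Opens X} {V : Opens Y} (h : V ≤ f.preim U) {k : ℕ}
    (a : Fin k → Y.O K V) (q : Fin k → M.sec U) : PSec f M V :=
  ∑ i, a i • Pull.pure f M h (q i)

/-- The section of `f^+M` given by a pair `(s, ξ)`. -/
def plusMk (f : Mfd.Hom Y X) {M : OMod K X} (σ : OMod.Hom M (tangentSheaf K X)) {V : Opens Y}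
    (s : PSec f M V) (ξ : (tangentSheaf K Y).sec V) (hs : (s, ξ) ∈ plusSub f σ V) :
    (plus f σ).sec V :=
  (prePlus f σ).toSheaf ⟨(s, ξ), hs⟩

/-- The section `[α, s, ξ]` of `f^{++}Q`. -/
def courMk (f : Mfd.Hom Y X) {Q : OMod K X} (S : CourantStr Q) {V : Opens Y}
    (α : (formSheaf K Y).sec V) (s : PSec f Q V) (ξ : (tangentSheaf K Y).sec V)
    (hs : (s, ξ) ∈ plusSub f S.anchor V) : (plusPlus f S).sec V :=
  (preCour f S).toSheaf (Submodule.Quotient.mk (α, ⟨(s, ξ), hs⟩))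

/-! ### The structures on the inverse images -/

/-- The Lie algebroid structure `B` on `f^+A` is the inverse image of that of `A`: the anchor is
the projection to `𝒯_Y` and
`[(∑ g_i ⊗ a_i, ξ), (∑ h_j ⊗ b_j, η)] =
  (∑ g_i h_j ⊗ [a_i, b_j] + ∑ ξ(h_j) ⊗ b_j - ∑ η(g_i) ⊗ a_i, [ξ, η])`. -/
structure IsLieInverseImage (f : Mfd.Hom Y X) {A : OMod K X} (L : LieStr A)
    (B : LieStr (plus f L.anchor)) : Prop where
  anchor_mk : ∀ {V : Opens Y} (s : PSec f A V) (ξ : (tangentSheaf K Y).sec V) (hs),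
    B.anchor.app V (plusMk f L.anchor s ξ hs) = ξ
  br_mk : ∀ {U : Opens X} {V : Opens Y} (hU : V ≤ f.preim U) {k l : ℕ}
    (g : Fin k → Y.O K V) (a : Fin k → A.sec U) (ξ : (tangentSheaf K Y).sec V) (hs)
    (h : Fin l → Y.O K V) (b : Fin l → A.sec U) (η : (tangentSheaf K Y).sec V) (ht),
    ∃ ζ : (tangentSheaf K Y).sec V, ∃ hr, IsBracket ζ ξ η ∧
      B.br (plusMk f L.anchor (pullSum f hU g a) ξ hs) (plusMk f L.anchor (pullSum f hU h b) η ht) =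
        plusMk f L.anchor
          ((∑ i, ∑ j, (g i * h j) • Pull.pure f A hU (L.br (a i) (b j))) +
            pullSum f hU (fun j ↦ VF.app ξ (h j)) b - pullSum f hU (fun i ↦ VF.app η (g i)) a) ζ hr

/-- The Courant algebroid structure `R` on `f^{++}Q` is the inverse image of that of `Q`:
the anchor is `[α, s, ξ] ↦ ξ`, the co-anchor is `β ↦ [β, 0, 0]`,
`⟨[α, ∑ g_i ⊗ q_i, ξ], [β, ∑ h_j ⊗ p_j, η]⟩ = ι_ξ β + ι_η α + ∑ g_i h_j f^*⟨q_i, p_j⟩` and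
`{[α, ∑ g_i ⊗ q_i, ξ], [β, ∑ h_j ⊗ p_j, η]} =
  [-ι_η dα + L_ξ β + ∑ h_j f^*⟨q_i, p_j⟩ dg_i,
    ∑ g_i h_j ⊗ {q_i, p_j} + ∑ ξ(h_j) ⊗ p_j - ∑ η(g_i) ⊗ q_i, [ξ, η]]`. -/
structure IsCourantInverseImage (f : Mfd.Hom Y X) {Q : OMod K X} (S : CourantStr Q)
    (R : CourantStr (plusPlus f S)) : Prop where
  anchor_mk : ∀ {V : Opens Y} (α : (formSheaf K Y).sec V) (s : PSec f Q V)
    (ξ : (tangentSheaf K Y).sec V) (hs), R.anchor.app V (courMk f S α s ξ hs) = ξ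
  coanchor_eq : ∀ {V : Opens Y} (β : (formSheaf K Y).sec V),
    R.coanchor.app V β = courMk f S β 0 0 (zero_mem _)
  pair_mk : ∀ {U : Opens X} {V : Opens Y} (hU : V ≤ f.preim U) {k l : ℕ}
    (α : (formSheaf K Y).sec V) (g : Fin k → Y.O K V) (q : Fin k → Q.sec U)
    (ξ : (tangentSheaf K Y).sec V) (hs)
    (β : (formSheaf K Y).sec V) (h : Fin l → Y.O K V) (p : Fin l → Q.sec U)
    (η : (tangentSheaf K Y).sec V) (ht),
    R.pair (courMk f S α (pullSum f hU g q) ξ hs) (courMk f S β (pullSum f hU h p) η ht) =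
      Form.contract ξ β + Form.contract η α +
        ∑ i, ∑ j, g i * h j * f.pullO K hU (S.pair (q i) (p j))
  br_mk : ∀ {U : Opens X} {V : Opens Y} (hU : V ≤ f.preim U) {k l : ℕ}
    (α : (formSheaf K Y).sec V) (g : Fin k → Y.O K V) (q : Fin k → Q.sec U)
    (ξ : (tangentSheaf K Y).sec V) (hs)
    (β : (formSheaf K Y).sec V) (h : Fin l → Y.O K V) (p : Fin l → Q.sec U)
    (η : (tangentSheaf K Y).sec V) (ht),
    ∃ (α' β' : (formSheaf K Y).sec V) (ζ : (tangentSheaf K Y).sec V), ∃ hr,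
      IsContractD α' η α ∧ IsLieDeriv β' ξ β ∧ IsBracket ζ ξ η ∧
      R.br (courMk f S α (pullSum f hU g q) ξ hs) (courMk f S β (pullSum f hU h p) η ht) =
        courMk f S
          (-α' + β' + ∑ i, ∑ j, (h j * f.pullO K hU (S.pair (q i) (p j))) •
            (show (formSheaf K Y).sec V from Mfd.d (g i)))
          ((∑ i, ∑ j, (g i * h j) • Pull.pure f Q hU (S.br (q i) (p j))) +
            pullSum f hU (fun j ↦ VF.app ξ (h j)) p - pullSum f hU (fun i ↦ VF.app η (g i)) q) ζ hr

/-- The morphism `r : f^{++}Q → f^+A` is induced by `p : Q → A`: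
`[α, ∑ g_i ⊗ q_i, ξ] ↦ (∑ g_i ⊗ p(q_i), ξ)`. -/
def IsInducedProj (f : Mfd.Hom Y X) {Q A : OMod K X} (S : CourantStr Q) (L : LieStr A)
    (p : OMod.Hom Q A) (r : OMod.Hom (plusPlus f S) (plus f L.anchor)) : Prop :=
  ∀ {U : Opens X} {V : Opens Y} (hU : V ≤ f.preim U) {k : ℕ} (α : (formSheaf K Y).sec V)
    (g : Fin k → Y.O K V) (q : Fin k → Q.sec U) (ξ : (tangentSheaf K Y).sec V) (hs),
    ∃ ht, r.app V (courMk f S α (pullSum f hU g q) ξ hs) =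
      plusMk f L.anchor (pullSum f hU g (fun i ↦ p.app U (q i))) ξ ht

/-- The morphism `ψ : f^{++}Q → f^{++}Q'` is induced by `φ : Q → Q'`:
`[α, ∑ g_i ⊗ q_i, ξ] ↦ [α, ∑ g_i ⊗ φ(q_i), ξ]`. -/
def IsInducedMap (f : Mfd.Hom Y X) {Q Q' : OMod K X} (S : CourantStr Q) (S' : CourantStr Q')
    (φ : OMod.Hom Q Q') (ψ : OMod.Hom (plusPlus f S) (plusPlus f S')) : Prop :=
  ∀ {U : Opens X} {V : Opens Y} (hU : V ≤ f.preim U) {k : ℕ} (α : (formSheaf K Y).sec V)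
    (g : Fin k → Y.O K V) (q : Fin k → Q.sec U) (ξ : (tangentSheaf K Y).sec V) (hs),
    ∃ ht, ψ.app V (courMk f S α (pullSum f hU g q) ξ hs) =
      courMk f S' α (pullSum f hU g (fun i ↦ φ.app U (q i))) ξ ht

end Modules

end

set_option linter.unusedSectionVars false
set_option linter.unusedVariables false

open Mfd Pull

noncomputable section

/-! ### Cartan calculus and brackets with formal coefficients -/

/-! The difficulty is that ∑ g_i ⊗ q_i does not determine the g_i and q_i, while the bracket
differentiates the g_i. So the computation is first made where representatives are unique: on
triples (α, x, ξ), with x in the free 𝒪_Y(V)-module on pairs (U, q), where q is a section over an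
open U with f(V) ⊆ U. There the bracket `br₃` and the pairing `pr₃` are biadditive by construction.
The Leibniz rule in the second argument and the symmetry of the pairing hold for the triples
themselves. The Jacobi identity and {u,v} + {v,u} = d⟨u,v⟩ hold for classes in any module to which
forms and generators map compatibly (`cls_br₃_jacobi`, `cls_br₃_swap`). All of this is formal Cartan
calculus.

The fibre product condition df(ξ) = ∑ g_i σ(q_i) is used in the equivalent form ξ(f^*g) = ∑ g_i
f^*(σ(q_i)(g)) for local functions g on X (`app_pullO_of_mem_raw`, `mem_raw_of_dir`). It follows
that triples in the fibre product are closed under the bracket (`tbr_mem_raw`) and that ξ(f^*⟨p,r⟩)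
= ∑ g_i f^*(⟨{q_i,p},r⟩ + ⟨p,{q_i,r}⟩) (`app_gpair`). The latter is all that invariance and the
Jacobi identity need to know about anchors.

For well-definedness, triples with ξ = 0 and zero class must have null brackets with all triples in
the fibre product. The bracket is not linear in its first argument, but the defect is built from the
pairing and the class (`cls_smul_br₃`); hence the elements that are null against a fixed v form a
submodule (`nullSub`), and only generators of the relations need a test. The tensor relation for g q
is handled by the fibre product condition (`rel_mem_tnull`). For the relation (f^*α, -1 ⊗ π†α) one
has {π†α, p} = -π†(ι_{π(p)} dα), and what remains is that d commutes with f^* (`brTerm_coanchor`,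
`ctrD_pullForm`). The other order of the bracket follows from {u,v} + {v,u} = d⟨u,v⟩.

A Lie algebroid is treated as a bracket with zero pairing whose forms are sent to 0, so one
construction, `TripleModel`, serves f^+ and f^{++}. The presheaf of triples is locally surjective
onto the sheaf, and operations that vanish on its kernel descend by gluing (`exists_op`,
`exists_hom`). Uniqueness holds because sections are locally given by triples, on which the formulas
leave no choice.

Local freeness enters only in exactness. It gives local 𝒪_X-linear splittings Q ≅ Ω¹_X ⊕ A
(`exists_localSplitting`). The retraction onto forms pulls back to ρ : f^*Q → Ω¹_Y, and (α, s) ↦ α +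
ρ(s) respects the relations, which gives injectivity and exactness in the middle; the pulled-back
lift A → Q gives surjectivity. Finally, a morphism of extensions acts on the generators of triples,
preserves every term of the formulas, and so induces the functor. -/

/-- The algebraic operations on functions, vector fields and one-forms. -/
structure CartanCalculus (R T Ω : Type*) [CommRing R] [AddCommGroup T] [Module R T]
    [AddCommGroup Ω] [Module R Ω] where
  app : T →+ R →+ R
  bra : T →+ T →+ T
  d : R →+ Ω
  ι : T →ₗ[R] Ω →ₗ[R] R
  lie : T →+ Ω →+ Ω
  app_mul : ∀ ξ g h, app ξ (g * h) = app ξ g * h + g * app ξ h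
  smul_app : ∀ g ξ h, app (g • ξ) h = g * app ξ h
  bra_app : ∀ ξ η g, app (bra ξ η) g = app ξ (app η g) - app η (app ξ g)
  bra_smul : ∀ ξ g η, bra ξ (g • η) = g • bra ξ η + app ξ g • η
  bra_swap : ∀ ξ η, bra η ξ = -bra ξ η
  bra_jacobi : ∀ ξ η ζ, bra ξ (bra η ζ) = bra (bra ξ η) ζ + bra η (bra ξ ζ)
  d_mul : ∀ g h, d (g * h) = g • d h + h • d g
  ι_d : ∀ ξ g, ι ξ (d g) = app ξ g
  lie_smul : ∀ ξ g α, lie ξ (g • α) = g • lie ξ α + app ξ g • α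
  smul_lie : ∀ g ξ α, lie (g • ξ) α = g • lie ξ α + ι ξ α • d g
  lie_d : ∀ ξ g, lie ξ (d g) = d (app ξ g)
  bra_lie : ∀ ξ η α, lie (bra ξ η) α = lie ξ (lie η α) - lie η (lie ξ α)
  ι_lie : ∀ ζ ξ α, ι ζ (lie ξ α) = app ξ (ι ζ α) - ι (bra ξ ζ) α

namespace CartanCalculus

variable {R T Ω : Type*} [CommRing R] [AddCommGroup T] [Module R T] [AddCommGroup Ω] [Module R Ω]
variable (𝒞 : CartanCalculus R T Ω)

/-- The form `ι_η dα`. -/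
def ctr (η : T) (α : Ω) : Ω := 𝒞.lie η α - 𝒞.d (𝒞.ι η α)

lemma ctr_add (η : T) (α β : Ω) : 𝒞.ctr η (α + β) = 𝒞.ctr η α + 𝒞.ctr η β := by
  simp only [ctr, map_add]; abel

lemma add_ctr (η ζ : T) (α : Ω) : 𝒞.ctr (η + ζ) α = 𝒞.ctr η α + 𝒞.ctr ζ α := by
  simp only [ctr, map_add, AddMonoidHom.add_apply, LinearMap.add_apply]; abel

@[simp] lemma ctr_zero (η : T) : 𝒞.ctr η 0 = 0 := by simp [ctr]

lemma ctr_neg (η : T) (α : Ω) : 𝒞.ctr η (-α) = -𝒞.ctr η α := by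
  simp only [ctr, map_neg]; abel

lemma smul_ctr (g : R) (η : T) (α : Ω) : 𝒞.ctr (g • η) α = g • 𝒞.ctr η α := by
  simp only [ctr, 𝒞.smul_lie, map_smul, LinearMap.smul_apply, smul_eq_mul, 𝒞.d_mul, smul_sub]
  abel

lemma ctr_smul (η : T) (g : R) (α : Ω) :
    𝒞.ctr η (g • α) = g • 𝒞.ctr η α + 𝒞.app η g • α - 𝒞.ι η α • 𝒞.d g := by
  simp only [ctr, 𝒞.lie_smul, map_smul, smul_eq_mul, 𝒞.d_mul, smul_sub]
  abel

lemma ctr_d (η : T) (g : R) : 𝒞.ctr η (𝒞.d g) = 0 := by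
  rw [ctr, 𝒞.lie_d, 𝒞.ι_d, sub_self]

/-- The commutator identity ι_{[ξ,ζ]} d = [L_ξ, ι_ζ d]; it follows from the one for Lie derivatives
because L_ξ commutes with d. -/
lemma ctr_bra (ξ ζ : T) (α : Ω) :
    𝒞.ctr (𝒞.bra ξ ζ) α = 𝒞.lie ξ (𝒞.ctr ζ α) - 𝒞.ctr ζ (𝒞.lie ξ α) := by
  simp only [ctr, 𝒞.bra_lie, map_sub, 𝒞.lie_d, 𝒞.ι_lie]
  abel

/-- ι_ξ dα and L_ξ α differ by an exact form, which ι_ζ d annihilates. This brings the form terms of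
the Jacobi identity to a common shape. -/
lemma ctr_ctr (ξ ζ : T) (α : Ω) : 𝒞.ctr ζ (𝒞.ctr ξ α) = 𝒞.ctr ζ (𝒞.lie ξ α) := by
  change 𝒞.ctr ζ (𝒞.lie ξ α - 𝒞.d (𝒞.ι ξ α)) = _
  rw [sub_eq_add_neg, 𝒞.ctr_add, 𝒞.ctr_neg, 𝒞.ctr_d, neg_zero, add_zero]

/-- Antisymmetry of dα. In the invariance of the pairing the two contractions of dα with η and ζ
appear in opposite orders and must cancel. -/
lemma ι_ctr_swap (η ζ : T) (α : Ω) : 𝒞.ι ζ (𝒞.ctr η α) = -𝒞.ι η (𝒞.ctr ζ α) := by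
  simp only [ctr, map_sub, 𝒞.ι_lie, 𝒞.ι_d, 𝒞.bra_swap ζ η, map_neg, LinearMap.neg_apply]
  abel

variable {Q : Type*}

/-- The biadditive extension of a map which is biadditive in the coefficients. -/
def bilift {R N Q : Type*} [Semiring R] [AddCommMonoid N] (φ : Q → Q → R →+ R →+ N) :
    (Q →₀ R) →+ (Q →₀ R) →+ N :=
  Finsupp.liftAddHom fun q ↦ (Finsupp.liftAddHom fun p ↦ (φ q p).flip).flip

@[simp] lemma bilift_single {R N Q : Type*} [Semiring R] [AddCommMonoid N]
    (φ : Q → Q → R →+ R →+ N) (q p : Q) (g h : R) :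
    bilift φ (Finsupp.single q g) (Finsupp.single p h) = φ q p g h := by
  simp [bilift]

lemma bilift_ext {R N Q : Type*} [Semiring R] [AddCommMonoid N] {φ ψ : (Q →₀ R) →+ (Q →₀ R) →+ N}
    (h : ∀ q p g k, φ (Finsupp.single q g) (Finsupp.single p k) =
      ψ (Finsupp.single q g) (Finsupp.single p k)) : φ = ψ :=
  Finsupp.addHom_ext fun q g ↦ Finsupp.addHom_ext fun p k ↦ h q p g k

/-! ### Bracket and pairing on triples with free coefficients -/

section Brackets

/-- The term `∑ h_j a(q_i, p_j) dg_i`. -/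
def formTerm (a : Q → Q → R) : (Q →₀ R) →+ (Q →₀ R) →+ Ω :=
  bilift fun q p ↦ AddMonoidHom.mk' (fun g ↦ AddMonoidHom.mk' (fun h ↦ (h * a q p) • 𝒞.d g)
    (fun h k ↦ by rw [add_mul, add_smul])) (fun g k ↦ by ext; simp)

@[simp] lemma formTerm_single (a : Q → Q → R) (q p : Q) (g h : R) :
    𝒞.formTerm a (Finsupp.single q g) (Finsupp.single p h) = (h * a q p) • 𝒞.d g := by
  simp [formTerm]

/-- The function `∑ g_i h_j a(q_i, p_j)`. -/
def pairTerm (a : Q → Q → R) : (Q →₀ R) →+ (Q →₀ R) →+ R :=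
  bilift fun q p ↦ AddMonoidHom.mk' (fun g ↦ AddMonoidHom.mk' (fun h ↦ g * h * a q p)
    (fun h k ↦ by ring)) (fun g k ↦ by ext; simp; ring)

@[simp] lemma pairTerm_single (a : Q → Q → R) (q p : Q) (g h : R) :
    pairTerm a (Finsupp.single q g) (Finsupp.single p h) = g * h * a q p := by
  simp [pairTerm]

/-- The term `∑ g_i h_j ⊗ [q_i, p_j]`. -/
def brTerm (br : Q → Q → Q) : (Q →₀ R) →+ (Q →₀ R) →+ (Q →₀ R) :=
  bilift fun q p ↦ AddMonoidHom.mk' (fun g : R ↦ AddMonoidHom.mk'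
    (fun h : R ↦ Finsupp.single (br q p) (g * h))
    (fun h k ↦ by rw [mul_add, Finsupp.single_add]))
    (fun g k ↦ AddMonoidHom.ext fun h ↦ by simp [add_mul, -Finsupp.single_mul])

@[simp] lemma brTerm_single (br : Q → Q → Q) (q p : Q) (g h : R) :
    brTerm br (Finsupp.single q g) (Finsupp.single p h) = Finsupp.single (br q p) (g * h) := by
  simp [brTerm, -Finsupp.single_mul]

/-- The action of a vector field on the coefficients. -/
def act (ξ : T) : (Q →₀ R) →+ (Q →₀ R) := Finsupp.mapRange.addMonoidHom (𝒞.app ξ)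

@[simp] lemma act_single (ξ : T) (q : Q) (g : R) :
    𝒞.act ξ (Finsupp.single q g) = Finsupp.single q (𝒞.app ξ g) := by
  simp [act]

lemma add_act (ξ η : T) (x : Q →₀ R) : 𝒞.act (ξ + η) x = 𝒞.act ξ x + 𝒞.act η x := by
  ext; simp [act]

lemma smul_act (g : R) (ξ : T) (x : Q →₀ R) : 𝒞.act (g • ξ) x = g • 𝒞.act ξ x := by
  ext; simp [act, 𝒞.smul_app]

lemma act_smul (ξ : T) (g : R) (x : Q →₀ R) :
    𝒞.act ξ (g • x) = g • 𝒞.act ξ x + 𝒞.app ξ g • x := by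
  ext; simp [act, 𝒞.app_mul, add_comm]

lemma bra_act (ξ η : T) (x : Q →₀ R) :
    𝒞.act (𝒞.bra ξ η) x = 𝒞.act ξ (𝒞.act η x) - 𝒞.act η (𝒞.act ξ x) := by
  ext; simp [act, 𝒞.bra_app]

variable (br : Q → Q → Q) (pr : Q → Q → R)

/-- The bracket on triples `(α, ∑ g_i ⊗ q_i, ξ)`. -/
def br₃ (u v : Ω × (Q →₀ R) × T) : Ω × (Q →₀ R) × T :=
  (-𝒞.ctr v.2.2 u.1 + 𝒞.lie u.2.2 v.1 + 𝒞.formTerm pr u.2.1 v.2.1,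
    brTerm br u.2.1 v.2.1 + 𝒞.act u.2.2 v.2.1 - 𝒞.act v.2.2 u.2.1, 𝒞.bra u.2.2 v.2.2)

/-- The pairing of triples `(α, ∑ g_i ⊗ q_i, ξ)`. -/
def pr₃ (u v : Ω × (Q →₀ R) × T) : R :=
  𝒞.ι u.2.2 v.1 + 𝒞.ι v.2.2 u.1 + pairTerm pr u.2.1 v.2.1

/-- The functions `∑ g_i (⟨[q_i, p], r⟩ + ⟨p, [q_i, r]⟩)`. -/
def inv₃ (x : Q →₀ R) (p r : Q) : R := x.sum fun q g ↦ g * (pr (br q p) r + pr p (br q r))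

lemma br₃_add (u v w : Ω × (Q →₀ R) × T) :
    𝒞.br₃ br pr u (v + w) = 𝒞.br₃ br pr u v + 𝒞.br₃ br pr u w := by
  refine Prod.ext ?_ (Prod.ext ?_ ?_) <;>
  simp only [br₃, Prod.fst_add, Prod.snd_add, map_add, add_ctr, add_act] <;> abel

lemma add_br₃ (u v w : Ω × (Q →₀ R) × T) :
    𝒞.br₃ br pr (u + v) w = 𝒞.br₃ br pr u w + 𝒞.br₃ br pr v w := by
  refine Prod.ext ?_ (Prod.ext ?_ ?_) <;>
  simp only [br₃, Prod.fst_add, Prod.snd_add, map_add, AddMonoidHom.add_apply, ctr_add,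
    add_act] <;> abel

lemma pr₃_add (u v w : Ω × (Q →₀ R) × T) :
    𝒞.pr₃ pr u (v + w) = 𝒞.pr₃ pr u v + 𝒞.pr₃ pr u w := by
  simp only [pr₃, Prod.fst_add, Prod.snd_add, map_add, LinearMap.add_apply]; abel

lemma pairTerm_symm {a : Q → Q → R} (ha : ∀ q p, a q p = a p q) (x y : Q →₀ R) :
    pairTerm a x y = pairTerm a y x := by
  have : pairTerm a = (pairTerm a).flip := bilift_ext fun q p g h ↦ by
    rw [AddMonoidHom.flip_apply, pairTerm_single, pairTerm_single, ha, mul_comm g]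
  exact DFunLike.congr_fun (DFunLike.congr_fun this x) y

lemma pr₃_symm (hpr : ∀ q p, pr q p = pr p q) (u v : Ω × (Q →₀ R) × T) :
    𝒞.pr₃ pr u v = 𝒞.pr₃ pr v u := by
  rw [pr₃, pr₃, pairTerm_symm hpr, add_comm (𝒞.ι u.2.2 v.1)]

lemma formTerm_smul (a : Q → Q → R) (x : Q →₀ R) (g : R) (y : Q →₀ R) :
    𝒞.formTerm a x (g • y) = g • 𝒞.formTerm a x y := by
  have : (𝒞.formTerm a).flip.comp (DistribSMul.toAddMonoidHom _ g) =
      ((AddMonoidHom.compHom (DistribSMul.toAddMonoidHom Ω g)).comp (𝒞.formTerm a).flip) :=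
    bilift_ext fun q p k l ↦ by simp [mul_smul, -Finsupp.single_mul]
  exact DFunLike.congr_fun (DFunLike.congr_fun this y) x

lemma smul_pairTerm (a : Q → Q → R) (g : R) (x y : Q →₀ R) :
    pairTerm a (g • x) y = g * pairTerm a x y := by
  have : (pairTerm a).comp (DistribSMul.toAddMonoidHom _ g) =
      ((AddMonoidHom.compHom (DistribSMul.toAddMonoidHom R g)).comp (pairTerm a)) :=
    bilift_ext fun q p k l ↦ by simp [-Finsupp.single_mul]; ring
  exact DFunLike.congr_fun (DFunLike.congr_fun this x) y

lemma brTerm_smul (x : Q →₀ R) (g : R) (y : Q →₀ R) :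
    brTerm br x (g • y) = g • brTerm br x y := by
  have : (brTerm br).flip.comp (DistribSMul.toAddMonoidHom _ g) =
      ((AddMonoidHom.compHom (DistribSMul.toAddMonoidHom _ g)).comp (brTerm (R := R) br).flip) :=
    bilift_ext fun q p k l ↦ by simp [mul_left_comm, -Finsupp.single_mul]
  exact DFunLike.congr_fun (DFunLike.congr_fun this y) x

lemma smul_brTerm (g : R) (x y : Q →₀ R) :
    brTerm br (g • x) y = g • brTerm br x y := by
  have : (brTerm br).comp (DistribSMul.toAddMonoidHom _ g) =
      ((AddMonoidHom.compHom (DistribSMul.toAddMonoidHom _ g)).comp (brTerm (R := R) br)) :=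
    bilift_ext fun q p k l ↦ by simp [mul_assoc, -Finsupp.single_mul]
  exact DFunLike.congr_fun (DFunLike.congr_fun this x) y

lemma smul_formTerm_of_d_eq_zero (a : Q → Q → R) {c : R} (hc : 𝒞.d c = 0) (x y : Q →₀ R) :
    𝒞.formTerm a (c • x) y = c • 𝒞.formTerm a x y := by
  have : (𝒞.formTerm a).comp (DistribSMul.toAddMonoidHom _ c) =
      ((AddMonoidHom.compHom (DistribSMul.toAddMonoidHom Ω c)).comp (𝒞.formTerm a)) :=
    bilift_ext fun q p k l ↦ by
      simp [𝒞.d_mul, hc, smul_smul, mul_comm, -Finsupp.single_mul]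
  exact DFunLike.congr_fun (DFunLike.congr_fun this x) y

lemma smul_pr₃ (g : R) (u v : Ω × (Q →₀ R) × T) :
    𝒞.pr₃ pr (g • u) v = g * 𝒞.pr₃ pr u v := by
  simp only [pr₃, Prod.smul_fst, Prod.smul_snd, map_smul, LinearMap.smul_apply, smul_pairTerm,
    smul_eq_mul]
  ring

lemma br₃_smul (u : Ω × (Q →₀ R) × T) (g : R) (v : Ω × (Q →₀ R) × T) :
    𝒞.br₃ br pr u (g • v) = g • 𝒞.br₃ br pr u v + 𝒞.app u.2.2 g • v := by
  refine Prod.ext ?_ (Prod.ext ?_ ?_) <;>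
  simp only [br₃, Prod.fst_add, Prod.snd_add, Prod.smul_fst, Prod.smul_snd, smul_ctr, lie_smul,
    formTerm_smul, brTerm_smul, act_smul, smul_act, bra_smul, smul_add, smul_sub, smul_neg] <;> abel

/-- A scalar with dc = 0 is killed by every vector field, so all the corrections to linearity in the
first argument disappear. It is applied to constant functions. -/
lemma smul_br₃_of_const {c : R} (hc : 𝒞.d c = 0) (u v : Ω × (Q →₀ R) × T) :
    𝒞.br₃ br pr (c • u) v = c • 𝒞.br₃ br pr u v := by
  have hc' : ∀ ξ, 𝒞.app ξ c = 0 := fun ξ ↦ by rw [← 𝒞.ι_d, hc, map_zero]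
  refine Prod.ext ?_ (Prod.ext ?_ ?_)
  · simp only [br₃, Prod.smul_fst, Prod.smul_snd, ctr_smul, smul_lie, hc, hc',
      smul_formTerm_of_d_eq_zero _ _ hc, smul_add, smul_neg, smul_zero, zero_smul, add_zero,
      sub_zero]
  · simp only [br₃, Prod.smul_fst, Prod.smul_snd, act_smul, smul_act, hc', zero_smul, add_zero,
      smul_brTerm, smul_add, smul_sub]
  · simp only [br₃, Prod.smul_snd]
    rw [𝒞.bra_swap v.2.2, 𝒞.bra_smul, hc', zero_smul, add_zero, 𝒞.bra_swap u.2.2]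
    simp

variable {br pr}

lemma pairTerm_add_coeff (a b : Q → Q → R) (x y : Q →₀ R) :
    pairTerm (fun q p ↦ a q p + b q p) x y = pairTerm a x y + pairTerm b x y := by
  have : pairTerm (fun q p ↦ a q p + b q p) = pairTerm a + pairTerm b :=
    bilift_ext fun q p k l ↦ by simp [mul_add]
  exact DFunLike.congr_fun (DFunLike.congr_fun this x) y

lemma pairTerm_zero_coeff (x y : Q →₀ R) : pairTerm (fun _ _ ↦ 0) x y = 0 := by
  have : pairTerm (fun (_ _ : Q) ↦ (0 : R)) = 0 := bilift_ext fun q p k l ↦ by simp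
  exact DFunLike.congr_fun (DFunLike.congr_fun this x) y

lemma formTerm_add_coeff (a b : Q → Q → R) (x y : Q →₀ R) :
    𝒞.formTerm (fun q p ↦ a q p + b q p) x y = 𝒞.formTerm a x y + 𝒞.formTerm b x y := by
  have : 𝒞.formTerm (fun q p ↦ a q p + b q p) = 𝒞.formTerm a + 𝒞.formTerm b :=
    bilift_ext fun q p k l ↦ by simp [mul_add, add_smul]
  exact DFunLike.congr_fun (DFunLike.congr_fun this x) y

lemma formTerm_zero_coeff (x y : Q →₀ R) : 𝒞.formTerm (fun _ _ ↦ 0) x y = 0 := by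
  have : 𝒞.formTerm (fun (_ _ : Q) ↦ (0 : R)) = 0 := bilift_ext fun q p k l ↦ by simp
  exact DFunLike.congr_fun (DFunLike.congr_fun this x) y

lemma inv₃_zero : inv₃ br pr 0 = fun _ _ ↦ 0 := by
  funext p r; simp [inv₃]

lemma inv₃_add (x y : Q →₀ R) :
    inv₃ br pr (x + y) = fun p r ↦ inv₃ br pr x p r + inv₃ br pr y p r := by
  funext p r
  exact Finsupp.sum_add_index' (by simp) (fun _ _ _ ↦ by ring)

lemma inv₃_single (q : Q) (g : R) :
    inv₃ br pr (Finsupp.single q g) = fun p r ↦ g * (pr (br q p) r + pr p (br q r)) := by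
  funext p r
  exact Finsupp.sum_single_index (by simp)

/-- The derivation falls on the left coefficients, on the right coefficients and on the structure
functions; by biadditivity single generators suffice. `lie_formTerm` has the same shape because L_ξ
dg = d(ξ(g)). -/
lemma app_pairTerm (a : Q → Q → R) (ξ : T) (x y : Q →₀ R) :
    𝒞.app ξ (pairTerm a x y) = pairTerm a (𝒞.act ξ x) y + pairTerm a x (𝒞.act ξ y) +
      pairTerm (fun q p ↦ 𝒞.app ξ (a q p)) x y := by
  have : (AddMonoidHom.compHom (𝒞.app ξ)).comp (pairTerm a) =
      (pairTerm a).comp (𝒞.act ξ) + (((pairTerm a).flip).comp (𝒞.act ξ)).flip +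
        pairTerm (fun q p ↦ 𝒞.app ξ (a q p)) :=
    bilift_ext fun q p k l ↦ by simp [𝒞.app_mul]; ring
  exact DFunLike.congr_fun (DFunLike.congr_fun this x) y

lemma lie_formTerm (a : Q → Q → R) (ξ : T) (x y : Q →₀ R) :
    𝒞.lie ξ (𝒞.formTerm a x y) = 𝒞.formTerm a (𝒞.act ξ x) y + 𝒞.formTerm a x (𝒞.act ξ y) +
      𝒞.formTerm (fun q p ↦ 𝒞.app ξ (a q p)) x y := by
  have : (AddMonoidHom.compHom (𝒞.lie ξ)).comp (𝒞.formTerm a) =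
      (𝒞.formTerm a).comp (𝒞.act ξ) + (((𝒞.formTerm a).flip).comp (𝒞.act ξ)).flip +
        𝒞.formTerm (fun q p ↦ 𝒞.app ξ (a q p)) :=
    bilift_ext fun q p k l ↦ by
      simp [𝒞.app_mul, 𝒞.lie_smul, 𝒞.lie_d, add_smul, add_assoc]
  exact DFunLike.congr_fun (DFunLike.congr_fun this x) y

lemma act_brTerm (ξ : T) (x y : Q →₀ R) :
    𝒞.act ξ (brTerm br x y) = brTerm br (𝒞.act ξ x) y + brTerm br x (𝒞.act ξ y) := by
  have : (AddMonoidHom.compHom (𝒞.act ξ)).comp (brTerm br) =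
      (brTerm br).comp (𝒞.act ξ) + (((brTerm br).flip).comp (𝒞.act ξ)).flip :=
    bilift_ext fun q p k l ↦ by
      simp [𝒞.app_mul, -Finsupp.single_mul]
  exact DFunLike.congr_fun (DFunLike.congr_fun this x) y

lemma ι_formTerm (a : Q → Q → R) (ζ : T) (x y : Q →₀ R) :
    𝒞.ι ζ (𝒞.formTerm a x y) = pairTerm a (𝒞.act ζ x) y := by
  have : (AddMonoidHom.compHom (𝒞.ι ζ).toAddMonoidHom).comp (𝒞.formTerm a) =
      (pairTerm a).comp (𝒞.act ζ) :=
    bilift_ext fun q p k l ↦ by simp [𝒞.ι_d]; ring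
  exact DFunLike.congr_fun (DFunLike.congr_fun this x) y

/-- This is the part of the Jacobi identity that contains differentials of coefficients. All terms
are triadditive, so single generators with coefficients g, h, k suffice. No dk occurs, the
coefficients of dh agree identically, and those of dg agree by `hI`. For actual brackets both sides
of `hI` are the derivative of ⟨q,p⟩ along the anchor of r. -/
lemma formTerm_cyclic (hI : ∀ q p r, pr (br q p) r + pr (br p q) r = pr (br r q) p + pr q (br r p))
    (x y z : Q →₀ R) :
    𝒞.formTerm (inv₃ br pr x) y z + 𝒞.formTerm pr x (brTerm br y z) +
        𝒞.formTerm (inv₃ br pr z) x y =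
      𝒞.formTerm pr (brTerm br x y) z + 𝒞.formTerm (inv₃ br pr y) x z +
        𝒞.formTerm pr y (brTerm br x z) := by
  induction x using Finsupp.induction_linear with
  | zero => simp [inv₃_zero, formTerm_zero_coeff]
  | add x x' hx hx' =>
    simp only [inv₃_add, formTerm_add_coeff, map_add, AddMonoidHom.add_apply] at hx hx' ⊢
    linear_combination (norm := abel) hx + hx'
  | single q g =>
  induction y using Finsupp.induction_linear with
  | zero => simp [inv₃_zero, formTerm_zero_coeff]
  | add x x' hx hx' =>
    simp only [inv₃_add, formTerm_add_coeff, map_add, AddMonoidHom.add_apply] at hx hx' ⊢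
    linear_combination (norm := abel) hx + hx'
  | single p h =>
  induction z using Finsupp.induction_linear with
  | zero => simp [inv₃_zero]
  | add x x' hx hx' =>
    simp only [inv₃_add, formTerm_add_coeff, map_add] at hx hx' ⊢
    linear_combination (norm := abel) hx + hx'
  | single r k =>
    simp only [inv₃_single, formTerm_single, brTerm_single, 𝒞.d_mul]
    -- The coefficient of dg, the only one for which `hI` is needed.
    have e : (h * k * pr q (br p r)) • 𝒞.d g + (h * (k * (pr (br r q) p + pr q (br r p)))) • 𝒞.d g =
        (k * pr (br q p) r * h) • 𝒞.d g +
          (k * (h * (pr (br p q) r + pr q (br p r)))) • 𝒞.d g := by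
      rw [← add_smul, ← add_smul]
      congr 1
      linear_combination (-h * k) * hI q p r
    rw [smul_add, smul_smul, smul_smul, add_assoc, e]
    module

lemma pairTerm_inv (x y z : Q →₀ R) :
    pairTerm pr (brTerm br x y) z + pairTerm pr y (brTerm br x z) =
      pairTerm (inv₃ br pr x) y z := by
  induction x using Finsupp.induction_linear with
  | zero => simp [inv₃_zero, pairTerm_zero_coeff]
  | add x x' hx hx' =>
    simp only [inv₃_add, pairTerm_add_coeff, map_add, AddMonoidHom.add_apply] at hx hx' ⊢
    linear_combination hx + hx'
  | single q g =>
  have : (pairTerm pr).comp (brTerm br (Finsupp.single q g)) +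
      ((pairTerm pr).flip.comp (brTerm br (Finsupp.single q g))).flip =
        pairTerm (inv₃ br pr (Finsupp.single q g)) :=
    bilift_ext fun p r k l ↦ by simp [inv₃_single, -Finsupp.single_mul]; ring
  exact DFunLike.congr_fun (DFunLike.congr_fun this y) z

/-- Invariance of the pairing. -/
lemma pr₃_br₃ (hs : ∀ q p, pr q p = pr p q) (u v w : Ω × (Q →₀ R) × T)
    (hu : ∀ p r, 𝒞.app u.2.2 (pr p r) = inv₃ br pr u.2.1 p r) :
    𝒞.pr₃ pr (𝒞.br₃ br pr u v) w + 𝒞.pr₃ pr v (𝒞.br₃ br pr u w) =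
      𝒞.app u.2.2 (𝒞.pr₃ pr v w) := by
  obtain ⟨α, x, ξ⟩ := u
  obtain ⟨β, y, η⟩ := v
  obtain ⟨γ, z, ζ⟩ := w
  have hu' : (fun q p ↦ 𝒞.app ξ (pr q p)) = inv₃ br pr x := by funext q p; exact hu q p
  simp only [pr₃, br₃, map_add, map_sub, map_neg, app_pairTerm, ι_formTerm, ι_lie, hu',
    AddMonoidHom.add_apply, AddMonoidHom.sub_apply, ← pairTerm_inv]
  rw [𝒞.ι_ctr_swap η ζ, pairTerm_symm hs y (𝒞.act ζ x)]
  ring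

/-! ### Identities that hold for classes of triples -/

section Target

variable {N : Type*} [AddCommGroup N] [Module R N] (jΩ : Ω →ₗ[R] N) (pt : Q → N)

/-- The class of a triple `(α, ∑ g_i ⊗ q_i, ξ)` in a module to which forms and generators map. -/
def cls (u : Ω × (Q →₀ R) × T) : N := jΩ u.1 + Finsupp.linearCombination R pt u.2.1

/-- d(g h ⟨q,p⟩) has three terms: g h d⟨q,p⟩ is the symmetrised bracket of the generators, and the
other two are the form terms of (x, y) and of (y, x). -/
lemma linearCombination_swap (hs : ∀ q p, pr q p = pr p q)
    (hsw : ∀ q p, pt (br q p) + pt (br p q) = jΩ (𝒞.d (pr q p))) (x y : Q →₀ R) :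
    Finsupp.linearCombination R pt (brTerm br x y) +
        Finsupp.linearCombination R pt (brTerm br y x) =
      jΩ (𝒞.d (pairTerm pr x y) - 𝒞.formTerm pr x y - 𝒞.formTerm pr y x) := by
  let l := (Finsupp.linearCombination R pt).toAddMonoidHom
  have : (AddMonoidHom.compHom l).comp (brTerm br) + ((AddMonoidHom.compHom l).comp (brTerm br)).flip =
      (AddMonoidHom.compHom jΩ.toAddMonoidHom).comp ((AddMonoidHom.compHom 𝒞.d).comp (pairTerm pr) -
        𝒞.formTerm pr - (𝒞.formTerm pr).flip) :=
    bilift_ext fun q p g h ↦ by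
      simp only [AddMonoidHom.add_apply, AddMonoidHom.sub_apply, AddMonoidHom.flip_apply,
        AddMonoidHom.comp_apply, AddMonoidHom.compHom_apply_apply, brTerm_single, pairTerm_single,
        formTerm_single, l, LinearMap.toAddMonoidHom_coe, Finsupp.linearCombination_single]
      rw [mul_comm h g, ← smul_add, hsw, ← map_smul, 𝒞.d_mul, 𝒞.d_mul, hs p q]
      congr 1
      module
  exact DFunLike.congr_fun (DFunLike.congr_fun this x) y

/-- Cartan's formula turns L_η α - ι_η dα into d(ι_η α), and likewise for β and ξ. The derivatives
of coefficients cancel in pairs, and `linearCombination_swap` accounts for the brackets of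
generators. -/
lemma cls_br₃_swap (hs : ∀ q p, pr q p = pr p q)
    (hsw : ∀ q p, pt (br q p) + pt (br p q) = jΩ (𝒞.d (pr q p))) (u v : Ω × (Q →₀ R) × T) :
    cls jΩ pt (𝒞.br₃ br pr u v) + cls jΩ pt (𝒞.br₃ br pr v u) = jΩ (𝒞.d (𝒞.pr₃ pr u v)) := by
  have h := 𝒞.linearCombination_swap jΩ pt hs hsw u.2.1 v.2.1
  simp only [cls, br₃, pr₃, map_add, map_sub, map_neg, ctr] at h ⊢
  linear_combination (norm := abel) h

lemma linearCombination_jacobi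
    (hj : ∀ q p r, pt (br q (br p r)) = pt (br (br q p) r) + pt (br p (br q r)))
    (x y z : Q →₀ R) :
    Finsupp.linearCombination R pt (brTerm br x (brTerm br y z)) =
      Finsupp.linearCombination R pt (brTerm br (brTerm br x y) z) +
        Finsupp.linearCombination R pt (brTerm br y (brTerm br x z)) := by
  induction x using Finsupp.induction_linear with
  | zero => simp
  | add x x' hx hx' =>
    simp only [map_add, AddMonoidHom.add_apply, hx, hx']; abel
  | single q g =>
  induction y using Finsupp.induction_linear with
  | zero => simp
  | add x x' hx hx' =>
    simp only [map_add, AddMonoidHom.add_apply, hx, hx']; abel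
  | single p h =>
  induction z using Finsupp.induction_linear with
  | zero => simp
  | add x x' hx hx' =>
    simp only [map_add, hx, hx']; abel
  | single r k =>
    simp only [brTerm_single, Finsupp.linearCombination_single]
    rw [hj, smul_add]
    congr 2 <;> ring

/-- The Jacobi identity for the bracket on triples. -/
lemma cls_br₃_jacobi (hs : ∀ q p, pr q p = pr p q)
    (hsw : ∀ q p, pt (br q p) + pt (br p q) = jΩ (𝒞.d (pr q p)))
    (hj : ∀ q p r, pt (br q (br p r)) = pt (br (br q p) r) + pt (br p (br q r)))
    (hI : ∀ q p r, pr (br q p) r + pr (br p q) r = pr (br r q) p + pr q (br r p))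
    (u v w : Ω × (Q →₀ R) × T)
    (hu : ∀ p r, 𝒞.app u.2.2 (pr p r) = inv₃ br pr u.2.1 p r)
    (hv : ∀ p r, 𝒞.app v.2.2 (pr p r) = inv₃ br pr v.2.1 p r)
    (hw : ∀ p r, 𝒞.app w.2.2 (pr p r) = inv₃ br pr w.2.1 p r) :
    cls jΩ pt (𝒞.br₃ br pr u (𝒞.br₃ br pr v w)) =
      cls jΩ pt (𝒞.br₃ br pr (𝒞.br₃ br pr u v) w) +
        cls jΩ pt (𝒞.br₃ br pr v (𝒞.br₃ br pr u w)) := by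
  obtain ⟨α, x, ξ⟩ := u
  obtain ⟨β, y, η⟩ := v
  obtain ⟨γ, z, ζ⟩ := w
  have hu' : (fun q p ↦ 𝒞.app ξ (pr q p)) = inv₃ br pr x := by funext q p; exact hu q p
  have hv' : (fun q p ↦ 𝒞.app η (pr q p)) = inv₃ br pr y := by funext q p; exact hv q p
  have hw' : (fun q p ↦ 𝒞.app ζ (pr q p)) = inv₃ br pr z := by funext q p; exact hw q p
  have h1 := congrArg jΩ (𝒞.formTerm_cyclic hI x y z)
  -- In ι_ζ d of the form term of (x, y) there remains -d⟨ζ(x), y⟩, with ζ(x) the derivative of the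
  -- coefficients. This instance trades it for the brackets of ζ(x) and y in both orders, which are
  -- the leftover terms of the Jacobi identity.
  have h2 := 𝒞.linearCombination_swap jΩ pt hs hsw (𝒞.act ζ x) y
  have h3 := linearCombination_jacobi pt hj x y z
  have h4 : 𝒞.ctr ζ (𝒞.formTerm pr x y) = 𝒞.formTerm pr (𝒞.act ζ x) y +
      𝒞.formTerm pr x (𝒞.act ζ y) + 𝒞.formTerm (inv₃ br pr z) x y -
        𝒞.d (pairTerm pr (𝒞.act ζ x) y) := by
    rw [ctr, lie_formTerm, ι_formTerm, hw']
  simp only [cls, br₃, map_add, map_sub, map_neg, lie_formTerm, ctr_add, ctr_neg, ctr_bra,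
    bra_lie, bra_act, act_brTerm, hu', hv', h4, AddMonoidHom.add_apply, AddMonoidHom.sub_apply,
    ctr_ctr] at h1 h2 h3 ⊢
  linear_combination (norm := abel) h1 + h3 + h2

end Target

end Brackets

end CartanCalculus

namespace Mfd

variable {𝕜 : Type} [RCLike 𝕜] {n : WithTop ℕ∞} {K : Type} [RCLike K] [NormedAlgebra 𝕜 K]
variable {X Y : Mfd.{u} 𝕜 n}

/-! ### Local coordinates -/

lemma dAt_tmul {U : Opens X} (g : U → K) (x : X) (k : K) (v : TangentSpace X.model x) :
    dAt g x (k ⊗ₜ v) = k * (show K from mfderiv X.model 𝓘(𝕜, K) (ext g) x v) := rfl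

lemma contMDiffAt_ext {U : Opens X} (g : X.O K U) {x : X} (hx : x ∈ U) :
    ContMDiffAt X.model 𝓘(𝕜, K) n (ext g.1) x := g.2 ⟨x, hx⟩

lemma infty_ne_zero [Fact (∞ ≤ n)] : n ≠ 0 := by
  have h : ∞ ≤ n := Fact.out
  rintro rfl
  simp at h

instance [h : Fact (∞ ≤ n)] : IsManifold X.model 1 X :=
  IsManifold.of_le (le_trans (by exact_mod_cast (le_top : (1 : ℕ∞) ≤ ⊤)) h.out)

/-- Both ∞ and ω absorb one derivative, so partial derivatives of functions of class n are again of
class n. -/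
lemma infty_add_one_le [h : Fact (∞ ≤ n)] : n + 1 ≤ n := by
  rcases n with _ | _ | m
  · exact le_rfl
  · exact le_rfl
  · have h' : (∞ : WithTop ℕ∞) ≤ ((m : ℕ∞) : WithTop ℕ∞) := h.out
    exact absurd (WithTop.coe_le_coe.1 h') (by simp)

section Chart

variable (x₀ : X)

/-- The domain of the preferred chart at a point. -/
def chartDom : Opens X := ⟨(chartAt (EuclideanSpace 𝕜 (Fin X.dim)) x₀).source,
  (chartAt (EuclideanSpace 𝕜 (Fin X.dim)) x₀).open_source⟩

lemma mem_chartDom : x₀ ∈ chartDom x₀ := mem_chart_source _ x₀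

/-- A function on an open set, read in the preferred chart at `x₀`. -/
def inChart {V : Opens X} (g : V → K) : EuclideanSpace 𝕜 (Fin X.dim) → K :=
  ext g ∘ (chartAt (EuclideanSpace 𝕜 (Fin X.dim)) x₀).symm

/-- The `i`-th coordinate vector at a point of the chart domain. -/
def coordVecAt (i : Fin X.dim) (x : X) : X.Tan K x :=
  (1 : K) ⊗ₜ (mfderiv 𝓘(𝕜, EuclideanSpace 𝕜 (Fin X.dim)) X.model
    (chartAt (EuclideanSpace 𝕜 (Fin X.dim)) x₀).symm
    (chartAt (EuclideanSpace 𝕜 (Fin X.dim)) x₀ x) (EuclideanSpace.single i (1 : 𝕜)) :)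

variable {x₀}

lemma contDiffAt_inChart {V : Opens X} (g : X.O K V) {x : X} (hx : x ∈ chartDom x₀)
    (hV : x ∈ V) :
    ContDiffAt 𝕜 n (inChart x₀ g.1) (chartAt (EuclideanSpace 𝕜 (Fin X.dim)) x₀ x) := by
  set φ := chartAt (EuclideanSpace 𝕜 (Fin X.dim)) x₀
  rw [← contMDiffAt_iff_contDiffAt]
  have h1 : ContMDiffAt X.model X.model n φ.symm (φ x) :=
    (contMDiffOn_chart_symm (I := X.model) (n := n) (x := x₀)).contMDiffAt
      (φ.open_target.mem_nhds (φ.map_source hx))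
  refine ContMDiffAt.comp (φ x) ?_ h1
  rw [φ.left_inv hx]
  exact contMDiffAt_ext g hV

variable [Fact (∞ ≤ n)]

lemma dAt_coordVecAt {V : Opens X} (g : X.O K V) (i : Fin X.dim) {x : X}
    (hx : x ∈ chartDom x₀) (hV : x ∈ V) :
    dAt g.1 x (coordVecAt x₀ i x) =
      fderiv 𝕜 (inChart x₀ g.1) (chartAt (EuclideanSpace 𝕜 (Fin X.dim)) x₀ x)
        (EuclideanSpace.single i (1 : 𝕜)) := by
  set φ := chartAt (EuclideanSpace 𝕜 (Fin X.dim)) x₀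
  have hφ : φ.symm (φ x) = x := φ.left_inv hx
  have h1 : MDifferentiableAt X.model X.model φ.symm (φ x) :=
    ((contMDiffOn_chart_symm (I := X.model) (n := n) (x := x₀)).contMDiffAt
      (φ.open_target.mem_nhds (φ.map_source hx))).mdifferentiableAt infty_ne_zero
  have h2 : MDifferentiableAt X.model 𝓘(𝕜, K) (ext g.1) (φ.symm (φ x)) := by
    rw [hφ]
    exact (contMDiffAt_ext g hV).mdifferentiableAt infty_ne_zero
  refine (dAt_tmul _ _ _ _).trans ?_
  rw [one_mul, ← mfderiv_eq_fderiv, inChart, mfderiv_comp _ h2 h1]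
  have e : ∀ x', x' = x → ∀ v : EuclideanSpace 𝕜 (Fin X.dim),
      (show K from mfderiv X.model 𝓘(𝕜, K) (ext g.1) x v) =
        (show K from mfderiv X.model 𝓘(𝕜, K) (ext g.1) x' v) := by
    rintro _ rfl v; rfl
  exact e _ hφ _

lemma ext_coordDeriv {V : Opens X} (hV : V ≤ chartDom x₀) (g : X.O K V) (i : Fin X.dim) {x : X}
    (hx : x ∈ V) :
    ext (fun z : V ↦ dAt g.1 z (coordVecAt x₀ i (z : X))) =ᶠ[nhds x]
      (fun p ↦ fderiv 𝕜 (inChart x₀ g.1) p (EuclideanSpace.single i (1 : 𝕜))) ∘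
        chartAt (EuclideanSpace 𝕜 (Fin X.dim)) x₀ := by
  filter_upwards [V.2.mem_nhds hx] with z hz
  rw [ext_apply _ hz, dAt_coordVecAt g i (hV hz) hz]
  rfl

/-- In the chart this function is a partial derivative, and no regularity is lost. It is what makes
the coordinate vectors a vector field in the sense of `VF`. -/
lemma coordDeriv_mem {V : Opens X} (hV : V ≤ chartDom x₀) (g : X.O K V) (i : Fin X.dim) :
    (fun z : V ↦ dAt g.1 z (coordVecAt x₀ i (z : X))) ∈ X.reg K V := fun x ↦ by
  set φ := chartAt (EuclideanSpace 𝕜 (Fin X.dim)) x₀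
  refine ContMDiffAt.congr_of_eventuallyEq ?_ (ext_coordDeriv hV g i x.2)
  have h1 : ContDiffAt 𝕜 n (fderiv 𝕜 (inChart x₀ g.1)) (φ x) :=
    (contDiffAt_inChart g (hV x.2) x.2).fderiv_right infty_add_one_le
  have h2 : ContDiffAt 𝕜 n (fun p ↦ fderiv 𝕜 (inChart x₀ g.1) p
      (EuclideanSpace.single i (1 : 𝕜))) (φ x) := h1.clm_apply contDiffAt_const
  exact h2.contMDiffAt.comp (x : X) ((contMDiffOn_chart (I := X.model) (n := n)
    (x := x₀)).contMDiffAt (φ.open_source.mem_nhds (hV x.2)))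

variable (K x₀) in
/-- The coordinate vector fields. -/
def coordVec (i : Fin X.dim) : (tangentSheaf K X).sec (chartDom x₀) :=
  (⟨fun z ↦ coordVecAt x₀ i (z : X), fun _ h g ↦ coordDeriv_mem h g i⟩ : X.VF K (chartDom x₀))

variable (K x₀) in
/-- The coordinate functions. -/
def coord (i : Fin X.dim) : X.O K (chartDom x₀) :=
  ⟨fun z ↦ algebraMap 𝕜 K (chartAt (EuclideanSpace 𝕜 (Fin X.dim)) x₀ z i), fun x ↦ by
    have h : ContDiff 𝕜 n (fun p : EuclideanSpace 𝕜 (Fin X.dim) ↦ algebraMap 𝕜 K (p i)) :=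
      ((algebraMapCLM 𝕜 K).comp (EuclideanSpace.proj i)).contDiff
    refine (h.contMDiff.contMDiffAt.comp (x : X) ((contMDiffOn_chart (I := X.model) (n := n)
      (x := x₀)).contMDiffAt ((chartDom x₀).2.mem_nhds x.2))).congr_of_eventuallyEq ?_
    filter_upwards [(chartDom x₀).2.mem_nhds x.2] with z hz
    rw [ext_apply _ hz]
    rfl⟩

lemma dAt_coord (i : Fin X.dim) {x : X} (hx : x ∈ chartDom x₀) (k : K)
    (v : TangentSpace X.model x) :
    dAt (coord K x₀ i).1 x (k ⊗ₜ v) = k * algebraMap 𝕜 K ((show EuclideanSpace 𝕜 (Fin X.dim) from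
      mfderiv X.model X.model (chartAt (EuclideanSpace 𝕜 (Fin X.dim)) x₀) x v) i) := by
  set φ := chartAt (EuclideanSpace 𝕜 (Fin X.dim)) x₀
  have h1 : MDifferentiableAt X.model X.model φ x :=
    ((contMDiffOn_chart (I := X.model) (n := n) (x := x₀)).contMDiffAt
      (φ.open_source.mem_nhds hx)).mdifferentiableAt infty_ne_zero
  let l : EuclideanSpace 𝕜 (Fin X.dim) →L[𝕜] K := (algebraMapCLM 𝕜 K).comp (EuclideanSpace.proj i)
  have e : ext (coord K x₀ i).1 =ᶠ[nhds x] l ∘ φ := by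
    filter_upwards [(chartDom x₀).2.mem_nhds hx] with z hz
    rw [ext_apply _ hz]
    rfl
  have h2 : MDifferentiableAt 𝓘(𝕜, EuclideanSpace 𝕜 (Fin X.dim)) 𝓘(𝕜, K) l (φ x) :=
    l.mdifferentiableAt
  rw [dAt_tmul, e.mfderiv_eq, mfderiv_comp x h2 h1, mfderiv_eq_fderiv, l.fderiv]
  rfl

/-- The differentials of the chart and of its inverse are mutually inverse, so a tangent vector is
recovered from its components; general elements of K ⊗ T_x X follow by additivity. -/
lemma coord_span {x : X} (hx : x ∈ chartDom x₀) (v : X.Tan K x) :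
    v = ∑ i, dAt (coord K x₀ i).1 x v • coordVecAt (K := K) x₀ i x := by
  have h := (mdifferentiable_chart (I := X.model) x₀).symm_comp_deriv hx
  induction v using TensorProduct.induction_on with
  | zero => simp
  | add v w hv hw =>
    simp only [map_add, add_smul, Finset.sum_add_distrib]
    rw [← hv, ← hw]
  | tmul k v =>
    set φ := chartAt (EuclideanSpace 𝕜 (Fin X.dim)) x₀
    let w : EuclideanSpace 𝕜 (Fin X.dim) := mfderiv X.model X.model φ x v
    let L : EuclideanSpace 𝕜 (Fin X.dim) →ₗ[𝕜] TangentSpace X.model x :=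
      (mfderiv X.model X.model φ.symm (φ x)).toLinearMap
    have hv : v = L w := (DFunLike.congr_fun h v).symm
    have hw : w = ∑ i, w i • EuclideanSpace.single i (1 : 𝕜) := by
      ext j
      simp [Finset.sum_apply, Pi.single_apply]
    have e : (k ⊗ₜ[𝕜] v : X.Tan K x) = k ⊗ₜ (∑ i, w i • L (EuclideanSpace.single i (1 : 𝕜))) := by
      conv_lhs => rw [hv, hw, map_sum]
      simp only [map_smul]
    refine e.trans ?_
    rw [TensorProduct.tmul_sum]
    refine Finset.sum_congr rfl fun i _ ↦ ?_
    rw [dAt_coord i hx k v]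
    change _ = (k * algebraMap 𝕜 K (w i)) • ((1 : K) ⊗ₜ[𝕜] L (EuclideanSpace.single i (1 : 𝕜)))
    rw [TensorProduct.smul_tmul', TensorProduct.tmul_smul, TensorProduct.smul_tmul', smul_eq_mul,
      mul_one, Algebra.smul_def, mul_comm]

/-- Symmetry of the second derivative of the function read in the chart. This is why the
second-order terms of a commutator of vector fields cancel. -/
lemma coord_comm {V : Opens X} (hV : V ≤ chartDom x₀) (g : X.O K V) (i j : Fin X.dim) :
    VF.app ((tangentSheaf K X).res hV (coordVec K x₀ i))
        (VF.app ((tangentSheaf K X).res hV (coordVec K x₀ j)) g) =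
      VF.app ((tangentSheaf K X).res hV (coordVec K x₀ j))
        (VF.app ((tangentSheaf K X).res hV (coordVec K x₀ i)) g) := by
  set φ := chartAt (EuclideanSpace 𝕜 (Fin X.dim)) x₀
  have key : ∀ (i j : Fin X.dim) (x : V), (VF.app ((tangentSheaf K X).res hV (coordVec K x₀ i))
        (VF.app ((tangentSheaf K X).res hV (coordVec K x₀ j)) g)).1 x =
      fderiv 𝕜 (fderiv 𝕜 (inChart x₀ g.1)) (φ x) (EuclideanSpace.single i (1 : 𝕜))
        (EuclideanSpace.single j (1 : 𝕜)) := fun i j x ↦ by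
    refine (dAt_coordVecAt _ i (hV x.2) x.2).trans ?_
    have e : inChart x₀ (VF.app ((tangentSheaf K X).res hV (coordVec K x₀ j)) g).1 =ᶠ[nhds (φ x)]
        fun p ↦ fderiv 𝕜 (inChart x₀ g.1) p (EuclideanSpace.single j (1 : 𝕜)) := by
      have hc : Filter.Tendsto φ.symm (nhds (φ x)) (nhds (x : X)) := by
        have := (φ.continuousAt_symm (φ.map_source (hV x.2)))
        rwa [ContinuousAt, φ.left_inv (hV x.2)] at this
      filter_upwards [hc.eventually (ext_coordDeriv hV g j x.2),
        φ.open_target.mem_nhds (φ.map_source (hV x.2))] with p hp hp'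
      refine hp.trans ?_
      rw [Function.comp_apply, φ.right_inv hp']
    rw [e.fderiv_eq]
    have h1 : DifferentiableAt 𝕜 (fderiv 𝕜 (inChart x₀ g.1)) (φ x) :=
      ((contDiffAt_inChart g (hV x.2) x.2).fderiv_right infty_add_one_le).differentiableAt
        infty_ne_zero
    rw [fderiv_clm_apply h1 (differentiableAt_const _)]
    simp
  refine Subtype.ext (funext fun x ↦ ?_)
  rw [key, key]
  refine ((contDiffAt_inChart g (hV x.2) x.2).isSymmSndFDerivAt ?_) _ _
  have h : ∞ ≤ n := Fact.out
  rw [minSmoothness_of_isRCLikeNormedField]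
  exact le_trans (WithTop.coe_le_coe.2 (le_top : (2 : ℕ∞) ≤ ⊤)) h

end Chart

/-- The chain rule. -/
lemma dAt_pullO [Fact (∞ ≤ n)] (f : Hom Y X) {U : Opens X} {V : Opens Y} (h : V ≤ f.preim U)
    (g : X.O K U) {y : Y} (hy : y ∈ V) (v : Y.Tan K y) :
    dAt (f.pullO K h g).1 y v = dAt g.1 (f y) (f.push K y v) := by
  have e : ext (f.pullO K h g).1 =ᶠ[nhds y] ext g.1 ∘ f := by
    filter_upwards [V.2.mem_nhds hy] with z hz
    rw [ext_apply _ hz, Function.comp_apply, ext_apply g.1 (h hz)]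
    rfl
  have h1 : MDifferentiableAt X.model 𝓘(𝕜, K) (ext g.1) (f y) :=
    (contMDiffAt_ext g (h hy)).mdifferentiableAt infty_ne_zero
  have h2 : MDifferentiableAt Y.model X.model f y :=
    (f.contMDiff y).mdifferentiableAt infty_ne_zero
  induction v using TensorProduct.induction_on with
  | zero => simp only [map_zero]
  | add v w hv hw => simp only [map_add, hv, hw]
  | tmul k v =>
    refine (dAt_tmul _ _ _ _).trans ?_
    rw [e.mfderiv_eq, mfderiv_comp y h1 h2]
    rfl

end Mfd

lemma PreMod.res_smul {𝕜 : Type} [RCLike 𝕜] {n : WithTop ℕ∞} {K : Type} [RCLike K]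
    [NormedAlgebra 𝕜 K] {X : Mfd.{u} 𝕜 n} (P : PreMod K X) {U V : Opens X} (h : V ≤ U)
    (g : X.O K U) (s : P.sec U) : P.res h (g • s) = Mfd.resO K h g • P.res h s := map_smulₛₗ _ _ _

/-- Sections which are determined by a local property glue. -/
lemma OMod.exists_of_local {𝕜 : Type} [RCLike 𝕜] {n : WithTop ℕ∞} {K : Type} [RCLike K]
    [NormedAlgebra 𝕜 K] {X : Mfd.{u} 𝕜 n} (M : OMod K X) {U : Opens X}
    (P : ∀ {V : Opens X}, V ≤ U → M.sec V → Prop)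
    (hres : ∀ {V W : Opens X} (h : V ≤ U) (k : W ≤ V) (s : M.sec V), P h s →
      P (k.trans h) (M.res k s))
    (huniq : ∀ {V : Opens X} (h : V ≤ U) (s t : M.sec V), P h s → P h t → s = t)
    (hloc : ∀ x ∈ U, ∃ (V : Opens X) (h : V ≤ U) (s : M.sec V), x ∈ V ∧ P h s) :
    ∃ t : M.sec U, ∀ {V : Opens X} (h : V ≤ U) (s : M.sec V), P h s → M.res h t = s := by
  choose V h s hx hP using fun x : U ↦ hloc x x.2
  obtain ⟨t, ht⟩ := M.glue V s fun x y ↦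
    huniq (inf_le_left.trans (h x)) _ _ (hres _ _ _ (hP x)) (hres _ _ _ (hP y))
  have hU : U ≤ ⨆ x, V x := fun x hx' ↦ Opens.mem_iSup.2 ⟨⟨x, hx'⟩, hx ⟨x, hx'⟩⟩
  refine ⟨M.res hU t, fun {W} k r hr ↦ M.sep _ _ fun x hxW ↦ ⟨W ⊓ V ⟨x, k hxW⟩, inf_le_left,
    ⟨hxW, hx ⟨x, k hxW⟩⟩, ?_⟩⟩
  rw [M.res_res, M.res_res]
  refine Eq.trans ?_ (huniq (inf_le_right.trans (h ⟨x, k hxW⟩)) _ _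
    (hres _ inf_le_right _ (hP ⟨x, k hxW⟩)) (hres k inf_le_left _ hr))
  rw [← ht ⟨x, k hxW⟩, M.res_res]

namespace Mfd

variable {𝕜 : Type} [RCLike 𝕜] {n : WithTop ℕ∞} {K : Type} [RCLike K] [NormedAlgebra 𝕜 K]
variable {X Y : Mfd.{u} 𝕜 n}

@[ext] lemma O_ext {U : Opens X} {g h : X.O K U} (e : ∀ x : U, g.1 x = h.1 x) : g = h :=
  Subtype.ext (funext e)

lemma O_eq_of_local {U : Opens X} {g h : X.O K U}
    (e : ∀ x ∈ U, ∃ (V : Opens X) (k : V ≤ U), x ∈ V ∧ resO K k g = resO K k h) : g = h :=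
  O_ext fun x ↦ by
    obtain ⟨V, k, hx, e⟩ := e x x.2
    exact congrFun (congrArg Subtype.val e) ⟨x, hx⟩

/-! ### Sum and product rules for differentials -/

section Derivative

variable [Fact (∞ ≤ n)]

lemma hasMFDerivAt_ext {U : Opens X} (g : X.O K U) {x : X} (hx : x ∈ U) :
    HasMFDerivAt X.model 𝓘(𝕜, K) (ext g.1) x (mfderiv X.model 𝓘(𝕜, K) (ext g.1) x) :=
  ((contMDiffAt_ext g hx).mdifferentiableAt infty_ne_zero).hasMFDerivAt

lemma dAt_add {U : Opens X} (g h : X.O K U) {x : X} (hx : x ∈ U) :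
    dAt (g + h).1 x = dAt g.1 x + dAt h.1 x := by
  have e : ext (g + h).1 =ᶠ[nhds x] ext g.1 + ext h.1 := by
    filter_upwards [U.2.mem_nhds hx] with z hz
    rw [ext_apply _ hz, Pi.add_apply, ext_apply _ hz, ext_apply _ hz]
    rfl
  have h1 := ((hasMFDerivAt_ext g hx).add (hasMFDerivAt_ext h hx)).congr_of_eventuallyEq e
  refine LinearMap.ext fun v ↦ ?_
  induction v using TensorProduct.induction_on with
  | zero => simp only [map_zero]
  | add v w hv hw => rw [map_add, map_add, hv, hw]
  | tmul k v =>
    refine (dAt_tmul _ _ _ _).trans ?_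
    rw [h1.mfderiv]
    exact mul_add _ _ _

lemma dAt_mul {U : Opens X} (g h : X.O K U) {x : X} (hx : x ∈ U) :
    dAt (g * h).1 x = g.1 ⟨x, hx⟩ • dAt h.1 x + h.1 ⟨x, hx⟩ • dAt g.1 x := by
  have e : ext (g * h).1 =ᶠ[nhds x] ext g.1 * ext h.1 := by
    filter_upwards [U.2.mem_nhds hx] with z hz
    rw [ext_apply _ hz, Pi.mul_apply, ext_apply _ hz, ext_apply _ hz]
    rfl
  have h1 := (HasMFDerivAt.mul (hasMFDerivAt_ext g hx)
    (hasMFDerivAt_ext h hx)).congr_of_eventuallyEq e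
  refine LinearMap.ext fun v ↦ ?_
  induction v using TensorProduct.induction_on with
  | zero => simp only [map_zero]
  | add v w hv hw => rw [map_add, map_add, hv, hw]
  | tmul k v =>
    refine (dAt_tmul _ _ _ _).trans ?_
    rw [h1.mfderiv]
    have e1 : ext g.1 x = g.1 ⟨x, hx⟩ := ext_apply _ hx
    have e2 : ext h.1 x = h.1 ⟨x, hx⟩ := ext_apply _ hx
    change k * (ext g.1 x * _ + ext h.1 x * _) = g.1 ⟨x, hx⟩ * (k * _) + h.1 ⟨x, hx⟩ * (k * _)
    rw [e1, e2]
    ring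

lemma dAt_const {U : Opens X} (k : K) {x : X} (hx : x ∈ U) :
    dAt (Mfd.const (X := X) U k).1 x = 0 := by
  have e : ext (Mfd.const (X := X) U k).1 =ᶠ[nhds x] fun _ ↦ k := by
    filter_upwards [U.2.mem_nhds hx] with z hz
    rw [ext_apply _ hz]
    rfl
  have h1 := (hasMFDerivAt_const (I := X.model) (I' := 𝓘(𝕜, K)) k x).congr_of_eventuallyEq e
  refine LinearMap.ext fun v ↦ ?_
  induction v using TensorProduct.induction_on with
  | zero => simp only [map_zero]
  | add v w hv hw => rw [map_add, map_add, hv, hw]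
  | tmul k v =>
    refine (dAt_tmul _ _ _ _).trans ?_
    rw [h1.mfderiv]
    exact mul_zero _

/-! ### Rules for vector fields, functions and forms -/

section Rules

variable {V : Opens X}

lemma app_apply (ξ : (tangentSheaf K X).sec V) (g : X.O K V) (x : V) :
    (VF.app ξ g).1 x = dAt g.1 x (ξ.1 x) := rfl

lemma resO_app {W : Opens X} (k : W ≤ V) (ξ : (tangentSheaf K X).sec V) (g : X.O K V) :
    resO K k (VF.app ξ g) = VF.app ((tangentSheaf K X).res k ξ) (resO K k g) :=
  O_ext fun x ↦ by
    rw [app_apply, dAt_res K k g x.2]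
    rfl

lemma resO_contract {W : Opens X} (k : W ≤ V) (ξ : (tangentSheaf K X).sec V)
    (α : (formSheaf K X).sec V) :
    resO K k (Form.contract ξ α) =
      Form.contract ((tangentSheaf K X).res k ξ) ((formSheaf K X).res k α) := rfl

lemma res_d {W : Opens X} (k : W ≤ V) (g : X.O K V) :
    (formSheaf K X).res k (Mfd.d g) = Mfd.d (resO K k g) :=
  Subtype.ext (funext fun x ↦ (dAt_res K k g x.2).symm)

lemma app_add (ξ : (tangentSheaf K X).sec V) (g h : X.O K V) :
    VF.app ξ (g + h) = VF.app ξ g + VF.app ξ h :=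
  O_ext fun x ↦ by rw [app_apply, dAt_add g h x.2]; rfl

lemma app_mul (ξ : (tangentSheaf K X).sec V) (g h : X.O K V) :
    VF.app ξ (g * h) = VF.app ξ g * h + g * VF.app ξ h :=
  O_ext fun x ↦ by
    rw [app_apply, dAt_mul g h x.2]
    change g.1 x * _ + h.1 x * _ = _ * h.1 x + g.1 x * _
    rw [add_comm, mul_comm (h.1 x)]
    rfl

lemma app_const (ξ : (tangentSheaf K X).sec V) (k : K) : VF.app ξ (const V k) = 0 :=
  O_ext fun x ↦ by rw [app_apply, dAt_const k x.2]; rfl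

lemma add_app (ξ η : (tangentSheaf K X).sec V) (g : X.O K V) :
    VF.app (ξ + η) g = VF.app ξ g + VF.app η g :=
  O_ext fun _ ↦ map_add (dAt g.1 _) _ _

lemma smul_app (h : X.O K V) (ξ : (tangentSheaf K X).sec V) (g : X.O K V) :
    VF.app (h • ξ) g = h * VF.app ξ g :=
  O_ext fun _ ↦ map_smul (dAt g.1 _) _ _

/-- `g ↦ ξ(g)` as an additive map. -/
def appHom (K : Type) [RCLike K] [NormedAlgebra 𝕜 K] (X : Mfd.{u} 𝕜 n) (V : Opens X) :
    (tangentSheaf K X).sec V →+ X.O K V →+ X.O K V :=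
  AddMonoidHom.mk' (fun ξ ↦ AddMonoidHom.mk' (VF.app ξ) (app_add ξ))
    (fun ξ η ↦ AddMonoidHom.ext (add_app ξ η))

lemma appHom_apply (ξ : (tangentSheaf K X).sec V) (g : X.O K V) :
    appHom K X V ξ g = VF.app ξ g := rfl

/-- `(ξ, α) ↦ α(ξ)` as a bilinear map. -/
def contractHom (K : Type) [RCLike K] [NormedAlgebra 𝕜 K] (X : Mfd.{u} 𝕜 n) (V : Opens X) :
    (tangentSheaf K X).sec V →ₗ[X.O K V] (formSheaf K X).sec V →ₗ[X.O K V] X.O K V :=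
  LinearMap.mk₂ _ (fun ξ α ↦ Form.contract ξ α)
    (fun ξ η α ↦ O_ext fun x ↦ map_add (α.1 x) _ _)
    (fun g ξ α ↦ O_ext fun x ↦ map_smul (α.1 x) _ _)
    (fun _ _ _ ↦ rfl) (fun _ _ _ ↦ rfl)

lemma contractHom_apply (ξ : (tangentSheaf K X).sec V) (α : (formSheaf K X).sec V) :
    contractHom K X V ξ α = Form.contract ξ α := rfl

/-- The differential as an additive map. -/
def dHom (K : Type) [RCLike K] [NormedAlgebra 𝕜 K] (X : Mfd.{u} 𝕜 n) (V : Opens X) :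
    X.O K V →+ (formSheaf K X).sec V :=
  AddMonoidHom.mk' (fun g ↦ Mfd.d g) (fun g h ↦ Subtype.ext (funext fun x ↦ dAt_add g h x.2))

lemma dHom_apply (g : X.O K V) : dHom K X V g = Mfd.d g := rfl

lemma dHom_mul (g h : X.O K V) : dHom K X V (g * h) = g • dHom K X V h + h • dHom K X V g :=
  Subtype.ext (funext fun x ↦ dAt_mul g h x.2)

lemma dHom_const (k : K) : dHom K X V (const V k) = 0 :=
  Subtype.ext (funext fun x ↦ dAt_const k x.2)

lemma contract_d (ξ : (tangentSheaf K X).sec V) (g : X.O K V) :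
    contractHom K X V ξ (dHom K X V g) = VF.app ξ g := rfl

end Rules

/-! ### Separation -/

/-- By `coord_span` the coordinate functions of the chart at x already separate tangent vectors, and
they may be restricted to any neighbourhood. -/
lemma tan_ext {V : Opens X} {x : X} (hx : x ∈ V) {v w : X.Tan K x}
    (h : ∀ (W : Opens X), W ≤ V → x ∈ W → ∀ g : X.O K W, dAt g.1 x v = dAt g.1 x w) : v = w := by
  rw [coord_span (mem_chartDom x) v, coord_span (mem_chartDom x) w]
  refine Finset.sum_congr rfl fun i _ ↦ ?_
  have e := h (chartDom x ⊓ V) inf_le_right ⟨mem_chartDom x, hx⟩ (resO K inf_le_left (coord K x i))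
  have hx' : x ∈ chartDom x ⊓ V := ⟨mem_chartDom x, hx⟩
  rw [dAt_res K _ _ hx'] at e
  rw [e]

lemma vf_ext {V : Opens X} {ξ η : (tangentSheaf K X).sec V}
    (h : ∀ (W : Opens X) (k : W ≤ V) (g : X.O K W),
      VF.app ((tangentSheaf K X).res k ξ) g = VF.app ((tangentSheaf K X).res k η) g) : ξ = η :=
  Subtype.ext <| funext fun x ↦ tan_ext x.2 fun W k hx g ↦
    congrFun (congrArg Subtype.val (h W k g)) ⟨x, hx⟩

/-- A combination of coordinate fields with constant coefficients. It provides enough local vector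
fields to separate one-forms in `form_ext`. -/
lemma exists_vf {x : X} (v : X.Tan K x) :
    ∃ ζ : (tangentSheaf K X).sec (chartDom x), ζ.1 ⟨x, mem_chartDom x⟩ = v := by
  refine ⟨∑ i, const (chartDom x) (dAt (coord K x i).1 x v) • coordVec K x i, ?_⟩
  have e : ∀ (s : Finset (Fin X.dim)) (φ : Fin X.dim → (tangentSheaf K X).sec (chartDom x)),
      (∑ i ∈ s, φ i).1 ⟨x, mem_chartDom x⟩ = ∑ i ∈ s, (φ i).1 ⟨x, mem_chartDom x⟩ := by
    intro s φ
    induction s using Finset.cons_induction with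
    | empty => rfl
    | cons a s ha ih => rw [Finset.sum_cons, Finset.sum_cons, ← ih]; rfl
  rw [e]
  exact (coord_span (mem_chartDom x) v).symm

lemma form_ext {V : Opens X} {α β : (formSheaf K X).sec V}
    (h : ∀ (W : Opens X) (k : W ≤ V) (ζ : (tangentSheaf K X).sec W),
      Form.contract ζ ((formSheaf K X).res k α) = Form.contract ζ ((formSheaf K X).res k β)) :
    α = β :=
  Subtype.ext <| funext fun x ↦ LinearMap.ext fun v ↦ by
    obtain ⟨ζ, rfl⟩ := exists_vf v
    exact congrFun (congrArg Subtype.val (h (chartDom x ⊓ V) inf_le_right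
      ((tangentSheaf K X).res inf_le_left ζ))) ⟨x, mem_chartDom _, x.2⟩

/-! ### Expansions in coordinates -/

section Coordinates

variable {x₀ : X} {V : Opens X}

lemma vf_coord (hV : V ≤ chartDom x₀) (ξ : (tangentSheaf K X).sec V) :
    ξ = ∑ i, VF.app ξ (resO K hV (coord K x₀ i)) • (tangentSheaf K X).res hV (coordVec K x₀ i) := by
  refine vf_ext fun W k g ↦ ?_
  rw [map_sum, ← appHom_apply, ← appHom_apply, map_sum, AddMonoidHom.finsetSum_apply]
  simp only [PreMod.res_smul, appHom_apply, smul_app, resO_app]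
  refine O_ext fun x ↦ ?_
  rw [app_apply]
  conv_lhs => rw [coord_span (hV (k x.2)) (((tangentSheaf K X).res k ξ).1 x), map_sum]
  have e : ∀ (s : Finset (Fin X.dim)) (φ : Fin X.dim → X.O K W),
      (∑ i ∈ s, φ i).1 x = ∑ i ∈ s, (φ i).1 x := fun s φ ↦ map_sum (evalO K x) φ s
  rw [e]
  refine Finset.sum_congr rfl fun i _ ↦ ?_
  rw [map_smul]
  have e' : (VF.app ((tangentSheaf K X).res k ξ) (resO K k (resO K hV (coord K x₀ i)))).1 x =
      dAt (coord K x₀ i).1 x (((tangentSheaf K X).res k ξ).1 x) := by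
    rw [app_apply, dAt_res K k _ x.2, dAt_res K hV _ (k x.2)]
  rw [← e']
  rfl

lemma form_coord (hV : V ≤ chartDom x₀) (α : (formSheaf K X).sec V) :
    α = ∑ i, Form.contract ((tangentSheaf K X).res hV (coordVec K x₀ i)) α •
      dHom K X V (resO K hV (coord K x₀ i)) := by
  refine form_ext fun W k ζ ↦ ?_
  rw [← contractHom_apply, ← contractHom_apply, map_sum, map_sum]
  conv_lhs => rw [vf_coord (k.trans hV) ζ, map_sum, LinearMap.sum_apply]
  refine Finset.sum_congr rfl fun i _ ↦ ?_
  rw [PreMod.res_smul, map_smul, map_smul, LinearMap.smul_apply, dHom_apply, res_d, ← dHom_apply,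
    contract_d, smul_eq_mul, smul_eq_mul, mul_comm]
  rfl

/-- Coordinate expression of the Lie bracket. -/
lemma exists_isBracket_of_le (hV : V ≤ chartDom x₀) (ξ η : (tangentSheaf K X).sec V) : ∃ ζ, IsBracket ζ ξ η := by
  let x i := resO K hV (coord K x₀ i)
  refine ⟨∑ i, (VF.app ξ (VF.app η (x i)) - VF.app η (VF.app ξ (x i))) •
    (tangentSheaf K X).res hV (coordVec K x₀ i), fun W k g ↦ ?_⟩
  have e : ∀ (ξ : (tangentSheaf K X).sec V) (g : X.O K W),
      appHom K X W ((tangentSheaf K X).res k ξ) g = ∑ i, resO K k (VF.app ξ (x i)) *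
        VF.app ((tangentSheaf K X).res (k.trans hV) (coordVec K x₀ i)) g := fun ξ g ↦ by
    conv_lhs => rw [vf_coord hV ξ]
    rw [map_sum, map_sum, AddMonoidHom.finsetSum_apply]
    refine Finset.sum_congr rfl fun i _ ↦ ?_
    rw [PreMod.res_smul, appHom_apply, smul_app]
    rfl
  -- The product rule splits ξ(η(g)) into a first-order and a second-order part in g.
  have e2 : ∀ (ξ η : (tangentSheaf K X).sec V), appHom K X W ((tangentSheaf K X).res k ξ)
      (appHom K X W ((tangentSheaf K X).res k η) g) =
      ∑ i, resO K k (VF.app ξ (VF.app η (x i))) *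
          VF.app ((tangentSheaf K X).res (k.trans hV) (coordVec K x₀ i)) g +
        ∑ i, ∑ j, resO K k (VF.app ξ (x j)) * resO K k (VF.app η (x i)) *
          VF.app ((tangentSheaf K X).res (k.trans hV) (coordVec K x₀ j))
            (VF.app ((tangentSheaf K X).res (k.trans hV) (coordVec K x₀ i)) g) := fun ξ η ↦ by
    rw [e η, map_sum, ← Finset.sum_add_distrib]
    refine Finset.sum_congr rfl fun i _ ↦ ?_
    rw [appHom_apply, app_mul, ← resO_app]
    change _ + _ * appHom K X W ((tangentSheaf K X).res k ξ) _ = _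
    rw [e ξ, Finset.mul_sum]
    congr 1
    exact Finset.sum_congr rfl fun j _ ↦ by ring
  rw [← appHom_apply, ← appHom_apply, ← appHom_apply, ← appHom_apply, ← appHom_apply, e2, e2,
    map_sum, map_sum, AddMonoidHom.finsetSum_apply]
  rw [Finset.sum_comm (γ := Fin X.dim) (f := fun i j ↦ resO K k (VF.app η (x j)) * _ * _),
    add_sub_add_comm, ← Finset.sum_sub_distrib, ← Finset.sum_sub_distrib]
  -- The second-order parts of ξη and ηξ agree because the coordinate fields commute.
  have e3 : ∑ i, ((∑ j, resO K k (VF.app ξ (x j)) * resO K k (VF.app η (x i)) *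
          VF.app ((tangentSheaf K X).res (k.trans hV) (coordVec K x₀ j))
            (VF.app ((tangentSheaf K X).res (k.trans hV) (coordVec K x₀ i)) g)) -
        ∑ j, resO K k (VF.app η (x i)) * resO K k (VF.app ξ (x j)) *
          VF.app ((tangentSheaf K X).res (k.trans hV) (coordVec K x₀ i))
            (VF.app ((tangentSheaf K X).res (k.trans hV) (coordVec K x₀ j)) g)) = 0 := by
    refine Finset.sum_eq_zero fun i _ ↦ ?_
    rw [← Finset.sum_sub_distrib]
    refine Finset.sum_eq_zero fun j _ ↦ ?_
    rw [coord_comm, mul_comm (resO K k (VF.app η (x i))), sub_self]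
  rw [e3, add_zero]
  refine Finset.sum_congr rfl fun i _ ↦ ?_
  rw [PreMod.res_smul, appHom_apply, smul_app, map_sub, sub_mul]
  rfl

end Coordinates

end Derivative

end Mfd

namespace Mfd

variable {𝕜 : Type} [RCLike 𝕜] {n : WithTop ℕ∞} {K : Type} [RCLike K] [NormedAlgebra 𝕜 K]
variable {X Y : Mfd.{u} 𝕜 n} [Fact (∞ ≤ n)]

/-! ### The Lie bracket -/

section LieBracket

variable {V : Opens X}

lemma IsBracket.res {ζ ξ η : (tangentSheaf K X).sec V} (H : IsBracket ζ ξ η) {W : Opens X}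
    (k : W ≤ V) : IsBracket ((tangentSheaf K X).res k ζ) ((tangentSheaf K X).res k ξ)
      ((tangentSheaf K X).res k η) :=
  fun W' h g ↦ H W' (h.trans k) g

lemma IsBracket.unique {ζ ζ' ξ η : (tangentSheaf K X).sec V} (H : IsBracket ζ ξ η)
    (H' : IsBracket ζ' ξ η) : ζ = ζ' :=
  vf_ext fun W k g ↦ (H W k g).trans (H' W k g).symm

/-- The commutator of two derivations has to be shown to come from a vector field. In charts this is
a coordinate formula; the local brackets agree on overlaps by `IsBracket.unique`, hence glue. -/
lemma exists_isBracket (ξ η : (tangentSheaf K X).sec V) : ∃ ζ, IsBracket ζ ξ η := by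
  obtain ⟨t, ht⟩ := (tangentSheaf K X).exists_of_local (U := V)
    (fun {W} h ζ ↦ IsBracket ζ ((tangentSheaf K X).res h ξ) ((tangentSheaf K X).res h η))
    (fun h k s H ↦ H.res k) (fun h s t H H' ↦ H.unique H')
    (fun x hx ↦ by
      obtain ⟨ζ, hζ⟩ := exists_isBracket_of_le (inf_le_right : V ⊓ chartDom x ≤ chartDom x)
        ((tangentSheaf K X).res inf_le_left ξ) ((tangentSheaf K X).res inf_le_left η)
      exact ⟨_, inf_le_left, ζ, ⟨hx, mem_chartDom x⟩, hζ⟩)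
  refine ⟨t, fun W h g ↦ O_eq_of_local fun x hx ↦ ⟨W ⊓ chartDom x, inf_le_left,
    ⟨hx, mem_chartDom x⟩, ?_⟩⟩
  obtain ⟨ζ, hζ⟩ := exists_isBracket_of_le (inf_le_right : W ⊓ chartDom x ≤ chartDom x)
        ((tangentSheaf K X).res (inf_le_left.trans h) ξ)
        ((tangentSheaf K X).res (inf_le_left.trans h) η)
  have e := ht (inf_le_left.trans h) ζ hζ
  have e' := hζ _ le_rfl (resO K inf_le_left g)
  rw [← e] at e'
  rw [map_sub, resO_app, resO_app, resO_app, resO_app, resO_app]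
  exact e'

/-- The Lie bracket of vector fields. -/
def lieB (ξ η : (tangentSheaf K X).sec V) : (tangentSheaf K X).sec V :=
  (exists_isBracket ξ η).choose

lemma isBracket_lieB (ξ η : (tangentSheaf K X).sec V) : IsBracket (lieB ξ η) ξ η :=
  (exists_isBracket ξ η).choose_spec

lemma IsBracket.eq_lieB {ζ ξ η : (tangentSheaf K X).sec V} (H : IsBracket ζ ξ η) :
    ζ = lieB ξ η := H.unique (isBracket_lieB ξ η)

lemma app_lieB (ξ η : (tangentSheaf K X).sec V) (g : X.O K V) :
    VF.app (lieB ξ η) g = VF.app ξ (VF.app η g) - VF.app η (VF.app ξ g) :=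
  isBracket_lieB ξ η V le_rfl g

lemma res_lieB {W : Opens X} (k : W ≤ V) (ξ η : (tangentSheaf K X).sec V) :
    (tangentSheaf K X).res k (lieB ξ η) =
      lieB ((tangentSheaf K X).res k ξ) ((tangentSheaf K X).res k η) :=
  ((isBracket_lieB ξ η).res k).eq_lieB

lemma app_zero_right (ξ : (tangentSheaf K X).sec V) : VF.app ξ (0 : X.O K V) = 0 :=
  map_zero (appHom K X V ξ)

lemma app_sub (ξ : (tangentSheaf K X).sec V) (g h : X.O K V) :
    VF.app ξ (g - h) = VF.app ξ g - VF.app ξ h := map_sub (appHom K X V ξ) g h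

lemma neg_app (ξ : (tangentSheaf K X).sec V) (g : X.O K V) :
    VF.app (-ξ) g = -VF.app ξ g := by
  rw [← appHom_apply, map_neg]; rfl

lemma lieB_add (ξ η ζ : (tangentSheaf K X).sec V) : lieB ξ (η + ζ) = lieB ξ η + lieB ξ ζ :=
  vf_ext fun W k g ↦ by
    rw [res_lieB, map_add, map_add, res_lieB, res_lieB]
    simp only [app_lieB, add_app, app_add]
    ring

lemma lieB_swap (ξ η : (tangentSheaf K X).sec V) : lieB η ξ = -lieB ξ η :=
  vf_ext fun W k g ↦ by
    rw [res_lieB, map_neg, res_lieB]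
    simp only [app_lieB, neg_app]
    ring

lemma add_lieB (ξ η ζ : (tangentSheaf K X).sec V) : lieB (ξ + η) ζ = lieB ξ ζ + lieB η ζ := by
  rw [lieB_swap ζ (ξ + η), lieB_add, lieB_swap ζ ξ, lieB_swap ζ η, neg_add]

lemma lieB_smul (ξ : (tangentSheaf K X).sec V) (g : X.O K V) (η : (tangentSheaf K X).sec V) :
    lieB ξ (g • η) = g • lieB ξ η + VF.app ξ g • η :=
  vf_ext fun W k h ↦ by
    rw [res_lieB, map_add, PreMod.res_smul, PreMod.res_smul, PreMod.res_smul, res_lieB, resO_app]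
    simp only [app_lieB, add_app, smul_app, app_mul]
    ring

lemma lieB_jacobi (ξ η ζ : (tangentSheaf K X).sec V) :
    lieB ξ (lieB η ζ) = lieB (lieB ξ η) ζ + lieB η (lieB ξ ζ) :=
  vf_ext fun W k h ↦ by
    rw [map_add]
    simp only [res_lieB, app_lieB, add_app, app_sub]
    ring

/-- The Lie bracket as a biadditive map. -/
def lieBHom (K : Type) [RCLike K] [NormedAlgebra 𝕜 K] (X : Mfd.{u} 𝕜 n) (V : Opens X) :
    (tangentSheaf K X).sec V →+ (tangentSheaf K X).sec V →+ (tangentSheaf K X).sec V :=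
  AddMonoidHom.mk' (fun ξ ↦ AddMonoidHom.mk' (lieB ξ) (lieB_add ξ))
    (fun ξ η ↦ AddMonoidHom.ext (add_lieB ξ η))

end LieBracket

/-! ### One-forms from functionals -/

section Forms

variable {V : Opens X}

lemma contract_add (ξ : (tangentSheaf K X).sec V) (α β : (formSheaf K X).sec V) :
    Form.contract ξ (α + β) = Form.contract ξ α + Form.contract ξ β := rfl

lemma contract_smul (ξ : (tangentSheaf K X).sec V) (g : X.O K V) (α : (formSheaf K X).sec V) :
    Form.contract ξ (g • α) = g * Form.contract ξ α := rfl

lemma add_contract (ξ η : (tangentSheaf K X).sec V) (α : (formSheaf K X).sec V) :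
    Form.contract (ξ + η) α = Form.contract ξ α + Form.contract η α := by
  rw [← contractHom_apply, map_add]; rfl

lemma smul_contract (g : X.O K V) (ξ : (tangentSheaf K X).sec V) (α : (formSheaf K X).sec V) :
    Form.contract (g • ξ) α = g * Form.contract ξ α := by
  rw [← contractHom_apply, map_smul]; rfl

lemma contract_sub (ξ : (tangentSheaf K X).sec V) (α β : (formSheaf K X).sec V) :
    Form.contract ξ (α - β) = Form.contract ξ α - Form.contract ξ β :=
  map_sub (contractHom K X V ξ) α β

lemma neg_contract (ξ : (tangentSheaf K X).sec V) (α : (formSheaf K X).sec V) :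
    Form.contract (-ξ) α = -Form.contract ξ α := by
  rw [← contractHom_apply, map_neg]; rfl

lemma res_dHom {W : Opens X} (k : W ≤ V) (g : X.O K V) :
    (formSheaf K X).res k (dHom K X V g) = dHom K X W (resO K k g) := res_d k g

/-- In a chart the form is ∑ Φ(∂_i) dx_i, and linearity over functions gives the correct value on
every field. By `form_ext` the local forms agree on overlaps and glue. The Lie derivative is
obtained from its defining formula in this way. -/
lemma exists_form_of_functional (Φ : ∀ {W : Opens X}, W ≤ V →
      (tangentSheaf K X).sec W →ₗ[X.O K W] X.O K W)
    (hΦ : ∀ {W W' : Opens X} (h : W ≤ V) (k : W' ≤ W) (ζ : (tangentSheaf K X).sec W),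
      resO K k (Φ h ζ) = Φ (k.trans h) ((tangentSheaf K X).res k ζ)) :
    ∃ β : (formSheaf K X).sec V, ∀ {W : Opens X} (h : W ≤ V) (ζ : (tangentSheaf K X).sec W),
      Form.contract ζ ((formSheaf K X).res h β) = Φ h ζ := by
  have hloc : ∀ (W : Opens X) (h : W ≤ V) (x₀ : X) (hW : W ≤ chartDom x₀),
      ∃ β : (formSheaf K X).sec W, ∀ (W' : Opens X) (k : W' ≤ W) (ζ : (tangentSheaf K X).sec W'),
        Form.contract ζ ((formSheaf K X).res k β) = Φ (k.trans h) ζ := fun W h x₀ hW ↦ by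
    refine ⟨∑ i, Φ h ((tangentSheaf K X).res hW (coordVec K x₀ i)) •
      dHom K X W (resO K hW (coord K x₀ i)), fun W' k ζ ↦ ?_⟩
    conv_rhs => rw [vf_coord (k.trans hW) ζ]
    rw [← contractHom_apply, map_sum, map_sum, map_sum]
    refine Finset.sum_congr rfl fun i _ ↦ ?_
    rw [PreMod.res_smul, map_smul, map_smul, dHom_apply, res_d, ← dHom_apply, contract_d, hΦ,
      smul_eq_mul, smul_eq_mul, mul_comm]
    rfl
  obtain ⟨t, ht⟩ := (formSheaf K X).exists_of_local (U := V)
    (fun {W} h β ↦ ∀ (W' : Opens X) (k : W' ≤ W) (ζ : (tangentSheaf K X).sec W'),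
      Form.contract ζ ((formSheaf K X).res k β) = Φ (k.trans h) ζ)
    (fun h k s H W' k' ζ ↦ H W' (k'.trans k) ζ)
    (fun h s t H H' ↦ form_ext fun W k ζ ↦ (H W k ζ).trans (H' W k ζ).symm)
    (fun x hx ↦ by
      obtain ⟨β, hβ⟩ := hloc (V ⊓ chartDom x) inf_le_left x inf_le_right
      exact ⟨_, inf_le_left, β, ⟨hx, mem_chartDom x⟩, hβ⟩)
  refine ⟨t, fun {W} h ζ ↦ O_eq_of_local fun x hx ↦ ⟨W ⊓ chartDom x, inf_le_left,
    ⟨hx, mem_chartDom x⟩, ?_⟩⟩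
  obtain ⟨β, hβ⟩ := hloc (W ⊓ chartDom x) (inf_le_left.trans h) x inf_le_right
  rw [hΦ, ← hβ _ le_rfl, ← ht (inf_le_left.trans h) β hβ]
  rfl

/-- The expression ξ(α(ζ)) - α([ξ,ζ]) is linear over functions in ζ: for gζ the two terms ξ(g) α(ζ)
cancel. -/
lemma exists_isLieDeriv (ξ : (tangentSheaf K X).sec V) (α : (formSheaf K X).sec V) :
    ∃ β : (formSheaf K X).sec V, ∀ {W : Opens X} (h : W ≤ V) (ζ : (tangentSheaf K X).sec W),
      Form.contract ζ ((formSheaf K X).res h β) =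
        VF.app ((tangentSheaf K X).res h ξ) (Form.contract ζ ((formSheaf K X).res h α)) -
          Form.contract (lieB ((tangentSheaf K X).res h ξ) ζ) ((formSheaf K X).res h α) :=
  exists_form_of_functional (fun {W} h ↦
    { toFun := fun ζ ↦
        VF.app ((tangentSheaf K X).res h ξ) (Form.contract ζ ((formSheaf K X).res h α)) -
          Form.contract (lieB ((tangentSheaf K X).res h ξ) ζ) ((formSheaf K X).res h α)
      map_add' := fun ζ θ ↦ by
        rw [lieB_add, add_contract, add_contract, app_add]
        ring
      map_smul' := fun g ζ ↦ by
        rw [lieB_smul, add_contract, smul_contract, smul_contract, smul_contract, app_mul,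
          RingHom.id_apply, smul_eq_mul]
        ring })
    (fun h k ζ ↦ by
      change resO K k (_ - _) = _ - _
      rw [map_sub, resO_app, resO_contract, resO_contract, res_lieB]
      rfl)

/-- The Lie derivative of a one-form. -/
def lieD (ξ : (tangentSheaf K X).sec V) (α : (formSheaf K X).sec V) : (formSheaf K X).sec V :=
  (exists_isLieDeriv ξ α).choose

lemma contract_res_lieD (ξ : (tangentSheaf K X).sec V) (α : (formSheaf K X).sec V) {W : Opens X}
    (h : W ≤ V) (ζ : (tangentSheaf K X).sec W) :
    Form.contract ζ ((formSheaf K X).res h (lieD ξ α)) =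
      VF.app ((tangentSheaf K X).res h ξ) (Form.contract ζ ((formSheaf K X).res h α)) -
        Form.contract (lieB ((tangentSheaf K X).res h ξ) ζ) ((formSheaf K X).res h α) :=
  (exists_isLieDeriv ξ α).choose_spec h ζ

lemma contract_lieD (ξ : (tangentSheaf K X).sec V) (α : (formSheaf K X).sec V)
    (ζ : (tangentSheaf K X).sec V) :
    Form.contract ζ (lieD ξ α) =
      VF.app ξ (Form.contract ζ α) - Form.contract (lieB ξ ζ) α :=
  contract_res_lieD ξ α le_rfl ζ

lemma res_lieD {W : Opens X} (k : W ≤ V) (ξ : (tangentSheaf K X).sec V)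
    (α : (formSheaf K X).sec V) : (formSheaf K X).res k (lieD ξ α) =
      lieD ((tangentSheaf K X).res k ξ) ((formSheaf K X).res k α) :=
  form_ext fun W' h ζ ↦ by
    rw [contract_res_lieD, PreMod.res_res, PreMod.res_res, PreMod.res_res, contract_res_lieD]

lemma isLieDeriv_lieD (ξ : (tangentSheaf K X).sec V) (α : (formSheaf K X).sec V) :
    IsLieDeriv (lieD ξ α) ξ α := fun W h η ζ H ↦ by
  rw [contract_res_lieD, H.eq_lieB]

lemma IsLieDeriv.eq_lieD {β : (formSheaf K X).sec V} {ξ : (tangentSheaf K X).sec V}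
    {α : (formSheaf K X).sec V} (H : IsLieDeriv β ξ α) : β = lieD ξ α :=
  form_ext fun W h ζ ↦ by
    rw [contract_res_lieD]
    exact H W h ζ _ (isBracket_lieB _ _)

lemma lieD_add (ξ : (tangentSheaf K X).sec V) (α β : (formSheaf K X).sec V) :
    lieD ξ (α + β) = lieD ξ α + lieD ξ β :=
  form_ext fun W k ζ ↦ by
    simp only [map_add, res_lieD, contract_lieD, contract_add, app_add]
    ring

lemma add_lieD (ξ η : (tangentSheaf K X).sec V) (α : (formSheaf K X).sec V) :
    lieD (ξ + η) α = lieD ξ α + lieD η α :=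
  form_ext fun W k ζ ↦ by
    simp only [map_add, res_lieD, contract_lieD, contract_add, add_app, add_lieB, add_contract]
    ring

lemma contract_dHom (ξ : (tangentSheaf K X).sec V) (g : X.O K V) :
    Form.contract ξ (dHom K X V g) = VF.app ξ g := rfl

lemma lieD_smul (ξ : (tangentSheaf K X).sec V) (g : X.O K V) (α : (formSheaf K X).sec V) :
    lieD ξ (g • α) = g • lieD ξ α + VF.app ξ g • α :=
  form_ext fun W k ζ ↦ by
    simp only [map_add, PreMod.res_smul, res_lieD, contract_lieD, contract_add, contract_smul,
      app_mul, resO_app]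
    ring

lemma smul_lieD (g : X.O K V) (ξ : (tangentSheaf K X).sec V) (α : (formSheaf K X).sec V) :
    lieD (g • ξ) α = g • lieD ξ α + Form.contract ξ α • dHom K X V g :=
  form_ext fun W k ζ ↦ by
    simp only [map_add, PreMod.res_smul, res_lieD, contract_lieD, contract_add, contract_smul,
      smul_app, res_dHom, contract_dHom, resO_contract]
    rw [lieB_swap ζ, lieB_smul, lieB_swap _ ζ, neg_contract, add_contract, smul_contract,
      smul_contract, neg_contract]
    ring

lemma lieD_d (ξ : (tangentSheaf K X).sec V) (g : X.O K V) :
    lieD ξ (dHom K X V g) = dHom K X V (VF.app ξ g) :=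
  form_ext fun W k ζ ↦ by
    simp only [res_dHom, res_lieD, contract_lieD, resO_app, contract_dHom, app_lieB]
    ring

lemma lieB_lieD (ξ η : (tangentSheaf K X).sec V) (α : (formSheaf K X).sec V) :
    lieD (lieB ξ η) α = lieD ξ (lieD η α) - lieD η (lieD ξ α) :=
  form_ext fun W k ζ ↦ by
    simp only [map_sub, res_lieD, res_lieB, contract_sub, contract_lieD, app_lieB, app_sub]
    generalize (tangentSheaf K X).res k ξ = ξ
    generalize (tangentSheaf K X).res k η = η
    generalize (formSheaf K X).res k α = α
    rw [lieB_jacobi ξ η ζ, add_contract]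
    ring

/-- The Lie derivative as a biadditive map. -/
def lieDHom (K : Type) [RCLike K] [NormedAlgebra 𝕜 K] (X : Mfd.{u} 𝕜 n) (V : Opens X) :
    (tangentSheaf K X).sec V →+ (formSheaf K X).sec V →+ (formSheaf K X).sec V :=
  AddMonoidHom.mk' (fun ξ ↦ AddMonoidHom.mk' (lieD ξ) (lieD_add ξ))
    (fun ξ η ↦ AddMonoidHom.ext (add_lieD ξ η))

/-- The Cartan calculus on an open set. -/
def cartan (K : Type) [RCLike K] [NormedAlgebra 𝕜 K] (X : Mfd.{u} 𝕜 n) (V : Opens X) :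
    CartanCalculus (X.O K V) ((tangentSheaf K X).sec V) ((formSheaf K X).sec V) where
  app := appHom K X V
  bra := lieBHom K X V
  d := dHom K X V
  ι := contractHom K X V
  lie := lieDHom K X V
  app_mul := app_mul
  smul_app := smul_app
  bra_app := app_lieB
  bra_smul := lieB_smul
  bra_swap := lieB_swap
  bra_jacobi := lieB_jacobi
  d_mul := dHom_mul
  ι_d := contract_d
  lie_smul := lieD_smul
  smul_lie := smul_lieD
  lie_d := lieD_d
  bra_lie := lieB_lieD
  ι_lie ζ ξ α := contract_lieD ξ α ζ

/-- The form `ι_η dα`. -/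
def ctrD (η : (tangentSheaf K X).sec V) (α : (formSheaf K X).sec V) : (formSheaf K X).sec V :=
  (cartan K X V).ctr η α

lemma ctrD_eq (η : (tangentSheaf K X).sec V) (α : (formSheaf K X).sec V) :
    ctrD η α = lieD η α - dHom K X V (Form.contract η α) := rfl

lemma res_ctrD {W : Opens X} (k : W ≤ V) (η : (tangentSheaf K X).sec V)
    (α : (formSheaf K X).sec V) : (formSheaf K X).res k (ctrD η α) =
      ctrD ((tangentSheaf K X).res k η) ((formSheaf K X).res k α) := by
  rw [ctrD_eq, ctrD_eq, map_sub, res_lieD, res_dHom, resO_contract]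

lemma isContractD_ctrD (η : (tangentSheaf K X).sec V) (α : (formSheaf K X).sec V) :
    IsContractD (ctrD η α) η α := fun W h ζ θ H ↦ by
  rw [H.eq_lieB, res_ctrD, ctrD_eq, contract_sub, contract_lieD]
  change _ - VF.app ζ _ = _
  ring

lemma IsContractD.eq_ctrD {β : (formSheaf K X).sec V} {η : (tangentSheaf K X).sec V}
    {α : (formSheaf K X).sec V} (H : IsContractD β η α) : β = ctrD η α :=
  form_ext fun W h ζ ↦ (H W h ζ _ (isBracket_lieB _ _)).trans
    (isContractD_ctrD η α W h ζ _ (isBracket_lieB _ _)).symm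

end Forms

/-! ### Pull-back of forms -/

section Pullback

variable (f : Hom Y X) {U : Opens X} {V : Opens Y}

/-- Near f(y) write α = ∑ a_i dx_i. By the chain rule the contraction with ζ is ∑ f^*a_i ·
ζ(f^*x_i), which is of class n. -/
lemma pull_mem (h : V ≤ f.preim U) (α : (formSheaf K X).sec U) :
    (fun y : V ↦ (α.1 ⟨f y, h y.2⟩).comp (f.push K y)) ∈ Y.Form K V := fun W k ζ ↦ by
  refine O_local K _ fun y ↦ ?_
  let U' := U ⊓ chartDom (f y)
  have hW : W ⊓ f.preim U' ≤ f.preim U' := inf_le_right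
  have hU : U' ≤ chartDom (f y) := inf_le_right
  refine ⟨W ⊓ f.preim U', inf_le_left, ⟨y.2, h (k y.2), mem_chartDom _⟩, ?_⟩
  let a : Fin X.dim → X.O K U' := fun i ↦ Form.contract
    ((tangentSheaf K X).res hU (coordVec K (f y) i)) ((formSheaf K X).res inf_le_left α)
  convert (∑ i, f.pullO K hW (a i) * VF.app ((tangentSheaf K Y).res inf_le_left ζ)
    (f.pullO K hW (resO K hU (coord K (f y) i)))).2 using 1
  funext z
  have e := form_coord hU ((formSheaf K X).res inf_le_left α)
  have e1 : ∀ (s : Finset (Fin X.dim)) (φ : Fin X.dim → Y.O K (W ⊓ f.preim U')),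
      (∑ i ∈ s, φ i).1 z = ∑ i ∈ s, (φ i).1 z := fun s φ ↦ map_sum (evalO K z) φ s
  have e2 : ∀ (s : Finset (Fin X.dim)) (φ : Fin X.dim → (formSheaf K X).sec U'),
      (∑ i ∈ s, φ i).1 ⟨f z, z.2.2⟩ = ∑ i ∈ s, (φ i).1 ⟨f z, z.2.2⟩ := by
    intro s φ
    induction s using Finset.cons_induction with
    | empty => rfl
    | cons a s ha ih => rw [Finset.sum_cons, Finset.sum_cons, ← ih]; rfl
  refine Eq.trans ?_ (e1 _ _).symm
  have e3 := (congrFun (congrArg Subtype.val e) ⟨f z, z.2.2⟩).trans (e2 _ _)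
  refine (LinearMap.congr_fun e3 (f.push K z (ζ.1 ⟨z, z.2.1⟩))).trans ?_
  rw [LinearMap.sum_apply]
  refine Finset.sum_congr rfl fun i _ ↦ ?_
  exact congrArg₂ (· * ·) rfl (dAt_pullO f hW (resO K hU (coord K (f y) i)) z.2 _).symm

/-- Pull-back of one-forms. -/
def Hom.pullForm (h : V ≤ f.preim U) (α : (formSheaf K X).sec U) : (formSheaf K Y).sec V :=
  (⟨_, pull_mem f h α⟩ : Y.Form K V)

lemma isFormPullback_iff (h : V ≤ f.preim U) (β : (formSheaf K Y).sec V)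
    (α : (formSheaf K X).sec U) : IsFormPullback f h β α ↔ β = f.pullForm h α :=
  ⟨fun H ↦ Subtype.ext (funext H), fun e y ↦ congrFun (congrArg Subtype.val e) y⟩

lemma pullForm_add (h : V ≤ f.preim U) (α β : (formSheaf K X).sec U) :
    f.pullForm h (α + β) = f.pullForm h α + f.pullForm h β := rfl

lemma pullForm_smul (h : V ≤ f.preim U) (g : X.O K U) (α : (formSheaf K X).sec U) :
    f.pullForm h (g • α) = f.pullO K h g • f.pullForm h α := rfl

lemma pullForm_d (h : V ≤ f.preim U) (g : X.O K U) :
    f.pullForm h (dHom K X U g) = dHom K Y V (f.pullO K h g) :=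
  Subtype.ext <| funext fun y ↦ LinearMap.ext fun v ↦ (dAt_pullO f h g y.2 v).symm

end Pullback

end Mfd

namespace Mfd

variable {𝕜 : Type} [RCLike 𝕜] {n : WithTop ℕ∞} {K : Type} [RCLike K] [NormedAlgebra 𝕜 K]
variable {X Y : Mfd.{u} 𝕜 n} [Fact (∞ ≤ n)]

/-! ### The exterior derivative at a point -/

/-- The value of `dα` at a point. -/
def twoForm {U : Opens X} (α : (formSheaf K X).sec U) (x : X) :
    X.Tan K x →ₗ[K] Module.Dual K (X.Tan K x) :=
  ∑ i, (LinearMap.smulRight (dAt (Form.contract ((tangentSheaf K X).res inf_le_right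
      (coordVec K x i)) ((formSheaf K X).res (inf_le_left : U ⊓ chartDom x ≤ U) α)).1 x)
        (dAt (coord K x i).1 x) -
    LinearMap.smulRight (dAt (coord K x i).1 x) (dAt (Form.contract ((tangentSheaf K X).res
      inf_le_right (coordVec K x i))
        ((formSheaf K X).res (inf_le_left : U ⊓ chartDom x ≤ U) α)).1 x))

lemma form_sum_apply {V : Opens X} {ι : Type*} (s : Finset ι) (φ : ι → (formSheaf K X).sec V)
    (x : V) : (∑ i ∈ s, φ i).1 x = ∑ i ∈ s, (φ i).1 x := by
  induction s using Finset.cons_induction with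
  | empty => rfl
  | cons a s ha ih => rw [Finset.sum_cons, Finset.sum_cons, ← ih]; rfl

/-- Contraction with d(∑ a_i db_i) = ∑ da_i ∧ db_i. With coordinate functions for the b_i this
becomes the expression that defines `twoForm`. -/
lemma ctrD_sum_apply {V : Opens X} {m : ℕ} (η : (tangentSheaf K X).sec V) (a b : Fin m → X.O K V)
    (x : V) : (ctrD η (∑ i, a i • dHom K X V (b i))).1 x =
      ∑ i, (dAt (a i).1 x (η.1 x) • dAt (b i).1 x - dAt (b i).1 x (η.1 x) • dAt (a i).1 x) := by
  have e : ctrD η (∑ i, a i • dHom K X V (b i)) =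
      ∑ i, (VF.app η (a i) • dHom K X V (b i) - VF.app η (b i) • dHom K X V (a i)) := by
    change AddMonoidHom.mk' ((cartan K X V).ctr η) ((cartan K X V).ctr_add η) _ = _
    rw [map_sum]
    refine Finset.sum_congr rfl fun i _ ↦ ?_
    refine ((cartan K X V).ctr_smul η (a i) _).trans ?_
    rw [show dHom K X V (b i) = (cartan K X V).d (b i) from rfl, (cartan K X V).ctr_d, smul_zero,
      zero_add, (cartan K X V).ι_d]
    rfl
  rw [e, form_sum_apply]
  rfl

lemma pullForm_sum (f : Hom Y X) {U : Opens X} {V : Opens Y} (h : V ≤ f.preim U) {ι : Type*}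
    (s : Finset ι) (φ : ι → (formSheaf K X).sec U) :
    f.pullForm h (∑ i ∈ s, φ i) = ∑ i ∈ s, f.pullForm h (φ i) :=
  map_sum (AddMonoidHom.mk' (f.pullForm h) (pullForm_add f h)) φ s

/-- The exterior derivative commutes with inverse images. -/
lemma ctrD_pullForm (f : Hom Y X) {U : Opens X} {V : Opens Y} (h : V ≤ f.preim U)
    (α : (formSheaf K X).sec U) (η : (tangentSheaf K Y).sec V) (y : V) (w : Y.Tan K y) :
    (ctrD η (f.pullForm h α)).1 y w =
      twoForm α (f y) (f.push K y (η.1 y)) (f.push K y w) := by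
  let U' := U ⊓ chartDom (f y)
  let W := V ⊓ f.preim U'
  have hW : W ≤ f.preim U' := inf_le_right
  have hU : U' ≤ chartDom (f y) := inf_le_right
  have hy : (y : Y) ∈ W := ⟨y.2, h y.2, mem_chartDom _⟩
  have e1 : (formSheaf K Y).res (inf_le_left : W ≤ V) (f.pullForm h α) =
      f.pullForm hW ((formSheaf K X).res inf_le_left α) := rfl
  have e2 : (ctrD η (f.pullForm h α)).1 y =
      ((formSheaf K Y).res (inf_le_left : W ≤ V) (ctrD η (f.pullForm h α))).1 ⟨y, hy⟩ := rfl
  rw [e2, res_ctrD, e1, form_coord hU ((formSheaf K X).res inf_le_left α), pullForm_sum]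
  simp only [pullForm_smul, pullForm_d]
  rw [ctrD_sum_apply, LinearMap.sum_apply, twoForm, LinearMap.sum_apply, LinearMap.sum_apply]
  refine Finset.sum_congr rfl fun i _ ↦ ?_
  have e3 : ∀ v : Y.Tan K y, dAt (f.pullO K hW (resO K hU (coord K (f y) i))).1 y v =
      dAt (coord K (f y) i).1 (f y) (f.push K y v) := fun v ↦ by
    rw [dAt_pullO f hW _ hy, dAt_res K hU _ (hW hy)]
  rw [LinearMap.sub_apply, LinearMap.sub_apply, LinearMap.sub_apply]
  refine congrArg₂ (· - ·) (congrArg₂ (· * ·) (dAt_pullO f hW _ hy _) (e3 w))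
    (congrArg₂ (· * ·) (e3 _) (dAt_pullO f hW _ hy _))

/-- The companion of `ctrD_pullForm` on X itself, by the same coordinate computation. Together they
reduce contractions of dα upstairs and downstairs to one bilinear form at f(y), in which an anchor
value may be exchanged for df(ξ). -/
lemma ctrD_res_apply {U W : Opens X} (k : W ≤ U) (α : (formSheaf K X).sec U)
    (η : (tangentSheaf K X).sec W) (x : W) (w : X.Tan K x) :
    (ctrD η ((formSheaf K X).res k α)).1 x w = twoForm α x (η.1 x) w := by
  let U' := U ⊓ chartDom (x : X)
  let W' := W ⊓ chartDom (x : X)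
  have hU : U' ≤ chartDom (x : X) := inf_le_right
  have hW : W' ≤ U' := inf_le_inf_right _ k
  have hx : (x : X) ∈ W' := ⟨x.2, mem_chartDom _⟩
  have e1 : (formSheaf K X).res (inf_le_left : W' ≤ W) ((formSheaf K X).res k α) =
      (formSheaf K X).res hW ((formSheaf K X).res inf_le_left α) := rfl
  have e2 : (ctrD η ((formSheaf K X).res k α)).1 x =
      ((formSheaf K X).res (inf_le_left : W' ≤ W) (ctrD η ((formSheaf K X).res k α))).1 ⟨x, hx⟩ :=
    rfl
  rw [e2, res_ctrD, e1, form_coord hU ((formSheaf K X).res inf_le_left α), map_sum]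
  simp only [PreMod.res_smul, res_dHom]
  rw [ctrD_sum_apply, LinearMap.sum_apply, twoForm, LinearMap.sum_apply, LinearMap.sum_apply]
  refine Finset.sum_congr rfl fun i _ ↦ ?_
  have e3 : dAt (resO K hW (resO K hU (coord K (x : X) i))).1 x = dAt (coord K (x : X) i).1 x := by
    rw [dAt_res K hW _ hx, dAt_res K hU _ (hW hx)]
  rw [e3, dAt_res K hW _ hx]
  rfl

end Mfd

/-! ### Lie and Courant algebroids as brackets with an invariant pairing -/

section Modules

variable {𝕜 : Type} [RCLike 𝕜] {n : WithTop ℕ∞} {K : Type} [RCLike K] [NormedAlgebra 𝕜 K]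
variable {X Y : Mfd.{u} 𝕜 n}

/-- A sheaf of modules with a Leibniz bracket, an anchor and an invariant symmetric pairing. -/
structure PairedBracket (M : OMod K X) where
  anchor : OMod.Hom M (tangentSheaf K X)
  br : ∀ {U : Opens X}, M.sec U → M.sec U → M.sec U
  pair : ∀ {U : Opens X}, M.sec U → M.sec U → X.O K U
  res_br : ∀ {U V : Opens X} (h : V ≤ U) (a b : M.sec U),
    M.res h (br a b) = br (M.res h a) (M.res h b)
  add_br : ∀ {U : Opens X} (a b c : M.sec U), br (a + b) c = br a c + br b c
  br_add : ∀ {U : Opens X} (a b c : M.sec U), br a (b + c) = br a b + br a c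
  jacobi : ∀ {U : Opens X} (a b c : M.sec U), br a (br b c) = br (br a b) c + br b (br a c)
  anchor_br : ∀ {U : Opens X} (a b : M.sec U),
    IsBracket (anchor.app U (br a b)) (anchor.app U a) (anchor.app U b)
  leibniz : ∀ {U : Opens X} (a b : M.sec U) (g : X.O K U),
    br a (g • b) = g • br a b + VF.app (anchor.app U a) g • b
  res_pair : ∀ {U V : Opens X} (h : V ≤ U) (a b : M.sec U),
    resO K h (pair a b) = pair (M.res h a) (M.res h b)
  pair_symm : ∀ {U : Opens X} (a b : M.sec U), pair a b = pair b a
  add_pair : ∀ {U : Opens X} (a b c : M.sec U), pair (a + b) c = pair a c + pair b c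
  smul_pair : ∀ {U : Opens X} (g : X.O K U) (a b : M.sec U), pair (g • a) b = g * pair a b
  invariance : ∀ {U : Opens X} (a b c : M.sec U),
    pair (br a b) c + pair b (br a c) = VF.app (anchor.app U a) (pair b c)
  -- For a Courant algebroid this is {a,b} + {b,a} = π†d⟨a,b⟩ paired with c. Stated without a
  -- co-anchor, it also holds for a Lie algebroid with zero pairing.
  pair_swap : ∀ {U : Opens X} (a b c : M.sec U),
    pair (br a b) c + pair (br b a) c = VF.app (anchor.app U c) (pair a b)

/-- A Lie algebroid, with the zero pairing. -/
def LieStr.toPaired [Fact (∞ ≤ n)] {A : OMod K X} (L : LieStr A) : PairedBracket A where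
  anchor := L.anchor
  br := L.br
  pair _ _ := 0
  res_br := L.res_br
  add_br := L.add_br
  br_add := L.br_add
  jacobi := L.jacobi
  anchor_br := L.anchor_br
  leibniz a b g := by rw [L.leibniz, add_comm]
  res_pair h _ _ := map_zero _
  pair_symm _ _ := rfl
  add_pair _ _ _ := (add_zero _).symm
  smul_pair _ _ _ := (mul_zero _).symm
  invariance a b c := by
    rw [app_zero_right, add_zero]
  pair_swap a b c := by
    rw [app_zero_right, add_zero]

lemma LieStr.br_swap {A : OMod K X} (L : LieStr A) {U : Opens X} (a b : A.sec U) :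
    L.br a b + L.br b a = 0 := by
  have h := L.br_self (a + b)
  rwa [L.add_br, L.br_add, L.br_add, L.br_self, L.br_self, zero_add, add_zero] at h

/-- The bracket, pairing and anchor of a Courant algebroid. -/
def CourantStr.toPaired {Q : OMod K X} (S : CourantStr Q) : PairedBracket Q where
  anchor := S.anchor
  br := S.br
  pair := S.pair
  res_br := S.res_br
  add_br := S.add_br
  br_add := S.br_add
  jacobi := S.jacobi
  anchor_br := S.anchor_br
  leibniz := S.leibniz
  res_pair := S.res_pair
  pair_symm := S.pair_symm
  add_pair := S.add_pair
  smul_pair := S.smul_pair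
  invariance := S.invariance
  pair_swap a b c := by
    rw [← S.add_pair, S.br_add_br_swap, S.pair_symm]
    exact S.pair_coanchor _ _

end Modules

namespace PairedBracket

variable {𝕜 : Type} [RCLike 𝕜] {n : WithTop ℕ∞} {K : Type} [RCLike K] [NormedAlgebra 𝕜 K]
variable {X Y : Mfd.{u} 𝕜 n} (f : Mfd.Hom Y X) {M : OMod K X} (D : PairedBracket M)

/-! ### Formal sums of sections -/

variable {V : Opens Y}

variable {f} in
lemma le_preim_inf {U U' : Opens X} (h : V ≤ f.preim U) (h' : V ≤ f.preim U') :
    V ≤ f.preim (U ⊓ U') := fun _ hy ↦ ⟨h hy, h' hy⟩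

/-- The bracket of two generators. -/
def gbr (q p : Gen f M V) : Gen f M V :=
  ⟨⟨q.1.1 ⊓ p.1.1, le_preim_inf q.1.2 p.1.2⟩,
    D.br (M.res inf_le_left q.2) (M.res inf_le_right p.2)⟩

/-- The pairing of two generators. -/
def gpair (q p : Gen f M V) : Y.O K V :=
  f.pullO K (U := q.1.1 ⊓ p.1.1) (le_preim_inf q.1.2 p.1.2)
    (D.pair (M.res inf_le_left q.2) (M.res inf_le_right p.2))

lemma pullO_res {U U' : Opens X} (h : V ≤ f.preim U) (k : U' ≤ U) (h' : V ≤ f.preim U')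
    (g : X.O K U) : f.pullO K h' (resO K k g) = f.pullO K h g := rfl

/-- Generators live over different opens of X. Here, and for the bracket in `gbr_res`, the
computation is moved to any common smaller open whose preimage still contains V, where the axioms of
M apply. -/
lemma gpair_eq {q p : Gen f M V} {W : Opens X} (hW : V ≤ f.preim W) (hq : W ≤ q.1.1)
    (hp : W ≤ p.1.1) : D.gpair f q p = f.pullO K hW (D.pair (M.res hq q.2) (M.res hp p.2)) := by
  rw [gpair, ← pullO_res f (le_preim_inf q.1.2 p.1.2) (le_inf hq hp) hW, D.res_pair, M.res_res, M.res_res]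

lemma gbr_res {q p : Gen f M V} {W : Opens X} (hq : W ≤ q.1.1) (hp : W ≤ p.1.1)
    (h : W ≤ (D.gbr f q p).1.1) : M.res h (D.gbr f q p).2 =
      D.br (M.res hq q.2) (M.res hp p.2) := by
  exact (D.res_br _ _ _).trans (congrArg₂ D.br (M.res_res _ _ _) (M.res_res _ _ _))

variable (M) in
/-- The section `1 ⊗ q` defined by a generator. -/
def gpt (q : Gen f M V) : PSec f M V := Pull.pure f M q.1.2 q.2

lemma gpt_eq {q : Gen f M V} {W : Opens X} (hW : V ≤ f.preim W) (hq : W ≤ q.1.1) :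
    gpt f M q = Pull.pure f M hW (M.res hq q.2) := (Pull.pure_res _ _ _ _).symm

lemma gpair_symm (q p : Gen f M V) : D.gpair f q p = D.gpair f p q := by
  have hW : V ≤ f.preim (q.1.1 ⊓ p.1.1) := le_preim_inf q.1.2 p.1.2
  rw [D.gpair_eq f hW inf_le_left inf_le_right, D.gpair_eq f hW inf_le_right inf_le_left,
    D.pair_symm]

/-- The terms are generators over differently nested intersections, so they are compared only in
f^*M, where each can be computed over the triple intersection. -/
lemma gpt_jacobi (q p r : Gen f M V) : gpt f M (D.gbr f q (D.gbr f p r)) =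
    gpt f M (D.gbr f (D.gbr f q p) r) + gpt f M (D.gbr f p (D.gbr f q r)) := by
  let W := q.1.1 ⊓ p.1.1 ⊓ r.1.1
  have hW : V ≤ f.preim W := le_preim_inf (le_preim_inf q.1.2 p.1.2) r.1.2
  have hq : W ≤ q.1.1 := inf_le_left.trans inf_le_left
  have hp : W ≤ p.1.1 := inf_le_left.trans inf_le_right
  have hr : W ≤ r.1.1 := inf_le_right
  have e : ∀ {q p r : Gen f M V} (hq : W ≤ q.1.1) (hp : W ≤ p.1.1) (hr : W ≤ r.1.1),
      gpt f M (D.gbr f q (D.gbr f p r)) =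
        Pull.pure f M hW (D.br (M.res hq q.2) (D.br (M.res hp p.2) (M.res hr r.2))) :=
    fun {q p r} hq hp hr ↦ by
      rw [gpt_eq f hW (show W ≤ (D.gbr f q (D.gbr f p r)).1.1 from le_inf hq (le_inf hp hr)),
        D.gbr_res f hq (show W ≤ (D.gbr f p r).1.1 from le_inf hp hr), D.gbr_res f hp hr]
  rw [e hq hp hr, e hp hq hr, gpt_eq f hW (show W ≤ (D.gbr f (D.gbr f q p) r).1.1 from le_inf (le_inf hq hp) hr),
    D.gbr_res f (show W ≤ (D.gbr f q p).1.1 from le_inf hq hp) hr, D.gbr_res f hq hp,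
    ← Pull.pure_add, D.jacobi]

lemma gpair_invariance {q p r : Gen f M V} {W : Opens X} (hW : V ≤ f.preim W) (hq : W ≤ q.1.1)
    (hp : W ≤ p.1.1) (hr : W ≤ r.1.1) :
    D.gpair f (D.gbr f q p) r + D.gpair f p (D.gbr f q r) = f.pullO K hW
      (VF.app (D.anchor.app W (M.res hq q.2)) (D.pair (M.res hp p.2) (M.res hr r.2))) := by
  rw [D.gpair_eq f hW (show W ≤ (D.gbr f q p).1.1 from le_inf hq hp) hr,
    D.gpair_eq f hW hp (show W ≤ (D.gbr f q r).1.1 from le_inf hq hr), D.gbr_res f hq hp,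
    D.gbr_res f hq hr, ← map_add, D.invariance]

/-- Both sides are the pull-back of the derivative of ⟨q,p⟩ along the anchor of r: the left one by
`pair_swap`, the right one by invariance. This supplies `hI` in `cls_br₃_jacobi`. -/
lemma gpair_swap (q p r : Gen f M V) :
    D.gpair f (D.gbr f q p) r + D.gpair f (D.gbr f p q) r =
      D.gpair f (D.gbr f r q) p + D.gpair f q (D.gbr f r p) := by
  let W := q.1.1 ⊓ p.1.1 ⊓ r.1.1
  have hW : V ≤ f.preim W := le_preim_inf (le_preim_inf q.1.2 p.1.2) r.1.2
  have hq : W ≤ q.1.1 := inf_le_left.trans inf_le_left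
  have hp : W ≤ p.1.1 := inf_le_left.trans inf_le_right
  have hr : W ≤ r.1.1 := inf_le_right
  rw [D.gpair_invariance f hW hr hq hp,
    D.gpair_eq f hW (show W ≤ (D.gbr f q p).1.1 from le_inf hq hp) hr,
    D.gpair_eq f hW (show W ≤ (D.gbr f p q).1.1 from le_inf hp hq) hr, D.gbr_res f hq hp,
    D.gbr_res f hp hq, ← map_add, D.pair_swap]

/-! ### Restriction of formal sums -/

variable (M) in
/-- Restriction of generators. -/
def gres {W : Opens Y} (k : W ≤ V) (q : Gen f M V) : Gen f M W := ⟨⟨q.1.1, k.trans q.1.2⟩, q.2⟩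

variable (M) in
/-- Restriction of formal sums. -/
def xres {W : Opens Y} (k : W ≤ V) : (Gen f M V →₀ Y.O K V) →+ (Gen f M W →₀ Y.O K W) :=
  (Finsupp.mapDomain.addMonoidHom (gres f M k)).comp
    (Finsupp.mapRange.addMonoidHom (resO K k).toAddMonoidHom)

@[simp] lemma xres_single {W : Opens Y} (k : W ≤ V) (q : Gen f M V) (g : Y.O K V) :
    xres f M k (Finsupp.single q g) = Finsupp.single (gres f M k q) (resO K k g) := by
  simp [xres]

lemma mk_single (q : Gen f M V) (g : Y.O K V) :
    (Submodule.Quotient.mk (Finsupp.single q g) : PSec f M V) = g • gpt f M q := by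
  rw [gpt, Pull.pure, ← Submodule.Quotient.mk_smul, Finsupp.smul_single, smul_eq_mul, mul_one]

lemma mk_eq_linearCombination (x : Gen f M V →₀ Y.O K V) :
    (Submodule.Quotient.mk x : PSec f M V) = Finsupp.linearCombination (Y.O K V) (gpt f M) x := by
  induction x using Finsupp.induction_linear with
  | zero => simp
  | add x y hx hy => rw [Submodule.Quotient.mk_add, map_add, hx, hy]
  | single q g => rw [mk_single, Finsupp.linearCombination_single]

lemma mk_xres {W : Opens Y} (k : W ≤ V) (x : Gen f M V →₀ Y.O K V) :
    (Submodule.Quotient.mk (xres f M k x) : PSec f M W) =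
      Pull.res f M k (Submodule.Quotient.mk x) := by
  induction x using Finsupp.induction_linear with
  | zero => simp
  | add x y hx hy => rw [Submodule.Quotient.mk_add, map_add, map_add, Submodule.Quotient.mk_add,
      hx, hy]
  | single q g =>
    rw [xres_single, mk_single, mk_single, map_smulₛₗ, gpt, gpt, Pull.res_pure]
    rfl

open CartanCalculus

lemma xres_brTerm {W : Opens Y} (k : W ≤ V) (x y : Gen f M V →₀ Y.O K V) :
    xres f M k (brTerm (D.gbr f) x y) = brTerm (D.gbr f) (xres f M k x) (xres f M k y) := by
  have : (AddMonoidHom.compHom (xres f M k)).comp (brTerm (D.gbr f)) =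
      (((brTerm (D.gbr f)).comp (xres f M k)).flip.comp (xres f M k)).flip :=
    bilift_ext fun q p g h ↦ by simp [-Finsupp.single_mul]; rfl
  exact DFunLike.congr_fun (DFunLike.congr_fun this x) y

variable [Fact (∞ ≤ n)]

lemma res_formTerm {W : Opens Y} (k : W ≤ V) (x y : Gen f M V →₀ Y.O K V) :
    (formSheaf K Y).res k ((cartan K Y V).formTerm (D.gpair f) x y) =
      (cartan K Y W).formTerm (D.gpair f) (xres f M k x) (xres f M k y) := by
  have : (AddMonoidHom.compHom ((formSheaf K Y).res k).toAddMonoidHom).comp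
      ((cartan K Y V).formTerm (D.gpair f)) =
      ((((cartan K Y W).formTerm (D.gpair f)).comp (xres f M k)).flip.comp (xres f M k)).flip :=
    bilift_ext fun q p g h ↦ by
      simp only [AddMonoidHom.comp_apply, AddMonoidHom.flip_apply, AddMonoidHom.compHom_apply_apply,
        xres_single, formTerm_single]
      refine (PreMod.res_smul (formSheaf K Y).toPreMod k _ _).trans ?_
      rw [map_mul]
      exact congrArg _ (res_dHom k g)
  exact DFunLike.congr_fun (DFunLike.congr_fun this x) y

lemma xres_act {W : Opens Y} (k : W ≤ V) (ξ : (tangentSheaf K Y).sec V)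
    (x : Gen f M V →₀ Y.O K V) : xres f M k ((cartan K Y V).act ξ x) =
      (cartan K Y W).act ((tangentSheaf K Y).res k ξ) (xres f M k x) := by
  induction x using Finsupp.induction_linear with
  | zero => simp
  | add x y hx hy => simp only [map_add, hx, hy]
  | single q g =>
    rw [act_single, xres_single, xres_single, act_single]
    exact congrArg _ (resO_app k ξ g)

/-- Triples `(α, ∑ g_i ⊗ q_i, ξ)`. -/
abbrev Triple (f : Mfd.Hom Y X) (M : OMod K X) (V : Opens Y) : Type u :=
  (formSheaf K Y).sec V × (Gen f M V →₀ Y.O K V) × (tangentSheaf K Y).sec V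

variable (M) in
/-- Restriction of triples. -/
def tres {W : Opens Y} (k : W ≤ V) (u : Triple f M V) : Triple f M W :=
  ((formSheaf K Y).res k u.1, xres f M k u.2.1, (tangentSheaf K Y).res k u.2.2)

/-- The bracket of triples. -/
def tbr (u v : Triple f M V) : Triple f M V := (cartan K Y V).br₃ (D.gbr f) (D.gpair f) u v

/-- The pairing of triples. -/
def tpr (u v : Triple f M V) : Y.O K V := (cartan K Y V).pr₃ (D.gpair f) u v

lemma tres_tbr {W : Opens Y} (k : W ≤ V) (u v : Triple f M V) :
    tres f M k (D.tbr f u v) = D.tbr f (tres f M k u) (tres f M k v) := by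
  refine Prod.ext ?_ (Prod.ext ?_ ?_)
  · simp only [tres, tbr, br₃, map_add, map_neg, res_formTerm]
    congr 2
    · exact congrArg _ (res_ctrD k _ _)
    · exact res_lieD k _ _
  · simp only [tres, tbr, br₃, map_add, map_sub, xres_brTerm, xres_act]
  · exact res_lieB k _ _

lemma resO_tpr {W : Opens Y} (k : W ≤ V) (u v : Triple f M V) :
    resO K k (D.tpr f u v) = D.tpr f (tres f M k u) (tres f M k v) := by
  have : (AddMonoidHom.compHom (resO K k).toAddMonoidHom).comp (pairTerm (D.gpair f)) =
      (((pairTerm (D.gpair f)).comp (xres f M k)).flip.comp (xres f M k)).flip :=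
    bilift_ext fun q p g h ↦ by
      simp only [AddMonoidHom.comp_apply, AddMonoidHom.flip_apply, AddMonoidHom.compHom_apply_apply,
        xres_single, pairTerm_single]
      change resO K k (_ * _ * _) = _
      rw [map_mul, map_mul]
      rfl
  have e := DFunLike.congr_fun (DFunLike.congr_fun this u.2.1) v.2.1
  rw [tpr, pr₃, map_add, map_add]
  exact congrArg₂ (· + ·) rfl e

end PairedBracket

/-! ### Descent of operations from a presheaf to a sheaf it generates locally -/

section Presentations

variable {𝕜 : Type} [RCLike 𝕜] {n : WithTop ℕ∞} {K : Type} [RCLike K] [NormedAlgebra 𝕜 K]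
variable {Y : Mfd.{u} 𝕜 n}

/-- The structure sheaf as a sheaf of modules over itself. -/
def structureSheaf (K : Type) [RCLike K] [NormedAlgebra 𝕜 K] (Y : Mfd.{u} 𝕜 n) : OMod K Y where
  sec U := Y.O K U
  res {U V} h :=
    { toFun := resO K h
      map_add' := map_add _
      map_smul' := fun g s ↦ map_mul (resO K h) g s }
  res_refl _ := rfl
  res_res _ _ _ := rfl
  sep s t hst := O_ext fun x ↦ by
    obtain ⟨V, h, hx, e⟩ := hst x x.2
    exact congrFun (congrArg Subtype.val e) ⟨x, hx⟩
  glue {ι} V s hs := by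
    have hmem : ∀ x : (⨆ i, V i : Opens Y), ∃ i, (x : Y) ∈ V i := fun x ↦
      Opens.mem_iSup.1 x.2
    choose i hi using hmem
    have key : ∀ (j : ι) (x : (⨆ i, V i : Opens Y)) (hx : (x : Y) ∈ V j),
        (s (i x)).1 ⟨x, hi x⟩ = (s j).1 ⟨x, hx⟩ := fun j x hx ↦
      congrFun (congrArg Subtype.val (hs (i x) j)) ⟨x, hi x, hx⟩
    refine ⟨⟨fun x ↦ (s (i x)).1 ⟨x, hi x⟩, O_local K _ fun x ↦ ?_⟩, fun j ↦ ?_⟩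
    · refine ⟨V (i x), le_iSup V (i x), hi x, ?_⟩
      convert (s (i x)).2 using 1
      funext z
      exact key _ ⟨z, _⟩ z.2
    · exact O_ext fun x ↦ key j ⟨x, le_iSup V j x.2⟩ x.2

/-- A locally surjective morphism from a presheaf to a sheaf. -/
structure PreMod.Pres (P : PreMod K Y) (M : OMod K Y) where
  app : ∀ V : Opens Y, P.sec V →ₗ[Y.O K V] M.sec V
  naturality : ∀ {V W : Opens Y} (k : W ≤ V) (u : P.sec V), app W (P.res k u) = M.res k (app V u)
  surj : ∀ {V : Opens Y} (t : M.sec V), ∀ y ∈ V, ∃ (W : Opens Y) (h : W ≤ V) (u : P.sec W),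
    y ∈ W ∧ app W u = M.res h t

namespace PreMod

lemma toSheaf_add (P : PreMod K Y) {V : Opens Y} (s t : P.sec V) :
    P.toSheaf (s + t) = P.toSheaf s + P.toSheaf t :=
  Subtype.ext (funext fun y ↦ P.germ_add y.2 s t)

lemma toSheaf_smul (P : PreMod K Y) {V : Opens Y} (g : Y.O K V) (s : P.sec V) :
    P.toSheaf (g • s) = g • P.toSheaf s :=
  Subtype.ext (funext fun y ↦ (P.smulGerm_germ g le_rfl y.2 s).symm)

lemma toSheaf_res (P : PreMod K Y) {V W : Opens Y} (k : W ≤ V) (s : P.sec V) :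
    P.toSheaf (P.res k s) = P.sheafify.res k (P.toSheaf s) :=
  Subtype.ext (funext fun y ↦ P.germ_res k y.2 s)

lemma exists_toSheaf (P : PreMod K Y) {V : Opens Y} (t : P.sheafify.sec V) {y : Y} (hy : y ∈ V) :
    ∃ (W : Opens Y) (h : W ≤ V) (s : P.sec W), y ∈ W ∧ P.toSheaf s = P.sheafify.res h t := by
  obtain ⟨W, h, hyW, s, hs⟩ := Subtype.property (p := (· ∈ P.shSec V)) t ⟨y, hy⟩
  exact ⟨W, h, s, hyW, Subtype.ext (funext fun z ↦ (hs z).symm)⟩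

lemma exists_res_eq_of_toSheaf_eq (P : PreMod K Y) {V : Opens Y} {s t : P.sec V}
    (e : P.toSheaf s = P.toSheaf t) {y : Y} (hy : y ∈ V) :
    ∃ (W : Opens Y) (h : W ≤ V), y ∈ W ∧ P.res h s = P.res h t := by
  have e' : P.germ hy s = P.germ hy t := congrFun (congrArg Subtype.val e) ⟨y, hy⟩
  obtain ⟨W, h, h', e'⟩ := Quotient.exact e'
  exact ⟨W.U, h, W.mem, e'⟩

/-- The presentation of an associated sheaf defined by a surjection of presheaves. -/
def presOfSurjective {P P' : PreMod K Y} (φ : ∀ V : Opens Y, P.sec V →ₗ[Y.O K V] P'.sec V)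
    (nat : ∀ {V W : Opens Y} (k : W ≤ V) (u : P.sec V), φ W (P.res k u) = P'.res k (φ V u))
    (hφ : ∀ V, Function.Surjective (φ V)) : P.Pres P'.sheafify where
  app V :=
    { toFun := fun u ↦ P'.toSheaf (φ V u)
      map_add' := fun u v ↦ by rw [map_add, toSheaf_add]
      map_smul' := fun g u ↦ by rw [map_smul, toSheaf_smul]; rfl }
  naturality k u := (congrArg P'.toSheaf (nat k u)).trans (P'.toSheaf_res k _)
  surj t y hy := by
    obtain ⟨W, h, s, hyW, e⟩ := P'.exists_toSheaf t hy
    obtain ⟨u, rfl⟩ := hφ W s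
    exact ⟨W, h, u, hyW, e⟩

namespace Pres

variable {P : PreMod K Y} {M : OMod K Y} (θ : P.Pres M)

lemma cover₂ {V : Opens Y} (t s : M.sec V) {y : Y} (hy : y ∈ V) :
    ∃ (W : Opens Y) (h : W ≤ V) (u v : P.sec W), y ∈ W ∧ θ.app W u = M.res h t ∧
      θ.app W v = M.res h s := by
  obtain ⟨W, h, u, hyW, hu⟩ := θ.surj t y hy
  obtain ⟨W', h', v, hyW', hv⟩ := θ.surj s y hy
  refine ⟨W ⊓ W', inf_le_left.trans h, P.res inf_le_left u, P.res inf_le_right v, ⟨hyW, hyW'⟩,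
    ?_, ?_⟩
  · rw [θ.naturality, hu, M.res_res]
  · rw [θ.naturality, hv, M.res_res]

lemma cover₃ {V : Opens Y} (t s r : M.sec V) {y : Y} (hy : y ∈ V) :
    ∃ (W : Opens Y) (h : W ≤ V) (u v w : P.sec W), y ∈ W ∧ θ.app W u = M.res h t ∧
      θ.app W v = M.res h s ∧ θ.app W w = M.res h r := by
  obtain ⟨W, h, u, v, hyW, hu, hv⟩ := θ.cover₂ t s hy
  obtain ⟨W', h', w, hyW', hw⟩ := θ.surj r y hy
  refine ⟨W ⊓ W', inf_le_left.trans h, P.res inf_le_left u, P.res inf_le_left v,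
    P.res inf_le_right w, ⟨hyW, hyW'⟩, ?_, ?_, ?_⟩
  · rw [θ.naturality, hu, M.res_res]
  · rw [θ.naturality, hv, M.res_res]
  · rw [θ.naturality, hw, M.res_res]

/-- Morphisms out of a sheaf are determined on a presentation. -/
lemma hom_ext {M' : OMod K Y} {φ ψ : OMod.Hom M M'}
    (h : ∀ (V : Opens Y) (u : P.sec V), φ.app V (θ.app V u) = ψ.app V (θ.app V u)) : φ = ψ := by
  refine OMod.Hom.ext (funext fun V ↦ LinearMap.ext fun t ↦ M'.sep _ _ fun y hy ↦ ?_)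
  obtain ⟨W, k, u, hyW, hu⟩ := θ.surj t y hy
  exact ⟨W, k, hyW, by rw [← φ.naturality, ← ψ.naturality, ← hu, h]⟩

/-- Biadditive operations descend along presentations. -/
lemma exists_op {M' : OMod K Y} (F : ∀ V : Opens Y, P.sec V →+ P.sec V →+ M'.sec V)
    (nat : ∀ {V W : Opens Y} (k : W ≤ V) (u v : P.sec V),
      M'.res k (F V u v) = F W (P.res k u) (P.res k v))
    (hl : ∀ {V : Opens Y} (u v : P.sec V), θ.app V u = 0 → F V u v = 0)
    (hr : ∀ {V : Opens Y} (u v : P.sec V), θ.app V v = 0 → F V u v = 0) :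
    ∃ op : ∀ {V : Opens Y}, M.sec V → M.sec V → M'.sec V,
      (∀ {V : Opens Y} (u v : P.sec V), op (θ.app V u) (θ.app V v) = F V u v) ∧
      ∀ {V W : Opens Y} (k : W ≤ V) (t s : M.sec V),
        M'.res k (op t s) = op (M.res k t) (M.res k s) := by
  have wd : ∀ {V : Opens Y} (u v u' v' : P.sec V), θ.app V u = θ.app V u' →
      θ.app V v = θ.app V v' → F V u v = F V u' v' := fun {V} u v u' v' hu hv ↦ by
    have h1 := hl (u - u') v (by rw [map_sub, hu, sub_self])
    have h2 := hr u' (v - v') (by rw [map_sub, hv, sub_self])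
    rw [map_sub, AddMonoidHom.sub_apply, sub_eq_zero] at h1
    rw [map_sub, sub_eq_zero] at h2
    exact h1.trans h2
  -- The value on t and s is prescribed wherever both lift to `P`. By `wd` it does not depend on the
  -- lifts, so the local values agree on overlaps and glue.
  have key : ∀ {V : Opens Y} (t s : M.sec V), ∃ r : M'.sec V, ∀ {W : Opens Y} (h : W ≤ V)
      (u v : P.sec W), θ.app W u = M.res h t → θ.app W v = M.res h s →
        M'.res h r = F W u v := fun {V} t s ↦ by
    obtain ⟨r, hr⟩ := M'.exists_of_local (U := V) (fun {W} h r ↦ ∃ u v : P.sec W,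
        θ.app W u = M.res h t ∧ θ.app W v = M.res h s ∧ r = F W u v)
      (fun h k r ↦ by
        rintro ⟨u, v, hu, hv, rfl⟩
        exact ⟨P.res k u, P.res k v, by rw [θ.naturality, hu, M.res_res],
          by rw [θ.naturality, hv, M.res_res], nat k u v⟩)
      (fun h r r' ↦ by
        rintro ⟨u, v, hu, hv, rfl⟩ ⟨u', v', hu', hv', rfl⟩
        exact wd _ _ _ _ (hu.trans hu'.symm) (hv.trans hv'.symm))
      (fun y hy ↦ by
        obtain ⟨W, h, u, v, hyW, hu, hv⟩ := θ.cover₂ t s hy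
        exact ⟨W, h, _, hyW, u, v, hu, hv, rfl⟩)
    exact ⟨r, fun h u v hu hv ↦ hr h _ ⟨u, v, hu, hv, rfl⟩⟩
  choose op hop using @key
  refine ⟨@op, fun {V} u v ↦ ?_, fun {V W} k t s ↦ M'.sep _ _ fun y hy ↦ ?_⟩
  · rw [← hop (θ.app V u) (θ.app V v) le_rfl u v (M.res_refl _).symm (M.res_refl _).symm,
      M'.res_refl]
  · obtain ⟨W', h, u, v, hyW, hu, hv⟩ := θ.cover₂ (M.res k t) (M.res k s) hy
    refine ⟨W', h, hyW, ?_⟩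
    rw [hop _ _ h u v hu hv, M'.res_res]
    exact hop t s _ u v (hu.trans (M.res_res _ _ _)) (hv.trans (M.res_res _ _ _))

/-- Linear maps descend along presentations. -/
lemma exists_hom {M' : OMod K Y} (F : ∀ V : Opens Y, P.sec V →ₗ[Y.O K V] M'.sec V)
    (nat : ∀ {V W : Opens Y} (k : W ≤ V) (u : P.sec V), M'.res k (F V u) = F W (P.res k u))
    (hF : ∀ {V : Opens Y} (u : P.sec V), θ.app V u = 0 → F V u = 0) :
    ∃ φ : OMod.Hom M M', ∀ (V : Opens Y) (u : P.sec V), φ.app V (θ.app V u) = F V u := by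
  have wd : ∀ {V : Opens Y} (u u' : P.sec V), θ.app V u = θ.app V u' → F V u = F V u' :=
    fun {V} u u' hu ↦ sub_eq_zero.1 ((map_sub _ _ _).symm.trans
      (hF (u - u') (by rw [map_sub, hu, sub_self])))
  have key : ∀ {V : Opens Y} (t : M.sec V), ∃ r : M'.sec V, ∀ {W : Opens Y} (h : W ≤ V)
      (u : P.sec W), θ.app W u = M.res h t → M'.res h r = F W u := fun {V} t ↦ by
    obtain ⟨r, hr⟩ := M'.exists_of_local (U := V) (fun {W} h r ↦ ∃ u : P.sec W,
        θ.app W u = M.res h t ∧ r = F W u)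
      (fun h k r ↦ by
        rintro ⟨u, hu, rfl⟩
        exact ⟨P.res k u, by rw [θ.naturality, hu, M.res_res], nat k u⟩)
      (fun h r r' ↦ by
        rintro ⟨u, hu, rfl⟩ ⟨u', hu', rfl⟩
        exact wd _ _ (hu.trans hu'.symm))
      (fun y hy ↦ by
        obtain ⟨W, h, u, hyW, hu⟩ := θ.surj t y hy
        exact ⟨W, h, _, hyW, u, hu, rfl⟩)
    exact ⟨r, fun h u hu ↦ hr h _ ⟨u, hu, rfl⟩⟩
  choose φ hφ using @key
  refine ⟨⟨fun V ↦
    { toFun := φ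
      map_add' := fun t s ↦ M'.sep _ _ fun y hy ↦ ?_
      map_smul' := fun g t ↦ M'.sep _ _ fun y hy ↦ ?_ },
    fun {V W} k t ↦ M'.sep _ _ fun y hy ↦ ?_⟩, fun V u ↦ ?_⟩
  · obtain ⟨W, h, u, v, hyW, hu, hv⟩ := θ.cover₂ t s hy
    refine ⟨W, h, hyW, ?_⟩
    rw [map_add, hφ t h u hu, hφ s h v hv, hφ (t + s) h (u + v) (by rw [map_add, map_add, hu, hv]),
      map_add]
  · obtain ⟨W, h, u, hyW, hu⟩ := θ.surj t y hy
    refine ⟨W, h, hyW, ?_⟩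
    rw [RingHom.id_apply, PreMod.res_smul, hφ t h u hu,
      hφ (g • t) h (resO K h g • u) (by rw [map_smul, PreMod.res_smul, hu]), map_smul]
  · obtain ⟨W', h, u, hyW, hu⟩ := θ.surj (M.res k t) y hy
    refine ⟨W', h, hyW, ?_⟩
    change M'.res h (φ _) = M'.res h (M'.res k (φ t))
    rw [hφ _ h u hu, M'.res_res]
    exact (hφ t _ u (hu.trans (M.res_res _ _ _))).symm
  · refine (M'.res_refl _).symm.trans (hφ _ le_rfl u (M.res_refl _).symm)

end Pres

end PreMod

end Presentations

namespace PairedBracket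

variable {𝕜 : Type} [RCLike 𝕜] {n : WithTop ℕ∞} {K : Type} [RCLike K] [NormedAlgebra 𝕜 K]
variable {X Y : Mfd.{u} 𝕜 n} (f : Mfd.Hom Y X) {M : OMod K X} (D : PairedBracket M)
variable {V : Opens Y}

open CartanCalculus

/-! ### The fibre product condition -/

lemma xres_smul {W : Opens Y} (k : W ≤ V) (g : Y.O K V) (x : Gen f M V →₀ Y.O K V) :
    xres f M k (g • x) = resO K k g • xres f M k x := by
  induction x using Finsupp.induction_linear with
  | zero => simp
  | add x y hx hy => rw [smul_add, map_add, map_add, hx, hy, smul_add]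
  | single q h =>
    rw [Finsupp.smul_single, xres_single, xres_single, Finsupp.smul_single, smul_eq_mul, map_mul,
      smul_eq_mul]

variable (M V) in
/-- The pair `(∑ g_i ⊗ q_i, ξ)` defined by a triple. -/
def toPair : Triple f M V →ₗ[Y.O K V] PSec f M V × (tangentSheaf K Y).sec V :=
  ((Submodule.mkQ _).comp ((LinearMap.fst _ _ _).comp (LinearMap.snd _ _ _))).prod
    ((LinearMap.snd _ _ _).comp (LinearMap.snd _ _ _))

lemma toPair_apply (u : Triple f M V) : toPair f M V u = (Submodule.Quotient.mk u.2.1, u.2.2) := rfl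

/-- The triples `(α, ∑ g_i ⊗ q_i, ξ)` such that `(∑ g_i ⊗ q_i, ξ)` is in the fibre product. -/
def raw (σ : OMod.Hom M (tangentSheaf K X)) (V : Opens Y) : Submodule (Y.O K V) (Triple f M V) :=
  (plusSub f σ V).comap (toPair f M V)

lemma mem_raw {σ : OMod.Hom M (tangentSheaf K X)} {u : Triple f M V} : u ∈ raw f σ V ↔
    ∀ y : V, anchorAt σ y (Submodule.Quotient.mk u.2.1) = f.push K y (u.2.2.1 y) := Iff.rfl

lemma tres_mem_raw {σ : OMod.Hom M (tangentSheaf K X)} {u : Triple f M V} (hu : u ∈ raw f σ V)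
    {W : Opens Y} (k : W ≤ V) : tres f M k u ∈ raw f σ W := fun y ↦ by
  refine (congrArg (anchorAt σ y) (mk_xres f k u.2.1)).trans ?_
  exact (Pull.anchorAt_res f σ k y _).trans (hu ⟨y, k y.2⟩)

/-- The presheaf of triples which satisfy the fibre product condition. -/
def rawMod (σ : OMod.Hom M (tangentSheaf K X)) : PreMod K Y where
  sec V := raw f σ V
  group V := Submodule.addCommGroup _
  module V := Submodule.module _
  res {V W} k :=
    { toFun := fun u ↦ ⟨tres f M k u.1, tres_mem_raw f u.2 k⟩
      map_add' := fun u v ↦ Subtype.ext (Prod.ext (map_add _ _ _)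
        (Prod.ext (map_add _ _ _) (map_add _ _ _)))
      map_smul' := fun g u ↦ Subtype.ext (Prod.ext (PreMod.res_smul _ _ _ _)
        (Prod.ext (xres_smul f k g _) (PreMod.res_smul _ _ _ _))) }
  res_refl u := Subtype.ext (Prod.ext (PreMod.res_refl _ _) (Prod.ext (by
    change xres f M le_rfl u.1.2.1 = u.1.2.1
    induction u.1.2.1 using Finsupp.induction_linear with
    | zero => simp
    | add x y hx hy => rw [map_add, hx, hy]
    | single q g => rw [xres_single]; rfl) (PreMod.res_refl _ _)))
  res_res h k u := Subtype.ext (Prod.ext (PreMod.res_res _ _ _ _) (Prod.ext (by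
    change xres f M k (xres f M h u.1.2.1) = xres f M (k.trans h) u.1.2.1
    induction u.1.2.1 using Finsupp.induction_linear with
    | zero => simp
    | add x y hx hy => simp only [map_add, hx, hy]
    | single q g => rw [xres_single, xres_single, xres_single]; rfl) (PreMod.res_res _ _ _ _)))

variable [Fact (∞ ≤ n)]

/-- The inverse image of the function `σ(q)(g)`. -/
def gdir (σ : OMod.Hom M (tangentSheaf K X)) {U : Opens X} (hU : V ≤ f.preim U) (g : X.O K U)
    (q : Gen f M V) : Y.O K V :=
  f.pullO K (U := q.1.1 ⊓ U) (le_preim_inf q.1.2 hU)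
    (VF.app (σ.app _ (M.res inf_le_left q.2)) (resO K inf_le_right g))

lemma gdir_eq (σ : OMod.Hom M (tangentSheaf K X)) {U : Opens X} (hU : V ≤ f.preim U) (g : X.O K U)
    (q : Gen f M V) {W : Opens X} (hW : V ≤ f.preim W) (hq : W ≤ q.1.1) (hWU : W ≤ U) :
    gdir f σ hU g q = f.pullO K hW (VF.app (σ.app _ (M.res hq q.2)) (resO K hWU g)) := by
  rw [gdir, ← pullO_res f (le_preim_inf q.1.2 hU) (le_inf hq hWU) hW, resO_app, ← σ.naturality,
    M.res_res]
  rfl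

/-- The inverse image of the function `∑ g_i σ(q_i)(g)`. -/
def dir (σ : OMod.Hom M (tangentSheaf K X)) {U : Opens X} (hU : V ≤ f.preim U) (g : X.O K U) :
    (Gen f M V →₀ Y.O K V) →ₗ[Y.O K V] Y.O K V := Finsupp.linearCombination _ (gdir f σ hU g)

@[simp] lemma dir_single (σ : OMod.Hom M (tangentSheaf K X)) {U : Opens X} (hU : V ≤ f.preim U)
    (g : X.O K U) (q : Gen f M V) (a : Y.O K V) :
    dir f σ hU g (Finsupp.single q a) = a * gdir f σ hU g q :=
  Finsupp.linearCombination_single _ _ _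

lemma dir_apply (σ : OMod.Hom M (tangentSheaf K X)) {U : Opens X} (hU : V ≤ f.preim U)
    (g : X.O K U) (x : Gen f M V →₀ Y.O K V) (y : V) :
    (dir f σ hU g x).1 y = dAt g.1 (f y) (anchorAt σ y (Submodule.Quotient.mk x)) := by
  induction x using Finsupp.induction_linear with
  | zero => rw [map_zero, Submodule.Quotient.mk_zero, map_zero, map_zero]; rfl
  | add x z hx hz =>
    rw [map_add, Submodule.Quotient.mk_add, map_add, map_add, ← hx, ← hz]; rfl
  | single q a =>
    rw [dir_single, mk_single, map_smulₛₗ, map_smul, gpt, anchorAt_pure]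
    refine congrArg (a.1 y * ·) ?_
    rw [gdir]
    have e := dAt_res K (inf_le_right : q.1.1 ⊓ U ≤ U) g
      (show f y ∈ q.1.1 ⊓ U from ⟨q.1.2 y.2, hU y.2⟩)
    refine (congrArg (fun L : Module.Dual K (X.Tan K (f y)) ↦ L _) e).trans ?_
    rw [σ.naturality]
    rfl

/-- By the chain rule ξ(f^*g) is dg evaluated on df(ξ), and in the fibre product df(ξ) is the anchor
of ∑ g_i ⊗ q_i. The condition is mostly used in this form. -/
lemma app_pullO_of_mem_raw {σ : OMod.Hom M (tangentSheaf K X)} {u : Triple f M V}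
    (hu : u ∈ raw f σ V) {U : Opens X} (hU : V ≤ f.preim U) (g : X.O K U) :
    VF.app u.2.2 (f.pullO K hU g) = dir f σ hU g u.2.1 := O_ext fun y ↦ by
  rw [dir_apply, app_apply, dAt_pullO f hU g y.2]
  exact congrArg _ ((mem_raw f).1 hu y).symm

/-- The converse of `app_pullO_of_mem_raw`: local functions on X separate tangent vectors at f(y),
so the fibre product condition can be tested on pulled-back functions. -/
lemma mem_raw_of_dir {σ : OMod.Hom M (tangentSheaf K X)} {u : Triple f M V}
    (h : ∀ {W : Opens Y} (k : W ≤ V) {U : Opens X} (hU : W ≤ f.preim U) (g : X.O K U),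
      VF.app ((tangentSheaf K Y).res k u.2.2) (f.pullO K hU g) =
        dir f σ hU g (xres f M k u.2.1)) : u ∈ raw f σ V := fun y ↦
  tan_ext (V := ⊤) trivial fun U _ hy g ↦ by
    have hU : V ⊓ f.preim U ≤ f.preim U := inf_le_right
    have hyW : (y : Y) ∈ V ⊓ f.preim U := ⟨y.2, hy⟩
    have e := congrFun (congrArg Subtype.val (h inf_le_left hU g)) ⟨y, hyW⟩
    rw [dir_apply, mk_xres, Pull.anchorAt_res] at e
    rw [← dAt_pullO f hU g hyW]
    exact e.symm

/-- The anchor of a bracket is the commutator of the anchors. The inner derivative is kept as a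
function on X, so that the outer one is again of the form `dir` and can be rewritten by the fibre
product condition. -/
lemma dir_brTerm {U : Opens X} (hU : V ≤ f.preim U) (g : X.O K U) (x z : Gen f M V →₀ Y.O K V) :
    dir f D.anchor hU g (brTerm (D.gbr f) x z) =
      z.sum (fun p b ↦ b * dir f D.anchor (U := p.1.1 ⊓ U) (le_preim_inf p.1.2 hU)
        (VF.app (D.anchor.app _ (M.res inf_le_left p.2)) (resO K inf_le_right g)) x) -
      x.sum (fun p b ↦ b * dir f D.anchor (U := p.1.1 ⊓ U) (le_preim_inf p.1.2 hU)
        (VF.app (D.anchor.app _ (M.res inf_le_left p.2)) (resO K inf_le_right g)) z) := by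
  induction x using Finsupp.induction_linear with
  | zero => simp
  | add x x' hx hx' =>
    rw [map_add, AddMonoidHom.add_apply, map_add, hx, hx',
      Finsupp.sum_add_index' (by simp) (fun _ _ _ ↦ by ring)]
    simp only [map_add, mul_add, Finsupp.sum_add]
    ring
  | single q a =>
  induction z using Finsupp.induction_linear with
  | zero => simp
  | add x x' hx hx' =>
    rw [map_add, map_add, hx, hx', Finsupp.sum_add_index' (by simp) (fun _ _ _ ↦ by ring),
      Finsupp.sum_single_index (by simp), Finsupp.sum_single_index (by simp),
      Finsupp.sum_single_index (by simp), map_add]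
    ring
  | single p b =>
    rw [brTerm_single, dir_single, Finsupp.sum_single_index (by simp),
      Finsupp.sum_single_index (by simp), dir_single, dir_single]
    let W := q.1.1 ⊓ p.1.1 ⊓ U
    have hW : V ≤ f.preim W := le_preim_inf (le_preim_inf q.1.2 p.1.2) hU
    have hq : W ≤ q.1.1 := inf_le_left.trans inf_le_left
    have hp : W ≤ p.1.1 := inf_le_left.trans inf_le_right
    have hWU : W ≤ U := inf_le_right
    rw [gdir_eq f _ hU g _ hW (show W ≤ (D.gbr f q p).1.1 from le_inf hq hp) hWU,
      gdir_eq f _ _ _ q hW hq (le_inf hp hWU), gdir_eq f _ _ _ p hW hp (le_inf hq hWU),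
      D.gbr_res f hq hp, resO_app, resO_app, ← D.anchor.naturality, ← D.anchor.naturality,
      M.res_res, M.res_res]
    refine (congrArg (fun z ↦ a * b * f.pullO K hW z)
      (D.anchor_br (M.res hq q.2) (M.res hp p.2) W le_rfl (resO K hWU g))).trans ?_
    rw [map_sub, mul_sub]
    refine congrArg₂ (· - ·) ?_ ?_
    · rw [mul_comm a b, mul_assoc]; rfl
    · rw [mul_assoc]; rfl

lemma app_dir (ξ : (tangentSheaf K Y).sec V) {U : Opens X} (hU : V ≤ f.preim U) (g : X.O K U)
    (x : Gen f M V →₀ Y.O K V) : VF.app ξ (dir f D.anchor hU g x) =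
      dir f D.anchor hU g ((cartan K Y V).act ξ x) +
        x.sum fun p b ↦ b * VF.app ξ (gdir f D.anchor hU g p) := by
  induction x using Finsupp.induction_linear with
  | zero => simp [app_zero_right]
  | add x x' hx hx' =>
    rw [map_add, app_add, hx, hx', map_add, map_add,
      Finsupp.sum_add_index' (by simp) (fun _ _ _ ↦ by ring)]
    ring
  | single q a =>
    rw [dir_single, Mfd.app_mul, act_single, dir_single, Finsupp.sum_single_index (by simp)]
    rfl

/-- Test on a pulled-back function: expanding [ξ,η](f^*g) with the condition for both triples gives
the anchors of the differentiated coefficients together with the two sums of `dir_brTerm`. -/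
lemma tbr_mem_raw {u v : Triple f M V} (hu : u ∈ raw f D.anchor V) (hv : v ∈ raw f D.anchor V) :
    D.tbr f u v ∈ raw f D.anchor V := mem_raw_of_dir f fun {W} k {U} hU g ↦ by
  have key : ∀ {u v : Triple f M W}, u ∈ raw f D.anchor W → v ∈ raw f D.anchor W →
      VF.app (D.tbr f u v).2.2 (f.pullO K hU g) = dir f D.anchor hU g (D.tbr f u v).2.1 :=
    fun {u v} hu hv ↦ by
      change VF.app (lieB u.2.2 v.2.2) _ = dir f D.anchor hU g (brTerm (D.gbr f) u.2.1 v.2.1 +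
        (cartan K Y W).act u.2.2 v.2.1 - (cartan K Y W).act v.2.2 u.2.1)
      rw [app_lieB, app_pullO_of_mem_raw f hu, app_pullO_of_mem_raw f hv, D.app_dir, D.app_dir,
        map_sub, map_add, dir_brTerm]
      -- The inner anchor derivatives are functions on X, so the condition applies to them a second
      -- time and turns the outer sums into derivatives along ξ and η.
      simp only [← app_pullO_of_mem_raw f hu, ← app_pullO_of_mem_raw f hv]
      change _ + v.2.1.sum (fun p b ↦ b * VF.app u.2.2 (gdir f D.anchor hU g p)) -
        (_ + u.2.1.sum (fun p b ↦ b * VF.app v.2.2 (gdir f D.anchor hU g p))) = 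
        v.2.1.sum (fun p b ↦ b * VF.app u.2.2 (gdir f D.anchor hU g p)) -
         u.2.1.sum (fun p b ↦ b * VF.app v.2.2 (gdir f D.anchor hU g p)) + _ - _
      ring
  have e := key (tres_mem_raw f hu k) (tres_mem_raw f hv k)
  rw [← tres_tbr] at e
  exact e

/-- The pairing of two generators is a pulled-back function, so its derivative along ξ is a
combination of derivatives along the anchors of the q_i, and invariance in M applies to each. This
discharges the hypotheses `hu`, `hv`, `hw` of the algebraic lemmas. -/
lemma app_gpair {u : Triple f M V} (hu : u ∈ raw f D.anchor V) (p r : Gen f M V) :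
    (cartan K Y V).app u.2.2 (D.gpair f p r) = inv₃ (D.gbr f) (D.gpair f) u.2.1 p r := by
  refine (app_pullO_of_mem_raw f hu _ _).trans ?_
  rw [dir, Finsupp.linearCombination_apply, inv₃]
  refine Finsupp.sum_congr fun q _ ↦ congrArg (_ * ·) ?_
  let W := q.1.1 ⊓ p.1.1 ⊓ r.1.1
  have hW : V ≤ f.preim W := le_preim_inf (le_preim_inf q.1.2 p.1.2) r.1.2
  have hq : W ≤ q.1.1 := inf_le_left.trans inf_le_left
  have hp : W ≤ p.1.1 := inf_le_left.trans inf_le_right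
  have hr : W ≤ r.1.1 := inf_le_right
  rw [D.gpair_invariance f hW hq hp hr, gdir_eq f _ _ _ q hW hq (le_inf hp hr), D.res_pair,
    M.res_res, M.res_res]

end PairedBracket

/-! ### Null elements and the defect of linearity in the first argument -/

namespace CartanCalculus

variable {R T Ω : Type*} [CommRing R] [AddCommGroup T] [Module R T] [AddCommGroup Ω] [Module R Ω]
variable (𝒞 : CartanCalculus R T Ω) {Q : Type*} (br : Q → Q → Q) (pr : Q → Q → R)
variable {N : Type*} [AddCommGroup N] [Module R N] (jΩ : Ω →ₗ[R] N) (pt : Q → N)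

lemma add_pr₃ (u v w : Ω × (Q →₀ R) × T) :
    𝒞.pr₃ pr (u + v) w = 𝒞.pr₃ pr u w + 𝒞.pr₃ pr v w := by
  simp only [pr₃, Prod.fst_add, Prod.snd_add, map_add, LinearMap.add_apply,
    AddMonoidHom.add_apply]; abel

lemma cls_add (u v : Ω × (Q →₀ R) × T) : cls jΩ pt (u + v) = cls jΩ pt u + cls jΩ pt v := by
  simp only [cls, Prod.fst_add, Prod.snd_add, map_add]; abel

lemma cls_smul (g : R) (u : Ω × (Q →₀ R) × T) : cls jΩ pt (g • u) = g • cls jΩ pt u := by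
  simp only [cls, Prod.smul_fst, Prod.smul_snd, map_smul, smul_add]

lemma cls_zero : cls jΩ pt (0 : Ω × (Q →₀ R) × T) = 0 := by
  simp only [cls, Prod.fst_zero, Prod.snd_zero, map_zero, add_zero]

lemma smul_formTerm (g : R) (x y : Q →₀ R) :
    𝒞.formTerm pr (g • x) y = g • 𝒞.formTerm pr x y + pairTerm pr x y • 𝒞.d g := by
  induction x using Finsupp.induction_linear with
  | zero => simp
  | add x x' hx hx' =>
    simp only [smul_add, map_add, AddMonoidHom.add_apply, add_smul, hx, hx']; abel
  | single q a =>
  induction y using Finsupp.induction_linear with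
  | zero => simp
  | add y y' hy hy' => simp only [smul_add, map_add, add_smul, hy, hy']; abel
  | single p b =>
    simp only [Finsupp.smul_single, smul_eq_mul, formTerm_single, pairTerm_single, 𝒞.d_mul,
      smul_add, smul_smul]
    congr 2 <;> ring

/-- When the vector field of u vanishes, the defect is the pairing times dg and a derivative of g
times the class of u. Both are zero on null elements, so these can be closed under multiplication by
functions. -/
lemma cls_smul_br₃ (g : R) {u : Ω × (Q →₀ R) × T} (hu : u.2.2 = 0) (v : Ω × (Q →₀ R) × T) :
    cls jΩ pt (𝒞.br₃ br pr (g • u) v) = g • cls jΩ pt (𝒞.br₃ br pr u v) +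
      𝒞.pr₃ pr u v • jΩ (𝒞.d g) - 𝒞.app v.2.2 g • cls jΩ pt u := by
  simp only [cls, br₃, pr₃, Prod.smul_fst, Prod.smul_snd, hu, smul_zero, map_zero,
    AddMonoidHom.zero_apply, LinearMap.zero_apply, ctr_smul, smul_formTerm, smul_brTerm, act_smul,
    map_add, map_sub, map_neg, map_smul]
  have e : ∀ y : Q →₀ R, 𝒞.act (0 : T) y = 0 := fun y ↦ by ext; simp [act]
  simp only [e, map_zero]
  module

/-- The pairs `(α, x)` whose class vanishes and for which the bracket and the pairing of
`(α, x, 0)` with `v` vanish in the quotient. -/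
def nullSub (v : Ω × (Q →₀ R) × T) : Submodule R (Ω × (Q →₀ R)) where
  -- The pairing is only required to annihilate the image of `jΩ`. For a Lie algebroid `jΩ` is zero,
  -- but the pairing of a form with a vector field need not vanish. The condition on its
  -- differential controls the bracket in the opposite order.
  carrier := {w | cls jΩ pt (w.1, w.2, (0 : T)) = 0 ∧
    (∀ γ, 𝒞.pr₃ pr (w.1, w.2, 0) v • jΩ γ = 0) ∧ jΩ (𝒞.d (𝒞.pr₃ pr (w.1, w.2, 0) v)) = 0 ∧
    cls jΩ pt (𝒞.br₃ br pr (w.1, w.2, 0) v) = 0}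
  zero_mem' := by
    have e : ((0 : Ω), (0 : Q →₀ R), (0 : T)) = (0 : R) • 0 := by rw [smul_zero]; rfl
    refine ⟨cls_zero jΩ pt, fun γ ↦ ?_, ?_, ?_⟩
    · rw [Prod.fst_zero, Prod.snd_zero, e, smul_pr₃, zero_mul, zero_smul]
    · rw [Prod.fst_zero, Prod.snd_zero, e, smul_pr₃, zero_mul, map_zero, map_zero]
    · rw [Prod.fst_zero, Prod.snd_zero, e, smul_br₃_of_const _ _ _ (map_zero _), zero_smul,
        cls_zero]
  add_mem' {a b} ha hb := by
    have e : ((a + b).1, (a + b).2, (0 : T)) = (a.1, a.2, 0) + (b.1, b.2, 0) :=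
      Prod.ext rfl (Prod.ext rfl (add_zero _).symm)
    obtain ⟨a1, a2, a3, a4⟩ := ha
    obtain ⟨b1, b2, b3, b4⟩ := hb
    refine ⟨?_, fun γ ↦ ?_, ?_, ?_⟩
    · rw [e, cls_add, a1, b1, add_zero]
    · rw [e, add_pr₃, add_smul, a2, b2, add_zero]
    · rw [e, add_pr₃, map_add, map_add, a3, b3, add_zero]
    · rw [e, add_br₃, cls_add, a4, b4, add_zero]
  smul_mem' g a ha := by
    have e : ((g • a).1, (g • a).2, (0 : T)) = g • (a.1, a.2, 0) :=
      Prod.ext rfl (Prod.ext rfl (smul_zero _).symm)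
    obtain ⟨a1, a2, a3, a4⟩ := ha
    refine ⟨?_, fun γ ↦ ?_, ?_, ?_⟩
    · rw [e, cls_smul, a1, smul_zero]
    · rw [e, smul_pr₃, mul_smul, a2, smul_zero]
    · rw [e, smul_pr₃, 𝒞.d_mul, map_add, map_smul, map_smul, a3, a2, smul_zero, add_zero]
    · rw [e, cls_smul_br₃ _ _ _ _ _ _ rfl, a1, a2, a4, smul_zero, smul_zero, add_zero, sub_zero]

end CartanCalculus

/-! ### Compatibility of the bracket with the tensor relations -/

namespace PairedBracket

variable {𝕜 : Type} [RCLike 𝕜] {n : WithTop ℕ∞} {K : Type} [RCLike K] [NormedAlgebra 𝕜 K]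
variable {X Y : Mfd.{u} 𝕜 n} (f : Mfd.Hom Y X) {M : OMod K X} (D : PairedBracket M)
variable {V : Opens Y}

open CartanCalculus

variable {N : Type*} [AddCommGroup N] [Module (Y.O K V) N]
  (jΩ : (formSheaf K Y).sec V →ₗ[Y.O K V] N) (jP : PSec f M V →ₗ[Y.O K V] N)

/-- The class of a triple in a quotient of `Ω¹_Y(V) × f^*M(V)`. -/
def tcls (u : Triple f M V) : N := cls jΩ (fun q ↦ jP (gpt f M q)) u

lemma linearCombination_gpt (x : Gen f M V →₀ Y.O K V) :
    Finsupp.linearCombination (Y.O K V) (fun q ↦ jP (gpt f M q)) x =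
      jP (Submodule.Quotient.mk x) := by
  rw [mk_eq_linearCombination]
  exact (Finsupp.apply_linearCombination _ _ _ _).symm

lemma tcls_eq (u : Triple f M V) :
    tcls f jΩ jP u = jΩ u.1 + jP (Submodule.Quotient.mk u.2.1) := by
  rw [tcls, cls, linearCombination_gpt]

variable [Fact (∞ ≤ n)]

/-- The pairs whose bracket with `v` vanishes in the quotient. -/
abbrev tnull (v : Triple f M V) : Submodule (Y.O K V)
    ((formSheaf K Y).sec V × (Gen f M V →₀ Y.O K V)) :=
  (cartan K Y V).nullSub (D.gbr f) (D.gpair f) jΩ (fun q ↦ jP (gpt f M q)) v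

lemma gpair_add_left {U : Opens X} (h : V ≤ f.preim U) (q q' : M.sec U) (p : Gen f M V) :
    D.gpair f ⟨⟨U, h⟩, q + q'⟩ p = D.gpair f ⟨⟨U, h⟩, q⟩ p + D.gpair f ⟨⟨U, h⟩, q'⟩ p := by
  simp only [gpair, map_add, D.add_pair]

lemma gpair_smul_left {U : Opens X} (h : V ≤ f.preim U) (g : X.O K U) (q : M.sec U)
    (p : Gen f M V) : D.gpair f ⟨⟨U, h⟩, g • q⟩ p =
      f.pullO K h g * D.gpair f ⟨⟨U, h⟩, q⟩ p := by
  simp only [gpair, PreMod.res_smul, D.smul_pair, map_mul]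
  rfl

lemma gpair_res_left {U U' : Opens X} (h : V ≤ f.preim U) (k : U ≤ U') (h' : V ≤ f.preim U')
    (q : M.sec U') (p : Gen f M V) :
    D.gpair f ⟨⟨U, h⟩, M.res k q⟩ p = D.gpair f ⟨⟨U', h'⟩, q⟩ p := by
  have hW : V ≤ f.preim (U ⊓ p.1.1) := le_preim_inf h p.1.2
  rw [D.gpair_eq f (q := ⟨⟨U', h'⟩, q⟩) hW (inf_le_left.trans k) inf_le_right]
  simp only [gpair, M.res_res]

lemma gpt_gbr_add_left {U : Opens X} (h : V ≤ f.preim U) (q q' : M.sec U) (p : Gen f M V) :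
    gpt f M (D.gbr f ⟨⟨U, h⟩, q + q'⟩ p) =
      gpt f M (D.gbr f ⟨⟨U, h⟩, q⟩ p) + gpt f M (D.gbr f ⟨⟨U, h⟩, q'⟩ p) := by
  refine Eq.trans ?_ (Pull.pure_add _ _ _)
  refine congrArg (Pull.pure f M (le_preim_inf h p.1.2)) ?_
  exact (congrArg (D.br · _) (map_add _ _ _)).trans (D.add_br _ _ _)

lemma gpt_gbr_res_left {U U' : Opens X} (h : V ≤ f.preim U) (k : U ≤ U') (h' : V ≤ f.preim U')
    (q : M.sec U') (p : Gen f M V) :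
    gpt f M (D.gbr f ⟨⟨U, h⟩, M.res k q⟩ p) = gpt f M (D.gbr f ⟨⟨U', h'⟩, q⟩ p) := by
  have hW : V ≤ f.preim (U ⊓ p.1.1) := le_preim_inf h p.1.2
  have h1 : U ⊓ p.1.1 ≤ (D.gbr f ⟨⟨U', h'⟩, q⟩ p).1.1 := inf_le_inf_right _ k
  have e := D.gbr_res f (q := ⟨⟨U', h'⟩, q⟩) (p := p) (inf_le_left.trans k) inf_le_right h1
  rw [gpt_eq f hW h1, e, ← M.res_res k inf_le_left]
  rfl

lemma gpt_gbr_smul_right {U : Opens X} (h : V ≤ f.preim U) (g : X.O K U) (q : M.sec U)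
    (p : Gen f M V) : gpt f M (D.gbr f p ⟨⟨U, h⟩, g • q⟩) =
      f.pullO K h g • gpt f M (D.gbr f p ⟨⟨U, h⟩, q⟩) +
        gdir f D.anchor h g p • gpt f M ⟨⟨U, h⟩, q⟩ := by
  have hW : V ≤ f.preim (p.1.1 ⊓ U) := le_preim_inf p.1.2 h
  have e : gpt f M ⟨⟨U, h⟩, q⟩ = Pull.pure f M hW (M.res inf_le_right q) :=
    gpt_eq f (q := ⟨⟨U, h⟩, q⟩) hW inf_le_right
  rw [e]
  change Pull.pure f M hW (D.br (M.res inf_le_left p.2) (M.res inf_le_right (g • q))) = 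
    f.pullO K hW (resO K inf_le_right g) •
      Pull.pure f M hW (D.br (M.res inf_le_left p.2) (M.res inf_le_right q)) +
    f.pullO K hW (VF.app (D.anchor.app _ (M.res inf_le_left p.2)) (resO K inf_le_right g)) • _
  rw [← Pull.pure_smul, ← Pull.pure_smul, ← Pull.pure_add, PreMod.res_smul, D.leibniz]

/-- The structure contains a Leibniz rule in the second argument only. The one in the first follows
from the symmetrised bracket, and its extra term comes from differentiating f^*g in d(f^*g ⟨q,p⟩).
-/
lemma gpt_gbr_smul_left (hsw : ∀ q p : Gen f M V, jP (gpt f M (D.gbr f q p)) +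
      jP (gpt f M (D.gbr f p q)) = jΩ (dHom K Y V (D.gpair f q p))) {U : Opens X} (h : V ≤ f.preim U) (g : X.O K U) (q : M.sec U)
    (p : Gen f M V) : jP (gpt f M (D.gbr f ⟨⟨U, h⟩, g • q⟩ p)) =
      f.pullO K h g • jP (gpt f M (D.gbr f ⟨⟨U, h⟩, q⟩ p)) -
        gdir f D.anchor h g p • jP (gpt f M ⟨⟨U, h⟩, q⟩) +
          D.gpair f ⟨⟨U, h⟩, q⟩ p • jΩ (dHom K Y V (f.pullO K h g)) := by
  have h1 := hsw ⟨⟨U, h⟩, g • q⟩ p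
  have h2 := hsw ⟨⟨U, h⟩, q⟩ p
  rw [gpt_gbr_smul_right, gpair_smul_left, dHom_mul] at h1
  simp only [map_add, map_smul] at h1
  rw [← h2] at h1
  linear_combination (norm := module) h1

/-- A vanishing pairing settles both middle conditions, so only the class and the bracket remain; in
the latter all terms containing the zero vector field drop out. -/
lemma single_mem_tnull {v : Triple f M V} {w : (formSheaf K Y).sec V × (Gen f M V →₀ Y.O K V)}
    (h1 : jΩ w.1 + jP (Submodule.Quotient.mk w.2) = 0)
    (h2 : Form.contract v.2.2 w.1 + pairTerm (D.gpair f) w.2 v.2.1 = 0)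
    (h3 : jΩ ((cartan K Y V).formTerm (D.gpair f) w.2 v.2.1 - ctrD v.2.2 w.1) +
      jP (Submodule.Quotient.mk (brTerm (D.gbr f) w.2 v.2.1)) -
        jP (Submodule.Quotient.mk ((cartan K Y V).act v.2.2 w.2)) = 0) :
    w ∈ D.tnull f jΩ jP v := by
  have e : (cartan K Y V).pr₃ (D.gpair f) (w.1, w.2, 0) v = 0 := by
    refine Eq.trans ?_ h2
    simp only [pr₃, map_zero, LinearMap.zero_apply, zero_add]
    rfl
  refine ⟨?_, fun γ ↦ ?_, ?_, ?_⟩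
  · exact (tcls_eq f jΩ jP _).trans h1
  · rw [e, zero_smul]
  · rw [e, map_zero, map_zero]
  · refine (tcls_eq f jΩ jP _).trans (Eq.trans ?_ h3)
    have e' : (cartan K Y V).act 0 v.2.1 = 0 := by ext q; simp [act]
    simp only [br₃, map_zero, AddMonoidHom.zero_apply, add_zero, e', Submodule.Quotient.mk_sub,
      map_sub, map_add, map_neg]
    rw [ctrD]
    abel

lemma pairTerm_rel {c : Gen f M V →₀ Y.O K V} (hc : Rel f M V c) (y : Gen f M V →₀ Y.O K V) :
    pairTerm (D.gpair f) c y = 0 := by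
  have hp : ∀ (q : Gen f M V) (g : Y.O K V) (y : Gen f M V →₀ Y.O K V),
      pairTerm (D.gpair f) (Finsupp.single q g) y =
        y.sum fun p b ↦ g * b * D.gpair f q p := fun q g y ↦ by
    induction y using Finsupp.induction_linear with
    | zero => simp
    | add y y' hy hy' =>
      rw [map_add, hy, hy', Finsupp.sum_add_index' (by simp) (fun _ _ _ ↦ by ring)]
    | single p b => rw [pairTerm_single, Finsupp.sum_single_index (by simp)]
  cases hc with
  | res h k h' q =>
    rw [map_sub, AddMonoidHom.sub_apply, hp, hp, sub_eq_zero]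
    exact Finsupp.sum_congr fun p _ ↦ by rw [D.gpair_res_left f h k h']
  | add h q q' =>
    rw [map_sub, map_sub, AddMonoidHom.sub_apply, AddMonoidHom.sub_apply, hp, hp, hp,
      sub_sub, sub_eq_zero, ← Finsupp.sum_add]
    exact Finsupp.sum_congr fun p _ ↦ by rw [D.gpair_add_left, mul_add]
  | smul h g q =>
    rw [map_sub, AddMonoidHom.sub_apply, hp, hp, sub_eq_zero]
    exact Finsupp.sum_congr fun p _ ↦ by rw [D.gpair_smul_left]; ring

/-- The relations for restriction and addition are formal. For 1 ⊗ gq = f^*g ⊗ q, the left side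
produces the anchor derivatives of g through the Leibniz rule in the first argument, the right side
produces η(f^*g) by differentiating the coefficient. They agree because v lies in the fibre product.
-/
lemma rel_mem_tnull (hsw : ∀ q p : Gen f M V, jP (gpt f M (D.gbr f q p)) +
      jP (gpt f M (D.gbr f p q)) = jΩ (dHom K Y V (D.gpair f q p))) {v : Triple f M V}
    (hv : v ∈ raw f D.anchor V) {c : Gen f M V →₀ Y.O K V} (hc : Rel f M V c) :
    ((0 : (formSheaf K Y).sec V), c) ∈ D.tnull f jΩ jP v := by
  have h0 : (Submodule.Quotient.mk c : PSec f M V) = 0 :=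
    (Submodule.Quotient.mk_eq_zero _).2 (Submodule.subset_span hc)
  let l : PSec f M V →+ N := jP.toAddMonoidHom
  let m : (Gen f M V →₀ Y.O K V) →+ PSec f M V := (Submodule.mkQ _).toAddMonoidHom
  -- The bracket condition of `single_mem_tnull` for (0, c), as an additive function of c, so that
  -- it can be evaluated on the single terms of a relation.
  let Φ : (Gen f M V →₀ Y.O K V) →+ N :=
    jΩ.toAddMonoidHom.comp (((cartan K Y V).formTerm (D.gpair f)).flip v.2.1) +
      (l.comp m).comp ((brTerm (D.gbr f)).flip v.2.1) -
        (l.comp m).comp ((cartan K Y V).act v.2.2)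
  have hΦ : ∀ (q : Gen f M V) (g : Y.O K V), Φ (Finsupp.single q g) =
      (v.2.1.sum fun p b ↦ b • (D.gpair f q p • jΩ (dHom K Y V g) +
        g • jP (gpt f M (D.gbr f q p)))) - VF.app v.2.2 g • jP (gpt f M q) := fun q g ↦ by
    have e : ∀ y : Gen f M V →₀ Y.O K V,
        jΩ ((cartan K Y V).formTerm (D.gpair f) (Finsupp.single q g) y) +
          jP (Submodule.Quotient.mk (brTerm (D.gbr f) (Finsupp.single q g) y)) =
        y.sum fun p b ↦ b • (D.gpair f q p • jΩ (dHom K Y V g) +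
          g • jP (gpt f M (D.gbr f q p))) := fun y ↦ by
      induction y using Finsupp.induction_linear with
      | zero => simp
      | add y y' hy hy' =>
        rw [Finsupp.sum_add_index' (by simp) (fun _ _ _ ↦ by rw [add_smul]), ← hy, ← hy', map_add,
          map_add, map_add, Submodule.Quotient.mk_add, map_add]
        abel
      | single p b =>
        rw [formTerm_single, brTerm_single, mk_single, Finsupp.sum_single_index (by simp), map_smul,
          map_smul, smul_add, smul_smul, smul_smul, mul_comm g]
        rfl
    refine congrArg₂ (· - ·) (e v.2.1) ?_
    change jP (Submodule.Quotient.mk ((cartan K Y V).act v.2.2 (Finsupp.single q g))) = _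
    rw [act_single, mk_single, map_smul]
    rfl
  have hΦ1 : ∀ q : Gen f M V, Φ (Finsupp.single q 1) =
      v.2.1.sum fun p b ↦ b • jP (gpt f M (D.gbr f q p)) := fun q ↦ by
    have h1 : VF.app v.2.2 (1 : Y.O K V) = 0 := Mfd.app_const v.2.2 1
    have h2 : dHom K Y V 1 = 0 := dHom_const 1
    rw [hΦ, h1, h2, zero_smul, sub_zero]
    simp only [map_zero, smul_zero, zero_add, one_smul]
  have hctr : ctrD v.2.2 (0 : (formSheaf K Y).sec V) = 0 := (cartan K Y V).ctr_zero _
  have hcontr : Form.contract v.2.2 (0 : (formSheaf K Y).sec V) = 0 := rfl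
  refine D.single_mem_tnull f jΩ jP (by rw [h0]; simp) ?_ ?_
  · change Form.contract v.2.2 (0 : (formSheaf K Y).sec V) + _ = 0
    rw [hcontr, zero_add]
    exact D.pairTerm_rel f hc _
  · change jΩ (_ - ctrD v.2.2 (0 : (formSheaf K Y).sec V)) + _ - _ = 0
    rw [hctr, sub_zero]
    change Φ c = 0
    cases hc with
    | res h k h' q =>
      rw [map_sub, hΦ1, hΦ1, sub_eq_zero]
      exact Finsupp.sum_congr fun p _ ↦ by rw [D.gpt_gbr_res_left f h k h']
    | add h q q' =>
      rw [map_sub, map_sub, hΦ1, hΦ1, hΦ1, sub_sub, sub_eq_zero, ← Finsupp.sum_add]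
      exact Finsupp.sum_congr fun p _ ↦ by rw [D.gpt_gbr_add_left, map_add, smul_add]
    | smul h g q =>
      -- Expanding η(f^*g) over the generators of v makes the two sides comparable term by term.
      have e : VF.app v.2.2 (f.pullO K h g) = v.2.1.sum fun p b ↦ b * gdir f D.anchor h g p :=
        (app_pullO_of_mem_raw f hv h g).trans (Finsupp.linearCombination_apply _ _)
      rw [map_sub, hΦ1, hΦ, e, sub_eq_zero]
      simp only [Finsupp.sum, Finset.sum_smul, ← Finset.sum_sub_distrib]
      refine Finset.sum_congr rfl fun p _ ↦ ?_
      rw [D.gpt_gbr_smul_left f jΩ jP hsw]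
      module

end PairedBracket

/-! ### Brackets on sheaves presented by triples -/

/-- A presentation of a sheaf by triples `(α, ∑ g_i ⊗ q_i, ξ)`. -/
structure TripleModel {𝕜 : Type} [RCLike 𝕜] {n : WithTop ℕ∞} {K : Type} [RCLike K]
    [NormedAlgebra 𝕜 K] {X Y : Mfd.{u} 𝕜 n} (f : Mfd.Hom Y X) {M : OMod K X}
    (D : PairedBracket M) [Fact (∞ ≤ n)] (M' : OMod K Y) where
  N : Opens Y → Type u
  [group : ∀ V, AddCommGroup (N V)]
  [module : ∀ V, Module (Y.O K V) (N V)]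
  jΩ : ∀ V, (formSheaf K Y).sec V →ₗ[Y.O K V] N V
  jP : ∀ V, PSec f M V →ₗ[Y.O K V] N V
  swap : ∀ {V : Opens Y} (q p : Gen f M V), jP V (PairedBracket.gpt f M (D.gbr f q p)) +
    jP V (PairedBracket.gpt f M (D.gbr f p q)) = jΩ V (dHom K Y V (D.gpair f q p))
  θ : (PairedBracket.rawMod f D.anchor).Pres M'
  -- A zero class with ξ = 0 gives the zero section. The converse in `local_eq_zero` is local, since
  -- a section of an associated sheaf may vanish although its representative vanishes only after
  -- restriction.
  θ_eq_zero : ∀ {V : Opens Y} (u : PairedBracket.Triple f M V)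
    (hu : u ∈ PairedBracket.raw f D.anchor V),
    PairedBracket.tcls f (jΩ V) (jP V) u = 0 → u.2.2 = 0 → θ.app V ⟨u, hu⟩ = 0
  local_eq_zero : ∀ {V : Opens Y} (u : PairedBracket.Triple f M V)
    (hu : u ∈ PairedBracket.raw f D.anchor V), θ.app V ⟨u, hu⟩ = 0 → ∀ y ∈ V,
    ∃ (W : Opens Y) (h : W ≤ V), y ∈ W ∧
      PairedBracket.tcls f (jΩ W) (jP W) (PairedBracket.tres f M h u) = 0 ∧
      (PairedBracket.tres f M h u).2.2 = 0
  null : ∀ {V : Opens Y} (u v : PairedBracket.Triple f M V),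
    v ∈ PairedBracket.raw f D.anchor V → PairedBracket.tcls f (jΩ V) (jP V) u = 0 →
      (u.1, u.2.1) ∈ D.tnull f (jΩ V) (jP V) v

attribute [instance] TripleModel.group TripleModel.module

namespace TripleModel

variable {𝕜 : Type} [RCLike 𝕜] {n : WithTop ℕ∞} {K : Type} [RCLike K]
    [NormedAlgebra 𝕜 K] {X Y : Mfd.{u} 𝕜 n} {f : Mfd.Hom Y X} {M : OMod K X}
    {D : PairedBracket M} [Fact (∞ ≤ n)] {M' : OMod K Y} (𝔪 : TripleModel f D M')
variable {V W : Opens Y}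

open CartanCalculus PairedBracket

/-- The section defined by a triple. -/
def sct (u : Triple f M V) (hu : u ∈ raw f D.anchor V) : M'.sec V := 𝔪.θ.app V ⟨u, hu⟩

lemma sct_add {u v : Triple f M V} (hu hv) :
    𝔪.sct (u + v) (add_mem hu hv) = 𝔪.sct u hu + 𝔪.sct v hv :=
  map_add (𝔪.θ.app V) ⟨u, hu⟩ ⟨v, hv⟩

lemma sct_smul (g : Y.O K V) {u : Triple f M V} (hu) :
    𝔪.sct (g • u) (Submodule.smul_mem _ g hu) = g • 𝔪.sct u hu :=
  map_smul (𝔪.θ.app V) g ⟨u, hu⟩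

lemma res_sct (k : W ≤ V) {u : Triple f M V} (hu) :
    M'.res k (𝔪.sct u hu) = 𝔪.sct (tres f M k u) (tres_mem_raw f hu k) :=
  (𝔪.θ.naturality k ⟨u, hu⟩).symm

lemma exists_sct (t : M'.sec V) {y : Y} (hy : y ∈ V) : ∃ (W : Opens Y) (h : W ≤ V)
    (u : Triple f M W) (hu : _), y ∈ W ∧ 𝔪.sct u hu = M'.res h t := by
  obtain ⟨W, h, u, hyW, e⟩ := 𝔪.θ.surj t y hy
  exact ⟨W, h, u.1, u.2, hyW, e⟩

lemma exists_sct₂ (t s : M'.sec V) {y : Y} (hy : y ∈ V) : ∃ (W : Opens Y) (h : W ≤ V)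
    (u v : Triple f M W) (hu : _) (hv : _), y ∈ W ∧ 𝔪.sct u hu = M'.res h t ∧
      𝔪.sct v hv = M'.res h s := by
  obtain ⟨W, h, u, v, hyW, e⟩ := 𝔪.θ.cover₂ t s hy
  exact ⟨W, h, u.1, v.1, u.2, v.2, hyW, e⟩

lemma exists_sct₃ (t s r : M'.sec V) {y : Y} (hy : y ∈ V) : ∃ (W : Opens Y) (h : W ≤ V)
    (u v w : Triple f M W) (hu : _) (hv : _) (hw : _), y ∈ W ∧ 𝔪.sct u hu = M'.res h t ∧
      𝔪.sct v hv = M'.res h s ∧ 𝔪.sct w hw = M'.res h r := by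
  obtain ⟨W, h, u, v, w, hyW, e⟩ := 𝔪.θ.cover₃ t s r hy
  exact ⟨W, h, u.1, v.1, w.1, u.2, v.2, w.2, hyW, e⟩

lemma sct_congr {u v : Triple f M V} (hu : u ∈ raw f D.anchor V) (hv : v ∈ raw f D.anchor V)
    (h : tcls f (𝔪.jΩ V) (𝔪.jP V) u = tcls f (𝔪.jΩ V) (𝔪.jP V) v) (h' : u.2.2 = v.2.2) :
    𝔪.sct u hu = 𝔪.sct v hv := by
  have e : tcls f (𝔪.jΩ V) (𝔪.jP V) (u - v) = 0 := by
    have := cls_add (𝔪.jΩ V) (fun q ↦ 𝔪.jP V (gpt f M q)) (u - v) v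
    rw [sub_add_cancel] at this
    exact (eq_sub_of_add_eq this.symm).trans (sub_eq_zero.2 h)
  have e' := 𝔪.θ_eq_zero (u - v) (sub_mem hu hv) e (sub_eq_zero.2 h')
  exact sub_eq_zero.1 ((map_sub (𝔪.θ.app V) ⟨u, hu⟩ ⟨v, hv⟩).symm.trans e')

lemma tcls_tbr_swap (u v : Triple f M V) :
    tcls f (𝔪.jΩ V) (𝔪.jP V) (D.tbr f u v) + tcls f (𝔪.jΩ V) (𝔪.jP V) (D.tbr f v u) =
      𝔪.jΩ V (dHom K Y V (D.tpr f u v)) :=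
  (cartan K Y V).cls_br₃_swap _ _ (D.gpair_symm f) 𝔪.swap u v

/-- Null triples behave like a two-sided ideal with respect to the fibre product. One order of the
bracket is the field `null`; for the other, the symmetrised bracket is the differential of the
pairing, which is zero in the target. -/
lemma null_tbr {u v : Triple f M V} (hv : v ∈ raw f D.anchor V)
    (hu : tcls f (𝔪.jΩ V) (𝔪.jP V) u = 0) (hu' : u.2.2 = 0) :
    tcls f (𝔪.jΩ V) (𝔪.jP V) (D.tbr f u v) = 0 ∧ (D.tbr f u v).2.2 = 0 ∧
      tcls f (𝔪.jΩ V) (𝔪.jP V) (D.tbr f v u) = 0 ∧ (D.tbr f v u).2.2 = 0 := by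
  have e : u = (u.1, u.2.1, 0) := Prod.ext rfl (Prod.ext rfl hu')
  obtain ⟨-, -, h3, h4⟩ := 𝔪.null u v hv hu
  dsimp only at h3 h4
  rw [← e] at h3 h4
  refine ⟨h4, ?_, ?_, ?_⟩
  · change lieBHom K Y V u.2.2 v.2.2 = 0
    rw [hu', map_zero]; rfl
  · have := 𝔪.tcls_tbr_swap u v
    rw [show tcls f (𝔪.jΩ V) (𝔪.jP V) (D.tbr f u v) = 0 from h4, zero_add] at this
    exact this.trans h3
  · change lieBHom K Y V v.2.2 u.2.2 = 0
    rw [hu', map_zero]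

lemma res_sct_tbr (k : W ≤ V) {u v : Triple f M V} (hu : u ∈ raw f D.anchor V)
    (hv : v ∈ raw f D.anchor V) : M'.res k (𝔪.sct (D.tbr f u v) (D.tbr_mem_raw f hu hv)) =
      𝔪.sct (D.tbr f (tres f M k u) (tres f M k v))
        (D.tbr_mem_raw f (tres_mem_raw f hu k) (tres_mem_raw f hv k)) :=
  (𝔪.res_sct k _).trans (congrArg (𝔪.θ.app W) (Subtype.ext (D.tres_tbr f k u v)))

lemma exists_br : ∃ br : ∀ {V : Opens Y}, M'.sec V → M'.sec V → M'.sec V,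
    (∀ {V : Opens Y} (u v : Triple f M V) (hu : u ∈ raw f D.anchor V) (hv : v ∈ raw f D.anchor V),
      br (𝔪.sct u hu) (𝔪.sct v hv) = 𝔪.sct (D.tbr f u v) (D.tbr_mem_raw f hu hv)) ∧
    ∀ {V W : Opens Y} (k : W ≤ V) (t s : M'.sec V),
      M'.res k (br t s) = br (M'.res k t) (M'.res k s) := by
  obtain ⟨br, h1, h2⟩ := 𝔪.θ.exists_op (M' := M') (fun V ↦ AddMonoidHom.mk'
    (fun u ↦ AddMonoidHom.mk' (fun v ↦ 𝔪.sct (D.tbr f u.1 v.1) (D.tbr_mem_raw f u.2 v.2))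
      (fun v w ↦ by
        rw [← 𝔪.sct_add]
        exact congrArg (𝔪.θ.app V) (Subtype.ext ((cartan K Y V).br₃_add _ _ u.1 v.1 w.1))))
    (fun u v ↦ AddMonoidHom.ext fun w ↦ by
        refine Eq.trans ?_ (𝔪.sct_add _ _)
        exact congrArg (𝔪.θ.app V) (Subtype.ext ((cartan K Y V).add_br₃ _ _ u.1 v.1 w.1))))
    (fun {V W} k u v ↦ 𝔪.res_sct_tbr k u.2 v.2)
    (fun {V} u v hu ↦ M'.sep _ _ fun y hy ↦ by
      obtain ⟨W, h, hyW, e1, e2⟩ := 𝔪.local_eq_zero u.1 u.2 hu y hy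
      refine ⟨W, h, hyW, ?_⟩
      refine (𝔪.res_sct_tbr h u.2 v.2).trans ?_
      rw [map_zero]
      have := 𝔪.null_tbr (tres_mem_raw f v.2 h) e1 e2
      exact 𝔪.θ_eq_zero _ (D.tbr_mem_raw f (tres_mem_raw f u.2 h) (tres_mem_raw f v.2 h)) this.1
        this.2.1)
    (fun {V} u v hv ↦ M'.sep _ _ fun y hy ↦ by
      obtain ⟨W, h, hyW, e1, e2⟩ := 𝔪.local_eq_zero v.1 v.2 hv y hy
      refine ⟨W, h, hyW, ?_⟩
      refine (𝔪.res_sct_tbr h u.2 v.2).trans ?_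
      rw [map_zero]
      have := 𝔪.null_tbr (tres_mem_raw f u.2 h) e1 e2
      exact 𝔪.θ_eq_zero _ (D.tbr_mem_raw f (tres_mem_raw f u.2 h) (tres_mem_raw f v.2 h))
        this.2.2.1 this.2.2.2)
  exact ⟨br, fun u v hu hv ↦ h1 ⟨u, hu⟩ ⟨v, hv⟩, h2⟩

/-- The bracket induced by the bracket of triples. -/
def br (t s : M'.sec V) : M'.sec V := 𝔪.exists_br.choose t s

lemma br_sct {u v : Triple f M V} (hu : u ∈ raw f D.anchor V) (hv : v ∈ raw f D.anchor V) :
    𝔪.br (𝔪.sct u hu) (𝔪.sct v hv) = 𝔪.sct (D.tbr f u v) (D.tbr_mem_raw f hu hv) :=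
  𝔪.exists_br.choose_spec.1 u v hu hv

lemma res_br (k : W ≤ V) (t s : M'.sec V) :
    M'.res k (𝔪.br t s) = 𝔪.br (M'.res k t) (M'.res k s) :=
  𝔪.exists_br.choose_spec.2 k t s

lemma exists_anchor : ∃ φ : OMod.Hom M' (tangentSheaf K Y), ∀ (V : Opens Y) (u : Triple f M V)
    (hu : u ∈ raw f D.anchor V), φ.app V (𝔪.sct u hu) = u.2.2 := by
  obtain ⟨φ, h⟩ := 𝔪.θ.exists_hom (M' := tangentSheaf K Y) (fun V ↦
      ((LinearMap.snd _ _ _).comp (LinearMap.snd _ _ _)).comp (raw f D.anchor V).subtype)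
    (fun k u ↦ rfl)
    (fun {V} u hu ↦ (tangentSheaf K Y).sep _ _ fun y hy ↦ by
      obtain ⟨W, h, hyW, e1, e2⟩ := 𝔪.local_eq_zero u.1 u.2 hu y hy
      exact ⟨W, h, hyW, e2.trans (map_zero _).symm⟩)
  exact ⟨φ, fun V u hu ↦ h V ⟨u, hu⟩⟩

/-- The anchor induced by `(α, s, ξ) ↦ ξ`. -/
def anchor : OMod.Hom M' (tangentSheaf K Y) := 𝔪.exists_anchor.choose

lemma anchor_sct {u : Triple f M V} (hu : u ∈ raw f D.anchor V) :
    𝔪.anchor.app V (𝔪.sct u hu) = u.2.2 := 𝔪.exists_anchor.choose_spec V u hu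

lemma add_br (t s r : M'.sec V) : 𝔪.br (t + s) r = 𝔪.br t r + 𝔪.br s r :=
  M'.sep _ _ fun y hy ↦ by
    obtain ⟨W, h, u, v, w, hu, hv, hw, hyW, eu, ev, ew⟩ := 𝔪.exists_sct₃ t s r hy
    refine ⟨W, h, hyW, ?_⟩
    rw [map_add, res_br, res_br, res_br, map_add, ← eu, ← ev, ← ew, ← sct_add, br_sct, br_sct, br_sct,
      ← sct_add]
    exact congrArg (𝔪.θ.app W) (Subtype.ext ((cartan K Y W).add_br₃ _ _ u v w))

lemma br_add (t s r : M'.sec V) : 𝔪.br t (s + r) = 𝔪.br t s + 𝔪.br t r :=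
  M'.sep _ _ fun y hy ↦ by
    obtain ⟨W, h, u, v, w, hu, hv, hw, hyW, eu, ev, ew⟩ := 𝔪.exists_sct₃ t s r hy
    refine ⟨W, h, hyW, ?_⟩
    rw [map_add, res_br, res_br, res_br, map_add, ← eu, ← ev, ← ew, ← sct_add, br_sct, br_sct, br_sct,
      ← sct_add]
    exact congrArg (𝔪.θ.app W) (Subtype.ext ((cartan K Y W).br₃_add _ _ u v w))

lemma const_br (k : K) (t s : M'.sec V) :
    𝔪.br (Mfd.const V k • t) s = Mfd.const V k • 𝔪.br t s :=
  M'.sep _ _ fun y hy ↦ by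
    obtain ⟨W, h, u, v, hu, hv, hyW, eu, ev⟩ := 𝔪.exists_sct₂ t s hy
    refine ⟨W, h, hyW, ?_⟩
    rw [res_br, PreMod.res_smul, PreMod.res_smul, res_br, ← eu, ← ev, ← sct_smul, br_sct, br_sct,
      ← sct_smul]
    exact congrArg (𝔪.θ.app W) (Subtype.ext
      ((cartan K Y W).smul_br₃_of_const _ _ (dHom_const k) u v))

lemma leibniz (t s : M'.sec V) (g : Y.O K V) :
    𝔪.br t (g • s) = g • 𝔪.br t s + VF.app (𝔪.anchor.app V t) g • s :=
  M'.sep _ _ fun y hy ↦ by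
    obtain ⟨W, h, u, v, hu, hv, hyW, eu, ev⟩ := 𝔪.exists_sct₂ t s hy
    refine ⟨W, h, hyW, ?_⟩
    rw [res_br, map_add, PreMod.res_smul, PreMod.res_smul, PreMod.res_smul, res_br, resO_app,
      ← 𝔪.anchor.naturality, ← eu, ← ev, ← sct_smul, br_sct, br_sct, anchor_sct, ← sct_smul, ← sct_smul,
      ← sct_add]
    exact congrArg (𝔪.θ.app W) (Subtype.ext
      ((cartan K Y W).br₃_smul _ _ u (resO K h g) v))

lemma br_const (k : K) (t s : M'.sec V) :
    𝔪.br t (Mfd.const V k • s) = Mfd.const V k • 𝔪.br t s := by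
  rw [leibniz, Mfd.app_const, zero_smul, add_zero]

/-- Unlike biadditivity or the Leibniz rule, this is an identity of classes and not of triples,
which is why `sct_congr` is needed. -/
lemma jacobi (t s r : M'.sec V) :
    𝔪.br t (𝔪.br s r) = 𝔪.br (𝔪.br t s) r + 𝔪.br s (𝔪.br t r) :=
  M'.sep _ _ fun y hy ↦ by
    obtain ⟨W, h, u, v, w, hu, hv, hw, hyW, eu, ev, ew⟩ := 𝔪.exists_sct₃ t s r hy
    refine ⟨W, h, hyW, ?_⟩
    rw [map_add]
    simp only [res_br, ← eu, ← ev, ← ew, br_sct]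
    rw [← sct_add]
    refine 𝔪.sct_congr _ _ ?_ ?_
    · refine Eq.trans ?_ (cls_add _ _ _ _).symm
      exact (cartan K Y W).cls_br₃_jacobi (𝔪.jΩ W) _ (D.gpair_symm f) 𝔪.swap
        (fun q p r ↦ by rw [D.gpt_jacobi, map_add]) (D.gpair_swap f) u v w
        (D.app_gpair f hu) (D.app_gpair f hv) (D.app_gpair f hw)
    · exact (cartan K Y W).bra_jacobi _ _ _

lemma anchor_br (t s : M'.sec V) :
    IsBracket (𝔪.anchor.app V (𝔪.br t s)) (𝔪.anchor.app V t) (𝔪.anchor.app V s) := by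
  have e : 𝔪.anchor.app V (𝔪.br t s) = lieB (𝔪.anchor.app V t) (𝔪.anchor.app V s) :=
    (tangentSheaf K Y).sep _ _ fun y hy ↦ by
      obtain ⟨W, h, u, v, hu, hv, hyW, eu, ev⟩ := 𝔪.exists_sct₂ t s hy
      refine ⟨W, h, hyW, ?_⟩
      rw [res_lieB, ← 𝔪.anchor.naturality, ← 𝔪.anchor.naturality, ← 𝔪.anchor.naturality, res_br,
        ← eu, ← ev, br_sct, anchor_sct, anchor_sct, anchor_sct]
      rfl
  rw [e]
  exact isBracket_lieB _ _

end TripleModel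

namespace PairedBracket

variable {𝕜 : Type} [RCLike 𝕜] {n : WithTop ℕ∞} {K : Type} [RCLike K] [NormedAlgebra 𝕜 K]
variable {X Y : Mfd.{u} 𝕜 n} (f : Mfd.Hom Y X) {M : OMod K X} (D : PairedBracket M)
variable {U : Opens X} {V : Opens Y}

open CartanCalculus

/-! ### Finite sums over a common open set -/

/-- The formal sum `∑ g_i ⊗ q_i`. -/
def psum (hU : V ≤ f.preim U) {k : ℕ} (g : Fin k → Y.O K V) (q : Fin k → M.sec U) :
    Gen f M V →₀ Y.O K V := ∑ i, Finsupp.single ⟨⟨U, hU⟩, q i⟩ (g i)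

lemma mk_sum {ι : Type*} (s : Finset ι) (x : ι → Gen f M V →₀ Y.O K V) :
    (Submodule.Quotient.mk (∑ i ∈ s, x i) : PSec f M V) = ∑ i ∈ s, Submodule.Quotient.mk (x i) :=
  map_sum (Submodule.mkQ (Submodule.span (Y.O K V) {c | Rel f M V c})) x s

lemma mk_psum (hU : V ≤ f.preim U) {k : ℕ} (g : Fin k → Y.O K V) (q : Fin k → M.sec U) :
    (Submodule.Quotient.mk (psum f hU g q) : PSec f M V) = pullSum f hU g q := by
  rw [psum, mk_sum, pullSum]
  exact Finset.sum_congr rfl fun i _ ↦ mk_single f _ _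

lemma gpair_mk (hU : V ≤ f.preim U) (q p : M.sec U) :
    D.gpair f ⟨⟨U, hU⟩, q⟩ ⟨⟨U, hU⟩, p⟩ = f.pullO K hU (D.pair q p) := by
  rw [D.gpair_eq f (q := ⟨⟨U, hU⟩, q⟩) (p := ⟨⟨U, hU⟩, p⟩) hU le_rfl le_rfl, M.res_refl, M.res_refl]

lemma gpt_gbr_mk (hU : V ≤ f.preim U) (q p : M.sec U) :
    gpt f M (D.gbr f ⟨⟨U, hU⟩, q⟩ ⟨⟨U, hU⟩, p⟩) = Pull.pure f M hU (D.br q p) := by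
  have h1 : U ≤ (D.gbr f (V := V) ⟨⟨U, hU⟩, q⟩ ⟨⟨U, hU⟩, p⟩).1.1 := le_inf le_rfl le_rfl
  rw [gpt_eq f hU h1, D.gbr_res f (q := ⟨⟨U, hU⟩, q⟩) (p := ⟨⟨U, hU⟩, p⟩) le_rfl le_rfl h1,
    M.res_refl, M.res_refl]

lemma mk_brTerm_psum (hU : V ≤ f.preim U) {k l : ℕ} (g : Fin k → Y.O K V) (q : Fin k → M.sec U)
    (h : Fin l → Y.O K V) (p : Fin l → M.sec U) :
    (Submodule.Quotient.mk (brTerm (D.gbr f) (psum f hU g q) (psum f hU h p)) : PSec f M V) =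
      ∑ i, ∑ j, (g i * h j) • Pull.pure f M hU (D.br (q i) (p j)) := by
  rw [psum, psum, map_sum, mk_sum, Finset.sum_comm]
  refine Finset.sum_congr rfl fun j _ ↦ ?_
  rw [map_sum, AddMonoidHom.finsetSum_apply, mk_sum]
  refine Finset.sum_congr rfl fun i _ ↦ ?_
  rw [brTerm_single, mk_single, gpt_gbr_mk]

lemma pairTerm_psum (hU : V ≤ f.preim U) {k l : ℕ} (g : Fin k → Y.O K V) (q : Fin k → M.sec U)
    (h : Fin l → Y.O K V) (p : Fin l → M.sec U) :
    pairTerm (D.gpair f) (psum f hU g q) (psum f hU h p) =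
      ∑ i, ∑ j, g i * h j * f.pullO K hU (D.pair (q i) (p j)) := by
  rw [psum, psum, map_sum, Finset.sum_comm]
  refine Finset.sum_congr rfl fun j _ ↦ ?_
  rw [map_sum, AddMonoidHom.finsetSum_apply]
  refine Finset.sum_congr rfl fun i _ ↦ ?_
  rw [pairTerm_single, gpair_mk]

/-- Opens of X whose preimage contains V are stable under intersection, so finitely many terms can
be moved to a common one. Arbitrary elements thus acquire the shape in which the formulas for
brackets and pairings are stated. -/
lemma exists_pullSum (s : PSec f M V) : ∃ (U : Opens X) (hU : V ≤ f.preim U) (k : ℕ)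
    (g : Fin k → Y.O K V) (q : Fin k → M.sec U), s = pullSum f hU g q := by
  induction s using Pull.induct with
  | zero => exact ⟨⊤, fun _ _ ↦ trivial, 0, Fin.elim0, Fin.elim0, by simp [pullSum]⟩
  | add s t hs ht =>
    obtain ⟨U, hU, k, g, q, rfl⟩ := hs
    obtain ⟨U', hU', k', g', q', rfl⟩ := ht
    refine ⟨U ⊓ U', le_preim_inf hU hU', k + k', Fin.append g g',
      Fin.append (fun i ↦ M.res inf_le_left (q i)) (fun i ↦ M.res inf_le_right (q' i)), ?_⟩
    simp only [pullSum, Fin.sum_univ_add, Fin.append_left, Fin.append_right]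
    congr 1
    · exact Finset.sum_congr rfl fun i _ ↦ by rw [pure_res (le_preim_inf hU hU') _ hU]
    · exact Finset.sum_congr rfl fun i _ ↦ by rw [pure_res (le_preim_inf hU hU') _ hU']
  | smul h g q => exact ⟨_, h, 1, fun _ ↦ g, fun _ ↦ q, by simp [pullSum]⟩

lemma exists_pullSum₂ (s t : PSec f M V) : ∃ (U : Opens X) (hU : V ≤ f.preim U) (k l : ℕ)
    (g : Fin k → Y.O K V) (q : Fin k → M.sec U) (h : Fin l → Y.O K V) (p : Fin l → M.sec U),
    s = pullSum f hU g q ∧ t = pullSum f hU h p := by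
  obtain ⟨U, hU, k, g, q, rfl⟩ := exists_pullSum f s
  obtain ⟨U', hU', l, h, p, rfl⟩ := exists_pullSum f t
  refine ⟨U ⊓ U', le_preim_inf hU hU', k, l, g, fun i ↦ M.res inf_le_left (q i), h,
    fun i ↦ M.res inf_le_right (p i), ?_, ?_⟩
  · exact Finset.sum_congr rfl fun i _ ↦ by rw [pure_res (le_preim_inf hU hU') _ hU]
  · exact Finset.sum_congr rfl fun i _ ↦ by rw [pure_res (le_preim_inf hU hU') _ hU']

variable [Fact (∞ ≤ n)]

lemma act_psum (ξ : (tangentSheaf K Y).sec V) (hU : V ≤ f.preim U) {k : ℕ} (g : Fin k → Y.O K V)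
    (q : Fin k → M.sec U) :
    (cartan K Y V).act ξ (psum f hU g q) = psum f hU (fun i ↦ VF.app ξ (g i)) q := by
  rw [psum, map_sum]
  exact Finset.sum_congr rfl fun i _ ↦ act_single _ _ _ _

lemma formTerm_psum (hU : V ≤ f.preim U) {k l : ℕ} (g : Fin k → Y.O K V) (q : Fin k → M.sec U)
    (h : Fin l → Y.O K V) (p : Fin l → M.sec U) :
    (cartan K Y V).formTerm (D.gpair f) (psum f hU g q) (psum f hU h p) =
      ∑ i, ∑ j, (h j * f.pullO K hU (D.pair (q i) (p j))) • dHom K Y V (g i) := by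
  rw [psum, psum, map_sum, Finset.sum_comm]
  refine Finset.sum_congr rfl fun j _ ↦ ?_
  rw [map_sum, AddMonoidHom.finsetSum_apply]
  refine Finset.sum_congr rfl fun i _ ↦ ?_
  rw [formTerm_single, gpair_mk]
  rfl

lemma mk_tbr_psum (hU : V ≤ f.preim U) {k l : ℕ} (α β : (formSheaf K Y).sec V)
    (ξ η : (tangentSheaf K Y).sec V) (g : Fin k → Y.O K V) (q : Fin k → M.sec U)
    (h : Fin l → Y.O K V) (p : Fin l → M.sec U) :
    (Submodule.Quotient.mk (D.tbr f (α, psum f hU g q, ξ) (β, psum f hU h p, η)).2.1 : PSec f M V) =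
      (∑ i, ∑ j, (g i * h j) • Pull.pure f M hU (D.br (q i) (p j))) +
        pullSum f hU (fun j ↦ VF.app ξ (h j)) p - pullSum f hU (fun i ↦ VF.app η (g i)) q := by
  rw [← mk_brTerm_psum, ← mk_psum, ← mk_psum, ← act_psum, ← act_psum, ← Submodule.Quotient.mk_add,
    ← Submodule.Quotient.mk_sub]
  rfl

/-- Since `tnull` is a submodule, it contains the span of the tensor relations as soon as it
contains each of them. -/
lemma mem_tnull_of_mk_eq_zero {N : Type*} [AddCommGroup N] [Module (Y.O K V) N]
    (jΩ : (formSheaf K Y).sec V →ₗ[Y.O K V] N) (jP : PSec f M V →ₗ[Y.O K V] N)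
    (hsw : ∀ q p : Gen f M V, jP (gpt f M (D.gbr f q p)) +
      jP (gpt f M (D.gbr f p q)) = jΩ (dHom K Y V (D.gpair f q p))) {v : Triple f M V}
    (hv : v ∈ raw f D.anchor V) {c : Gen f M V →₀ Y.O K V}
    (hc : (Submodule.Quotient.mk c : PSec f M V) = 0) :
    ((0 : (formSheaf K Y).sec V), c) ∈ D.tnull f jΩ jP v := by
  have h : Submodule.span (Y.O K V) {c | Rel f M V c} ≤
      (D.tnull f jΩ jP v).comap (LinearMap.inr _ _ _) :=
    Submodule.span_le.2 fun c hc ↦ D.rel_mem_tnull f jΩ jP hsw hv hc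
  exact h ((Submodule.Quotient.mk_eq_zero _).1 hc)

end PairedBracket

/-! ### The inverse image of a Lie algebroid -/

section Lie

variable {𝕜 : Type} [RCLike 𝕜] {n : WithTop ℕ∞} {K : Type} [RCLike K] [NormedAlgebra 𝕜 K]
variable {X Y : Mfd.{u} 𝕜 n} (f : Mfd.Hom Y X) {A : OMod K X} (L : LieStr A)

open CartanCalculus PairedBracket

/-- The presentation of `f^+A` by triples. -/
def plusPres (σ : OMod.Hom A (tangentSheaf K X)) : (rawMod f σ).Pres (plus f σ) :=
  PreMod.presOfSurjective (P' := prePlus f σ)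
    (fun V ↦ ((toPair f A V).comp (raw f σ V).subtype).codRestrict (plusSub f σ V) fun u ↦ u.2)
    (fun k u ↦ Subtype.ext (Prod.ext (mk_xres f k u.1.2.1) rfl))
    (fun V t ↦ by
      obtain ⟨⟨s, ξ⟩, ht⟩ := t
      obtain ⟨x, rfl⟩ := Submodule.Quotient.mk_surjective _ s
      exact ⟨⟨(0, x, ξ), ht⟩, rfl⟩)

lemma plusPres_app {σ : OMod.Hom A (tangentSheaf K X)} {V : Opens Y} {u : Triple f A V}
    (hu : u ∈ raw f σ V) :
    (plusPres f σ).app V ⟨u, hu⟩ = plusMk f σ (Submodule.Quotient.mk u.2.1) u.2.2 hu := rfl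

/-- Two sections of the presheaf have the same germ precisely when they agree after shrinking. -/
lemma plusMk_eq_zero_iff {σ : OMod.Hom A (tangentSheaf K X)} {V : Opens Y} {s : PSec f A V}
    {ξ : (tangentSheaf K Y).sec V} (hs : (s, ξ) ∈ plusSub f σ V) :
    plusMk f σ s ξ hs = 0 ↔ ∀ y ∈ V, ∃ (W : Opens Y) (h : W ≤ V), y ∈ W ∧
      Pull.res f A h s = 0 ∧ (tangentSheaf K Y).res h ξ = 0 := by
  have h0 : ∀ W, (prePlus f σ).toSheaf (0 : (prePlus f σ).sec W) = 0 := fun W ↦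
    Subtype.ext (funext fun y ↦ (prePlus f σ).germ_zero y.2)
  constructor
  · intro h y hy
    obtain ⟨W, h, hyW, e⟩ := (prePlus f σ).exists_res_eq_of_toSheaf_eq (h.trans (h0 V).symm) hy
    rw [map_zero] at e
    have e' := congrArg Subtype.val e
    exact ⟨W, h, hyW, congrArg Prod.fst e', congrArg Prod.snd e'⟩
  · intro h
    refine (plus f σ).sep _ _ fun y hy ↦ ?_
    obtain ⟨W, h, hyW, e1, e2⟩ := h y hy
    refine ⟨W, h, hyW, ?_⟩
    refine ((prePlus f σ).toSheaf_res h _).symm.trans (Eq.trans ?_ (map_zero _).symm)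
    exact (congrArg (prePlus f σ).toSheaf (Subtype.ext (Prod.ext e1 e2))).trans (h0 W)

variable [Fact (∞ ≤ n)]

lemma LieStr.gpt_gbr_swap {V : Opens Y} (q p : Gen f A V) :
    gpt f A (L.toPaired.gbr f q p) + gpt f A (L.toPaired.gbr f p q) = 0 := by
  have hW : V ≤ f.preim (q.1.1 ⊓ p.1.1) := le_preim_inf q.1.2 p.1.2
  have h1 : q.1.1 ⊓ p.1.1 ≤ (L.toPaired.gbr f q p).1.1 := le_rfl
  have h2 : q.1.1 ⊓ p.1.1 ≤ (L.toPaired.gbr f p q).1.1 := le_inf inf_le_right inf_le_left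
  rw [gpt_eq f hW h1, gpt_eq f hW h2, gbr_res f _ inf_le_left inf_le_right,
    gbr_res f _ inf_le_right inf_le_left, ← pure_add]
  refine (congrArg _ (L.br_swap _ _)).trans ?_
  have := pure_smul hW 0 (0 : A.sec (q.1.1 ⊓ p.1.1))
  rwa [zero_smul, map_zero, zero_smul] at this

/-- The model of `f^+A`. -/
def lieModel : TripleModel f L.toPaired (plus f L.anchor) where
  N V := PSec f A V
  -- f^+A has no component in forms. With the zero map, the swap identity reduces to antisymmetry of
  -- the bracket.
  jΩ V := 0
  jP V := LinearMap.id
  swap q p := L.gpt_gbr_swap f q p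
  θ := plusPres f L.anchor
  θ_eq_zero {V} u hu h h' := by
    rw [tcls_eq] at h
    refine (plusPres_app f hu).trans ((plusMk_eq_zero_iff f _).2 fun y hy ↦
      ⟨V, le_rfl, hy, ?_, ?_⟩)
    · refine (congrArg _ ((zero_add _).symm.trans h)).trans (map_zero _)
    · exact (congrArg _ h').trans (map_zero _)
  local_eq_zero {V} u hu h y hy := by
    obtain ⟨W, k, hyW, e1, e2⟩ := (plusMk_eq_zero_iff f _).1 h y hy
    refine ⟨W, k, hyW, ?_, e2⟩
    rw [tcls_eq]
    exact (zero_add _).trans ((mk_xres f k u.2.1).trans e1)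
  null {V} u v hv h := by
    rw [tcls_eq] at h
    have h1 : ((0 : (formSheaf K Y).sec V), u.2.1) ∈
        L.toPaired.tnull f (0 : _ →ₗ[Y.O K V] PSec f A V) LinearMap.id v :=
      mem_tnull_of_mk_eq_zero f _ _ _ (L.gpt_gbr_swap f) hv ((zero_add _).symm.trans h)
    have h2 : (u.1, (0 : Gen f A V →₀ Y.O K V)) ∈
        L.toPaired.tnull f (0 : _ →ₗ[Y.O K V] PSec f A V) LinearMap.id v := by
      refine ⟨?_, fun γ ↦ smul_zero _, rfl, ?_⟩
      · refine (tcls_eq f _ _ _).trans ?_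
        exact (zero_add _).trans rfl
      · refine (tcls_eq f _ _ _).trans ((zero_add _).trans ?_)
        have e : (cartan K Y V).act 0 v.2.1 = 0 := by ext q; simp [act]
        simp only [br₃, map_zero, AddMonoidHom.zero_apply, e, zero_add, sub_zero,
          Submodule.Quotient.mk_zero]
    have := add_mem h2 h1
    rwa [Prod.mk_add_mk, add_zero, zero_add] at this

/-- The Lie algebroid structure on `f^+A`. -/
def plusLie : LieStr (plus f L.anchor) where
  anchor := (lieModel f L).anchor
  br := (lieModel f L).br
  res_br := (lieModel f L).res_br
  add_br := (lieModel f L).add_br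
  br_add := (lieModel f L).br_add
  const_br := (lieModel f L).const_br
  br_const := (lieModel f L).br_const
  br_self {V} a := (plus f L.anchor).sep _ _ fun y hy ↦ by
    obtain ⟨W, h, u, hu, hyW, e⟩ := (lieModel f L).exists_sct a hy
    refine ⟨W, h, hyW, ?_⟩
    rw [TripleModel.res_br, ← e, TripleModel.br_sct, map_zero]
    have h1 : tcls f ((lieModel f L).jΩ W) ((lieModel f L).jP W) (L.toPaired.tbr f u u) = 0 := by
      have h2 := (lieModel f L).tcls_tbr_swap u u
      have h3 : (lieModel f L).jΩ W (dHom K Y W (L.toPaired.tpr f u u)) = 0 := rfl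
      rw [h3] at h2
      generalize tcls f ((lieModel f L).jΩ W) ((lieModel f L).jP W) (L.toPaired.tbr f u u) = z at h2
      -- The swap identity only says that twice the class is zero; multiplication by the constant
      -- function 1/2 finishes.
      have h4 : Mfd.const W (2 : K)⁻¹ • (z + z) = z := by
        have h5 : Mfd.const (X := Y) W (2 : K)⁻¹ + Mfd.const W (2 : K)⁻¹ = 1 := O_ext fun x ↦ by
          change (2 : K)⁻¹ + (2 : K)⁻¹ = 1
          rw [← two_mul, mul_inv_cancel₀ two_ne_zero]
        rw [smul_add, ← add_smul, h5, one_smul]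
      rw [← h4, h2, smul_zero]
    refine (lieModel f L).θ_eq_zero _ _ h1 ?_
    have h5 : lieB u.2.2 u.2.2 = 0 := vf_ext fun W k g ↦ by
      rw [res_lieB, app_lieB, sub_self, map_zero]
      exact (DFunLike.congr_fun (map_zero (appHom K Y W)) g).symm
    exact h5
  jacobi := (lieModel f L).jacobi
  anchor_br := (lieModel f L).anchor_br
  leibniz a b g := ((lieModel f L).leibniz a b g).trans (add_comm _ _)

lemma plusMk_congr {σ : OMod.Hom A (tangentSheaf K X)} {V : Opens Y} {s s' : PSec f A V}
    {ξ ξ' : (tangentSheaf K Y).sec V} (hs : (s, ξ) ∈ plusSub f σ V) (e : s = s') (e' : ξ = ξ') :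
    plusMk f σ s ξ hs = plusMk f σ s' ξ' (by rw [← e, ← e']; exact hs) := by
  subst e e'; rfl

lemma plusMk_pullSum {U : Opens X} {V : Opens Y} (hU : V ≤ f.preim U) {k : ℕ}
    (g : Fin k → Y.O K V) (a : Fin k → A.sec U) (ξ : (tangentSheaf K Y).sec V)
    (hs : (pullSum f hU g a, ξ) ∈ plusSub f L.anchor V) : ∃ hu,
    plusMk f L.anchor (pullSum f hU g a) ξ hs = (lieModel f L).sct (0, psum f hU g a, ξ) hu :=
  ⟨by rw [← mk_psum] at hs; exact hs, plusMk_congr f hs (mk_psum f hU g a).symm rfl⟩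

lemma isLieInverseImage_plusLie : IsLieInverseImage f L (plusLie f L) where
  anchor_mk {V} s ξ hs := by
    obtain ⟨x, rfl⟩ := Submodule.Quotient.mk_surjective _ s
    exact (lieModel f L).anchor_sct (u := (0, x, ξ)) hs
  br_mk {U V} hU {k l} g a ξ hs h b η ht := by
    obtain ⟨hu, eu⟩ := plusMk_pullSum f L hU g a ξ hs
    obtain ⟨hv, ev⟩ := plusMk_pullSum f L hU h b η ht
    have e := mk_tbr_psum f L.toPaired hU 0 0 ξ η g a h b
    have hr := L.toPaired.tbr_mem_raw f hu hv
    refine ⟨lieB ξ η, ?_, isBracket_lieB ξ η, ?_⟩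
    · have := hr
      rw [raw, Submodule.mem_comap, toPair_apply, e] at this
      exact this
    · rw [eu, ev]
      refine ((lieModel f L).br_sct hu hv).trans ?_
      exact plusMk_congr f hr e rfl

lemma LieStr.ext_of {B B' : LieStr A} (h : B.anchor = B'.anchor)
    (h' : ∀ {V : Opens X} (a b : A.sec V), B.br a b = B'.br a b) : B = B' := by
  cases B; cases B'
  obtain rfl := h
  congr
  funext V a b
  exact h' a b

/-- Every section is locally a pair given by a finite sum over one open of X. There the formula
applies, and the field [ξ,η] occurring in it is itself unique. -/
lemma IsLieInverseImage.unique {B B' : LieStr (plus f L.anchor)} (H : IsLieInverseImage f L B)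
    (H' : IsLieInverseImage f L B') : B = B' := by
  have key : ∀ {W : Opens Y} (s : PSec f A W) (ξ : (tangentSheaf K Y).sec W) (hs)
      (t : PSec f A W) (η : (tangentSheaf K Y).sec W) (ht),
      B.br (plusMk f L.anchor s ξ hs) (plusMk f L.anchor t η ht) =
        B'.br (plusMk f L.anchor s ξ hs) (plusMk f L.anchor t η ht) := fun {W} s ξ hs t η ht ↦ by
    obtain ⟨U, hU, m, l, g, q, h, p, rfl, rfl⟩ := exists_pullSum₂ f s t
    obtain ⟨ζ, hr, hζ, e⟩ := H.br_mk hU g q ξ hs h p η ht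
    obtain ⟨ζ', hr', hζ', e'⟩ := H'.br_mk hU g q ξ hs h p η ht
    rw [e, e']
    exact plusMk_congr f _ rfl (hζ.unique hζ')
  refine LieStr.ext_of ?_ fun {V} t s ↦ (plus f L.anchor).sep _ _ fun y hy ↦ ?_
  · refine (plusPres f L.anchor).hom_ext fun V u ↦ ?_
    exact (H.anchor_mk _ _ u.2).trans (H'.anchor_mk _ _ u.2).symm
  · obtain ⟨W, k, u, v, hu, hv, hyW, eu, ev⟩ := (lieModel f L).exists_sct₂ t s hy
    refine ⟨W, k, hyW, ?_⟩
    rw [B.res_br, B'.res_br, ← eu, ← ev]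
    exact key _ _ hu _ _ hv

end Lie

section Courant

variable {𝕜 : Type} [RCLike 𝕜] {n : WithTop ℕ∞} {K : Type} [RCLike K] [NormedAlgebra 𝕜 K]
variable {X Y : Mfd.{u} 𝕜 n} (f : Mfd.Hom Y X) {Q : OMod K X} (S : CourantStr Q)

open CartanCalculus PairedBracket

/-! ### The presentation of `f^{++}Q` -/

variable {V : Opens Y}

/-- The pairs `(α, s)` such that `(α, s, 0)` vanishes in `f^{++}Q`. -/
def relSub (V : Opens Y) : Submodule (Y.O K V) ((formSheaf K Y).sec V × PSec f Q V) :=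
  (courSub f S V).map (LinearMap.prodMap LinearMap.id
    ((LinearMap.fst _ _ _).comp (plusSub f S.anchor V).subtype))

lemma snd_of_mem_courSub {t : (formSheaf K Y).sec V × plusSub f S.anchor V}
    (ht : t ∈ courSub f S V) : t.2.1.2 = 0 := by
  have h : courSub f S V ≤ LinearMap.ker (((LinearMap.snd _ _ _).comp
      (plusSub f S.anchor V).subtype).comp (LinearMap.snd (Y.O K V) _ _)) :=
    Submodule.span_le.2 fun t ht ↦ by
      obtain ⟨U, h, α, h1, h2, h3⟩ := ht
      exact h3
  exact h ht

/-- All generators of the relations have ξ = 0, so the relations can be studied among pairs (α, s)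
without the fibre product condition. -/
lemma mem_courSub_iff {t : (formSheaf K Y).sec V × plusSub f S.anchor V} :
    t ∈ courSub f S V ↔ (t.1, t.2.1.1) ∈ relSub f S V ∧ t.2.1.2 = 0 := by
  refine ⟨fun ht ↦ ⟨⟨t, ht, rfl⟩, snd_of_mem_courSub f S ht⟩, ?_⟩
  rintro ⟨⟨t', ht', e⟩, h⟩
  have h' := snd_of_mem_courSub f S ht'
  obtain ⟨α, ⟨⟨s, ξ⟩, hs⟩⟩ := t
  obtain ⟨α', ⟨⟨s', ξ'⟩, hs'⟩⟩ := t'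
  dsimp only at h h'
  subst h h'
  obtain ⟨rfl, rfl⟩ := Prod.mk.inj e
  exact ht'

/-- The presentation of `f^{++}Q` by triples. -/
def plusPlusPres : (rawMod f S.anchor).Pres (plusPlus f S) :=
  PreMod.presOfSurjective (P' := preCour f S)
    (fun V ↦ (courSub f S V).mkQ.comp ((LinearMap.fst _ _ _ ∘ₗ (raw f S.anchor V).subtype).prod
      (((toPair f Q V).comp (raw f S.anchor V).subtype).codRestrict
        (plusSub f S.anchor V) fun u ↦ u.2)))
    (fun k u ↦ congrArg Submodule.Quotient.mk
      (Prod.ext rfl (Subtype.ext (Prod.ext (mk_xres f k u.1.2.1) rfl))))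
    (fun V t ↦ by
      obtain ⟨⟨α, ⟨⟨s, ξ⟩, ht⟩⟩, rfl⟩ := Submodule.Quotient.mk_surjective _ t
      obtain ⟨x, rfl⟩ := Submodule.Quotient.mk_surjective _ s
      exact ⟨⟨(α, x, ξ), ht⟩, rfl⟩)

lemma plusPlusPres_app {u : Triple f Q V} (hu : u ∈ raw f S.anchor V) :
    (plusPlusPres f S).app V ⟨u, hu⟩ =
      courMk f S u.1 (Submodule.Quotient.mk u.2.1) u.2.2 hu := rfl

lemma courMk_eq_zero_iff {α : (formSheaf K Y).sec V} {s : PSec f Q V}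
    {ξ : (tangentSheaf K Y).sec V} (hs : (s, ξ) ∈ plusSub f S.anchor V) :
    courMk f S α s ξ hs = 0 ↔ ∀ y ∈ V, ∃ (W : Opens Y) (h : W ≤ V), y ∈ W ∧
      ((formSheaf K Y).res h α, Pull.res f Q h s) ∈ relSub f S W ∧
        (tangentSheaf K Y).res h ξ = 0 := by
  have h0 : ∀ W, (preCour f S).toSheaf (0 : (preCour f S).sec W) = 0 := fun W ↦
    Subtype.ext (funext fun y ↦ (preCour f S).germ_zero y.2)
  constructor
  · intro h y hy
    obtain ⟨W, h, hyW, e⟩ := (preCour f S).exists_res_eq_of_toSheaf_eq (h.trans (h0 V).symm) hy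
    rw [map_zero] at e
    exact ⟨W, h, hyW, (mem_courSub_iff f S).1 ((Submodule.Quotient.mk_eq_zero _).1 e)⟩
  · intro h
    refine (plusPlus f S).sep _ _ fun y hy ↦ ?_
    obtain ⟨W, h, hyW, e⟩ := h y hy
    refine ⟨W, h, hyW, ?_⟩
    refine ((preCour f S).toSheaf_res h _).symm.trans (Eq.trans ?_ (map_zero _).symm)
    refine (congrArg (preCour f S).toSheaf ?_).trans (h0 W)
    exact (Submodule.Quotient.mk_eq_zero _).2 ((mem_courSub_iff f S).2 e)

lemma courMk_congr {α α' : (formSheaf K Y).sec V} {s s' : PSec f Q V}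
    {ξ ξ' : (tangentSheaf K Y).sec V} (hs : (s, ξ) ∈ plusSub f S.anchor V) (e₀ : α = α')
    (e : s = s') (e' : ξ = ξ') : courMk f S α s ξ hs =
      courMk f S α' s' ξ' (by rw [← e, ← e']; exact hs) := by
  subst e₀ e e'; rfl

variable [Fact (∞ ≤ n)]

lemma coanchor_mem_plusSub {U : Opens X} (h : V ≤ f.preim U) (α : (formSheaf K X).sec U) :
    (-Pull.pure f Q h (S.coanchor.app U α), (0 : (tangentSheaf K Y).sec V)) ∈
      plusSub f S.anchor V := fun y ↦ by
  change anchorAt S.anchor y (-Pull.pure f Q h (S.coanchor.app U α)) = f.push K y 0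
  rw [map_neg, anchorAt_pure, S.anchor_coanchor, map_zero]
  exact neg_zero

lemma pullForm_mem_relSub {U : Opens X} (h : V ≤ f.preim U) (α : (formSheaf K X).sec U) :
    (f.pullForm h α, -Pull.pure f Q h (S.coanchor.app U α)) ∈ relSub f S V := by
  have e : (f.pullForm h α, ⟨(_, 0), coanchor_mem_plusSub f S h α⟩) ∈ courSub f S V :=
    Submodule.subset_span ⟨U, h, α, (isFormPullback_iff f h _ _).2 rfl, rfl, rfl⟩
  exact ⟨_, e, rfl⟩

lemma relSub_le {P : Submodule (Y.O K V) ((formSheaf K Y).sec V × PSec f Q V)}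
    (hP : ∀ {U : Opens X} (h : V ≤ f.preim U) (α : (formSheaf K X).sec U),
      (f.pullForm h α, -Pull.pure f Q h (S.coanchor.app U α)) ∈ P) : relSub f S V ≤ P := by
  refine Submodule.map_le_iff_le_comap.2 (Submodule.span_le.2 ?_)
  rintro ⟨β, t⟩ ⟨U, h, α, h1, h2, h3⟩
  obtain rfl := (isFormPullback_iff f h _ _).1 h1
  have := hP h α
  rwa [← h2] at this

/-- The quotient of `Ω¹_Y(V) × f^*Q(V)` by the image of `f^*Ω¹_X`. -/
abbrev RelQuot (V : Opens Y) : Type u := ((formSheaf K Y).sec V × PSec f Q V) ⧸ relSub f S V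

/-- The map from forms to the quotient. -/
def relForm (V : Opens Y) : (formSheaf K Y).sec V →ₗ[Y.O K V] RelQuot f S V :=
  (relSub f S V).mkQ.comp (LinearMap.inl _ _ _)

/-- The map from `f^*Q` to the quotient. -/
def relSec (V : Opens Y) : PSec f Q V →ₗ[Y.O K V] RelQuot f S V :=
  (relSub f S V).mkQ.comp (LinearMap.inr _ _ _)

lemma relForm_add_relSec (α : (formSheaf K Y).sec V) (s : PSec f Q V) :
    relForm f S V α + relSec f S V s = Submodule.Quotient.mk (α, s) := by
  refine (map_add (relSub f S V).mkQ (α, 0) (0, s)).symm.trans ?_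
  rw [Prod.mk_add_mk, add_zero, zero_add]
  rfl

lemma relSec_coanchor {U : Opens X} (h : V ≤ f.preim U) (α : (formSheaf K X).sec U) :
    relSec f S V (Pull.pure f Q h (S.coanchor.app U α)) = relForm f S V (f.pullForm h α) := by
  have := (Submodule.Quotient.mk_eq_zero _).2 (pullForm_mem_relSub f S h α)
  rw [← relForm_add_relSec, map_neg, add_neg_eq_zero] at this
  exact this.symm

/-- The symmetrised bracket in Q is π†d⟨q,p⟩. The relations identify 1 ⊗ π†α with f^*α, and f^*
commutes with d on functions. -/
lemma relSec_gbr_swap (q p : Gen f Q V) : relSec f S V (gpt f Q (S.toPaired.gbr f q p)) +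
    relSec f S V (gpt f Q (S.toPaired.gbr f p q)) =
      relForm f S V (dHom K Y V (S.toPaired.gpair f q p)) := by
  have hW : V ≤ f.preim (q.1.1 ⊓ p.1.1) := le_preim_inf q.1.2 p.1.2
  have h1 : q.1.1 ⊓ p.1.1 ≤ (S.toPaired.gbr f q p).1.1 := le_rfl
  have h2 : q.1.1 ⊓ p.1.1 ≤ (S.toPaired.gbr f p q).1.1 := le_inf inf_le_right inf_le_left
  rw [gpt_eq f hW h1, gpt_eq f hW h2, gbr_res f _ inf_le_left inf_le_right,
    gbr_res f _ inf_le_right inf_le_left, ← map_add, ← pure_add]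
  refine (congrArg (fun z ↦ relSec f S V (Pull.pure f Q hW z)) (S.br_add_br_swap _ _)).trans ?_
  refine (relSec_coanchor f S hW _).trans (congrArg _ ?_)
  exact pullForm_d f hW _

/-! ### Vanishing of brackets and pairings with the relations -/

/-- Since ⟨π†α, p⟩ = α(π(p)), the sum is α at f(y) evaluated on the anchor of v, which is df(η) in
the fibre product. -/
lemma pairTerm_coanchor {U : Opens X} (h : V ≤ f.preim U) (α : (formSheaf K X).sec U)
    {v : Triple f Q V} (hv : v ∈ raw f S.anchor V) :
    pairTerm (S.toPaired.gpair f) (Finsupp.single ⟨⟨U, h⟩, S.coanchor.app U α⟩ 1) v.2.1 =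
      Form.contract v.2.2 (f.pullForm h α) := by
  have key : ∀ (x : Gen f Q V →₀ Y.O K V) (y : V), (pairTerm (S.toPaired.gpair f)
      (Finsupp.single ⟨⟨U, h⟩, S.coanchor.app U α⟩ 1) x).1 y =
        α.1 ⟨f y, h y.2⟩ (anchorAt S.anchor y (Submodule.Quotient.mk x)) := fun x y ↦ by
    induction x using Finsupp.induction_linear with
    | zero => rw [map_zero, Submodule.Quotient.mk_zero, map_zero, map_zero]; rfl
    | add x z hx hz =>
      rw [map_add, Submodule.Quotient.mk_add, map_add, map_add, ← hx, ← hz]; rfl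
    | single p b =>
      rw [pairTerm_single, mk_single, map_smulₛₗ, map_smul, gpt, anchorAt_pure, one_mul]
      refine congrArg (b.1 y * ·) ?_
      have e : S.pair (Q.res (inf_le_left : U ⊓ p.1.1 ≤ U) (S.coanchor.app U α))
          (Q.res (inf_le_right : U ⊓ p.1.1 ≤ p.1.1) p.2) = Form.contract
            (S.anchor.app _ (Q.res (inf_le_right : U ⊓ p.1.1 ≤ p.1.1) p.2))
              ((formSheaf K X).res inf_le_left α) := by
        rw [← S.coanchor.naturality, S.pair_symm, S.pair_coanchor]
      have hW : V ≤ f.preim (U ⊓ p.1.1) := le_preim_inf h p.1.2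
      refine (congrFun (congrArg Subtype.val (congrArg (f.pullO K hW) e)) y).trans ?_
      rw [S.anchor.naturality]
      rfl
  refine O_ext fun y ↦ (key _ y).trans ?_
  rw [(mem_raw f).1 hv y]
  rfl

/-- The symmetrised bracket is π†d(ι_{π(p)} α) and the opposite bracket is π†(L_{π(p)} α); Cartan's
formula gives the difference. -/
lemma br_coanchor_left {U : Opens X} (α : (formSheaf K X).sec U) (p : Q.sec U) :
    S.br (S.coanchor.app U α) p = -S.coanchor.app U (ctrD (S.anchor.app U p) α) := by
  have h1 := S.br_add_br_swap (S.coanchor.app U α) p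
  rw [S.br_coanchor p α _ (isLieDeriv_lieD _ _), S.pair_symm, S.pair_coanchor] at h1
  rw [ctrD_eq, map_sub, neg_sub, eq_sub_iff_add_eq]
  exact h1

/-- For any formal sum ∑ b_j ⊗ p_j the bracket is minus the class of the form β = ∑ b_j
f^*(ι_{π(p_j)} dα), whose value at y depends on the sum only through its anchor. In the fibre
product the anchor is df(η), and naturality of d identifies β with ι_η d(f^*α). -/
lemma brTerm_coanchor {U : Opens X} (h : V ≤ f.preim U) (α : (formSheaf K X).sec U)
    {v : Triple f Q V} (hv : v ∈ raw f S.anchor V) :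
    relSec f S V (Submodule.Quotient.mk (brTerm (S.toPaired.gbr f)
      (Finsupp.single ⟨⟨U, h⟩, S.coanchor.app U α⟩ 1) v.2.1)) =
        -relForm f S V (ctrD v.2.2 (f.pullForm h α)) := by
  have key : ∀ x : Gen f Q V →₀ Y.O K V, ∃ β : (formSheaf K Y).sec V,
      relSec f S V (Submodule.Quotient.mk (brTerm (S.toPaired.gbr f)
        (Finsupp.single ⟨⟨U, h⟩, S.coanchor.app U α⟩ 1) x)) = -relForm f S V β ∧
      ∀ (y : V) (w : Y.Tan K y), β.1 y w = twoForm α (f y)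
        (anchorAt S.anchor y (Submodule.Quotient.mk x)) (f.push K y w) := fun x ↦ by
    induction x using Finsupp.induction_linear with
    | zero =>
      refine ⟨0, by simp, fun y w ↦ ?_⟩
      rw [Submodule.Quotient.mk_zero, map_zero, map_zero]
      rfl
    | add x z hx hz =>
      obtain ⟨β, hβ, hβ'⟩ := hx
      obtain ⟨γ, hγ, hγ'⟩ := hz
      refine ⟨β + γ, ?_, fun y w ↦ ?_⟩
      · rw [map_add, Submodule.Quotient.mk_add, map_add, hβ, hγ, map_add, neg_add]
      · rw [Submodule.Quotient.mk_add, map_add, map_add, LinearMap.add_apply, ← hβ', ← hγ']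
        rfl
    | single p b =>
      have hW : V ≤ f.preim (U ⊓ p.1.1) := le_preim_inf h p.1.2
      refine ⟨b • f.pullForm hW (ctrD (S.anchor.app _ (Q.res inf_le_right p.2))
        ((formSheaf K X).res inf_le_left α)), ?_, fun y w ↦ ?_⟩
      · have e : gpt f Q (S.toPaired.gbr f ⟨⟨U, h⟩, S.coanchor.app U α⟩ p) =
            -Pull.pure f Q hW (S.coanchor.app _ (ctrD (S.anchor.app _ (Q.res inf_le_right p.2))
              ((formSheaf K X).res inf_le_left α))) := by
          have e1 : S.br (Q.res (inf_le_left : U ⊓ p.1.1 ≤ U) (S.coanchor.app U α))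
              (Q.res inf_le_right p.2) = -S.coanchor.app _ (ctrD (S.anchor.app _
                (Q.res inf_le_right p.2)) ((formSheaf K X).res inf_le_left α)) := by
            rw [← S.coanchor.naturality, br_coanchor_left]
          refine (congrArg (Pull.pure f Q hW) e1).trans ?_
          rw [eq_neg_iff_add_eq_zero, ← pure_add, neg_add_cancel]
          have := pure_smul hW 0 (0 : Q.sec (U ⊓ p.1.1))
          rwa [zero_smul, map_zero, zero_smul] at this
        rw [brTerm_single, mk_single, one_mul, e, map_smul, map_neg, relSec_coanchor, map_smul,
          smul_neg]
      · rw [mk_single, map_smulₛₗ, map_smul, LinearMap.smul_apply, gpt, anchorAt_pure]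
        refine congrArg (b.1 y * ·) ?_
        refine (ctrD_res_apply inf_le_left α _ ⟨f y, hW y.2⟩ (f.push K y w)).trans ?_
        rw [S.anchor.naturality]
        rfl
  obtain ⟨β, hβ, hβ'⟩ := key v.2.1
  rw [hβ]
  congr 2
  refine Subtype.ext (funext fun y ↦ LinearMap.ext fun w ↦ (hβ' y w).trans ?_)
  rw [(mem_raw f).1 hv y]
  exact (ctrD_pullForm f h α v.2.2 y w).symm

/-- The pairs whose pairing with `v` vanishes. -/
def pairNull (v : Triple f Q V) : Submodule (Y.O K V)
    ((formSheaf K Y).sec V × (Gen f Q V →₀ Y.O K V)) where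
  carrier := {w | Form.contract v.2.2 w.1 + pairTerm (S.toPaired.gpair f) w.2 v.2.1 = 0}
  zero_mem' := by
    change contractHom K Y V v.2.2 0 + pairTerm (S.toPaired.gpair f) 0 v.2.1 = 0
    rw [map_zero, map_zero, AddMonoidHom.zero_apply, add_zero]
  add_mem' {a b} ha hb := by
    have ha' : Form.contract v.2.2 a.1 + pairTerm (S.toPaired.gpair f) a.2 v.2.1 = 0 := ha
    have hb' : Form.contract v.2.2 b.1 + pairTerm (S.toPaired.gpair f) b.2 v.2.1 = 0 := hb
    change Form.contract v.2.2 (a.1 + b.1) + pairTerm (S.toPaired.gpair f) (a.2 + b.2) v.2.1 = 0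
    rw [contract_add, map_add, AddMonoidHom.add_apply]
    linear_combination ha' + hb'
  smul_mem' g a ha := by
    have ha' : Form.contract v.2.2 a.1 + pairTerm (S.toPaired.gpair f) a.2 v.2.1 = 0 := ha
    change Form.contract v.2.2 (g • a.1) + pairTerm (S.toPaired.gpair f) (g • a.2) v.2.1 = 0
    rw [contract_smul, smul_pairTerm]
    linear_combination g * ha'

/-- Both kinds of null elements form submodules, so the generators (f^*α, -1 ⊗ π†α) suffice; for
these the form and the section contribute opposite terms by `brTerm_coanchor` and
`pairTerm_coanchor`. `pairNull` is needed besides `tnull` because here the pairing itself must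
vanish in order to descend. -/
lemma mem_null_of_mem_relSub {v : Triple f Q V} (hv : v ∈ raw f S.anchor V)
    {w : (formSheaf K Y).sec V × (Gen f Q V →₀ Y.O K V)}
    (hw : (w.1, (Submodule.Quotient.mk w.2 : PSec f Q V)) ∈ relSub f S V) :
    w ∈ S.toPaired.tnull f (relForm f S V) (relSec f S V) v ∧ w ∈ pairNull f S v := by
  have h : relSub f S V ≤ (S.toPaired.tnull f (relForm f S V) (relSec f S V) v ⊓
      pairNull f S v).map (LinearMap.prodMap LinearMap.id (Submodule.mkQ _)) := by
    refine relSub_le f S fun {U} h α ↦ ⟨(f.pullForm h α,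
      -Finsupp.single ⟨⟨U, h⟩, S.coanchor.app U α⟩ 1), ?_, ?_⟩
    · have h2 : Form.contract v.2.2 (f.pullForm h α) + pairTerm (S.toPaired.gpair f)
          (-Finsupp.single ⟨⟨U, h⟩, S.coanchor.app U α⟩ 1) v.2.1 = 0 := by
        rw [map_neg, AddMonoidHom.neg_apply, pairTerm_coanchor f S h α hv, add_neg_cancel]
      refine ⟨single_mem_tnull f _ _ _ ?_ h2 ?_, h2⟩
      · rw [Submodule.Quotient.mk_neg, mk_single, one_smul, map_neg]
        exact add_neg_eq_zero.2 (relSec_coanchor f S h α).symm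
      · have h3 : (cartan K Y V).formTerm (S.toPaired.gpair f)
            (Finsupp.single ⟨⟨U, h⟩, S.coanchor.app U α⟩ 1) v.2.1 = 0 := by
          have hd : (cartan K Y V).d 1 = 0 := dHom_const 1
          induction v.2.1 using Finsupp.induction_linear with
          | zero => rw [map_zero]
          | add x z hx hz => rw [map_add, hx, hz, add_zero]
          | single p b => rw [formTerm_single, hd, smul_zero]
        have h4 : (cartan K Y V).act v.2.2
            (Finsupp.single (⟨⟨U, h⟩, S.coanchor.app U α⟩ : Gen f Q V) 1) = 0 := by
          rw [act_single]
          have : (cartan K Y V).app v.2.2 1 = 0 := Mfd.app_const v.2.2 1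
          rw [this, Finsupp.single_zero]
        dsimp only
        rw [map_neg, map_neg, map_neg, AddMonoidHom.neg_apply, AddMonoidHom.neg_apply, h3, h4,
          Submodule.Quotient.mk_neg, map_neg, brTerm_coanchor f S h α hv, neg_zero, neg_neg,
          zero_sub, map_neg, neg_add_cancel, neg_zero, Submodule.Quotient.mk_zero, map_zero, sub_zero]
    · exact Prod.ext rfl ((Submodule.Quotient.mk_neg _).trans rfl)
  obtain ⟨w', ⟨h1, h2⟩, e⟩ := h hw
  have e1 : w'.1 = w.1 := (Prod.ext_iff.1 e).1
  -- `w` and the lifted relation `w'` have the same image in the presheaf for f^*Q, so they differ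
  -- by tensor relations, which are null as well.
  have e2 : (Submodule.Quotient.mk (w.2 - w'.2) : PSec f Q V) = 0 :=
    sub_eq_zero.2 (Prod.ext_iff.1 e).2.symm
  have e3 : w = w' + (0, w.2 - w'.2) := Prod.ext (by simp [e1]) (by simp)
  have h4 : ((0 : (formSheaf K Y).sec V), w.2 - w'.2) ∈ pairNull f S v := by
    have h5 : Submodule.span (Y.O K V) {c | Rel f Q V c} ≤
        (pairNull f S v).comap (LinearMap.inr _ _ _) :=
      Submodule.span_le.2 fun c hc ↦ by
        change contractHom K Y V v.2.2 0 + pairTerm (S.toPaired.gpair f) c v.2.1 = 0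
        rw [map_zero, zero_add, S.toPaired.pairTerm_rel f hc]
    exact h5 ((Submodule.Quotient.mk_eq_zero _).1 e2)
  rw [e3]
  exact ⟨add_mem h1 (mem_tnull_of_mk_eq_zero f _ _ _ (relSec_gbr_swap f S) hv e2), add_mem h2 h4⟩

end Courant

/-! ### The Courant algebroid structure on the inverse image -/

section Courant

variable {𝕜 : Type} [RCLike 𝕜] {n : WithTop ℕ∞} {K : Type} [RCLike K] [NormedAlgebra 𝕜 K]
variable {X Y : Mfd.{u} 𝕜 n} (f : Mfd.Hom Y X) {Q : OMod K X} (S : CourantStr Q)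
variable [Fact (∞ ≤ n)] {V W : Opens Y}

open CartanCalculus PairedBracket

lemma tcls_eq_zero_iff (u : Triple f Q V) :
    tcls f (relForm f S V) (relSec f S V) u = 0 ↔
      (u.1, (Submodule.Quotient.mk u.2.1 : PSec f Q V)) ∈ relSub f S V := by
  rw [tcls_eq, relForm_add_relSec, Submodule.Quotient.mk_eq_zero]

/-- The model of `f^{++}Q`. -/
def courantModel : TripleModel f S.toPaired (plusPlus f S) where
  N V := RelQuot f S V
  group V := Submodule.Quotient.addCommGroup _
  module V := Submodule.Quotient.module _
  jΩ V := relForm f S V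
  jP V := relSec f S V
  swap q p := relSec_gbr_swap f S q p
  θ := plusPlusPres f S
  θ_eq_zero {V} u hu h h' := by
    rw [tcls_eq_zero_iff] at h
    refine (plusPlusPres_app f S hu).trans ((courMk_eq_zero_iff f S _).2 fun y hy ↦
      ⟨V, le_rfl, hy, ?_, ?_⟩)
    · rw [PreMod.res_refl, Pull.res_refl]
      exact h
    · exact (congrArg _ h').trans (map_zero _)
  local_eq_zero {V} u hu h y hy := by
    obtain ⟨W, k, hyW, e1, e2⟩ := (courMk_eq_zero_iff f S _).1 h y hy
    refine ⟨W, k, hyW, ?_, e2⟩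
    rw [tcls_eq_zero_iff]
    exact (congrArg (fun z ↦ ((tres f Q k u).1, z) ∈ relSub f S W) (mk_xres f k u.2.1)).mpr e1
  null {V} u v hv h :=
    (mem_null_of_mem_relSub f S hv (w := (u.1, u.2.1)) ((tcls_eq_zero_iff f S u).1 h)).1

lemma tpr_eq_zero {u v : Triple f Q V} (hv : v ∈ raw f S.toPaired.anchor V)
    (hu : tcls f (relForm f S V) (relSec f S V) u = 0) (hu' : u.2.2 = 0) :
    S.toPaired.tpr f u v = 0 := by
  have h : Form.contract v.2.2 u.1 + pairTerm (S.toPaired.gpair f) u.2.1 v.2.1 = 0 :=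
    (mem_null_of_mem_relSub f S hv (w := (u.1, u.2.1)) ((tcls_eq_zero_iff f S u).1 hu)).2
  have e : contractHom K Y V u.2.2 v.1 = 0 := by rw [hu', map_zero]; rfl
  refine Eq.trans ?_ h
  change contractHom K Y V u.2.2 v.1 + Form.contract v.2.2 u.1 + _ = _
  rw [e, zero_add]

lemma tpr_symm (u v : Triple f Q V) : S.toPaired.tpr f u v = S.toPaired.tpr f v u :=
  (cartan K Y V).pr₃_symm _ (S.toPaired.gpair_symm f) u v

lemma exists_pair : ∃ pr : ∀ {V : Opens Y}, (plusPlus f S).sec V → (plusPlus f S).sec V → Y.O K V,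
    (∀ {V : Opens Y} (u v : Triple f Q V) (hu : u ∈ raw f S.toPaired.anchor V)
      (hv : v ∈ raw f S.toPaired.anchor V), pr ((courantModel f S).sct u hu) ((courantModel f S).sct v hv) = S.toPaired.tpr f u v) ∧
    ∀ {V W : Opens Y} (k : W ≤ V) (t s : (plusPlus f S).sec V),
      resO K k (pr t s) = pr ((plusPlus f S).res k t) ((plusPlus f S).res k s) := by
  have hl : ∀ {V : Opens Y} (u v : Triple f Q V) (hu : u ∈ raw f S.toPaired.anchor V)
      (hv : v ∈ raw f S.toPaired.anchor V), (courantModel f S).sct u hu = 0 →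
        S.toPaired.tpr f u v = 0 := fun {V} u v hu hv h ↦
    (structureSheaf K Y).sep (U := V) _ _ fun y hy ↦ by
      obtain ⟨W, h, hyW, e1, e2⟩ := (courantModel f S).local_eq_zero u hu h y hy
      exact ⟨W, h, hyW, (resO_tpr f S.toPaired h u v).trans
        ((tpr_eq_zero f S (tres_mem_raw f hv h) e1 e2).trans (map_zero (resO K h)).symm)⟩
  obtain ⟨pr, h1, h2⟩ := (courantModel f S).θ.exists_op (M' := structureSheaf K Y)
    (fun V ↦ AddMonoidHom.mk' (fun u ↦ AddMonoidHom.mk'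
        (fun v ↦ S.toPaired.tpr f u.1 v.1)
        (fun v w ↦ (cartan K Y V).pr₃_add _ u.1 v.1 w.1))
      (fun u v ↦ AddMonoidHom.ext fun w ↦ (cartan K Y V).add_pr₃ _ u.1 v.1 w.1))
    (fun {V W} k u v ↦ resO_tpr f S.toPaired k u.1 v.1)
    (fun {V} u v h ↦ hl u.1 v.1 u.2 v.2 h)
    (fun {V} u v h ↦ (tpr_symm f S u.1 v.1).trans (hl v.1 u.1 v.2 u.2 h))
  exact ⟨pr, fun u v hu hv ↦ h1 ⟨u, hu⟩ ⟨v, hv⟩, h2⟩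

/-- The pairing on `f^{++}Q`. -/
def plusPair (t s : (plusPlus f S).sec V) : Y.O K V := (exists_pair f S).choose t s

lemma plusPair_sct {u v : Triple f Q V} (hu : u ∈ raw f S.toPaired.anchor V)
    (hv : v ∈ raw f S.toPaired.anchor V) :
    plusPair f S ((courantModel f S).sct u hu) ((courantModel f S).sct v hv) =
      S.toPaired.tpr f u v :=
  (exists_pair f S).choose_spec.1 u v hu hv

lemma resO_plusPair (k : W ≤ V) (t s : (plusPlus f S).sec V) : resO K k (plusPair f S t s) =
    plusPair f S ((plusPlus f S).res k t) ((plusPlus f S).res k s) :=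
  (exists_pair f S).choose_spec.2 k t s

lemma form_mem_raw (β : (formSheaf K Y).sec V) :
    ((β, 0, 0) : Triple f Q V) ∈ raw f S.toPaired.anchor V := fun y ↦ by
  change anchorAt S.anchor y 0 = f.push K y 0
  rw [map_zero, map_zero]

/-- The co-anchor of `f^{++}Q`. -/
def plusCoanchor : OMod.Hom (formSheaf K Y) (plusPlus f S) where
  app V :=
    { toFun := fun β ↦ (courantModel f S).sct (β, 0, 0) (form_mem_raw f S β)
      map_add' := fun β γ ↦ by
        rw [← TripleModel.sct_add]
        exact (courantModel f S).sct_congr _ _ (congrArg _ (Prod.ext rfl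
          (Prod.ext (add_zero _).symm (add_zero _).symm))) (add_zero _).symm
      map_smul' := fun g β ↦ by
        rw [RingHom.id_apply, ← TripleModel.sct_smul]
        exact (courantModel f S).sct_congr _ _ (congrArg _ (Prod.ext rfl
          (Prod.ext (smul_zero _).symm (smul_zero _).symm))) (smul_zero _).symm }
  naturality {V W} k β := by
    refine Eq.trans ?_ ((courantModel f S).res_sct k (form_mem_raw f S β)).symm
    exact (courantModel f S).sct_congr _ _ (congrArg _ (Prod.ext rfl
      (Prod.ext (map_zero _).symm (map_zero _).symm))) (map_zero _).symm

lemma plusCoanchor_app (β : (formSheaf K Y).sec V) : (plusCoanchor f S).app V β =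
    (courantModel f S).sct (β, 0, 0) (form_mem_raw f S β) := rfl

/-- The Courant algebroid structure on `f^{++}Q`. -/
def plusCourant : CourantStr (plusPlus f S) where
  br := (courantModel f S).br
  anchor := (courantModel f S).anchor
  pair := plusPair f S
  coanchor := plusCoanchor f S
  res_br := (courantModel f S).res_br
  add_br := (courantModel f S).add_br
  br_add := (courantModel f S).br_add
  const_br := (courantModel f S).const_br
  br_const := (courantModel f S).br_const
  jacobi := (courantModel f S).jacobi
  anchor_br := (courantModel f S).anchor_br
  res_pair := resO_plusPair f S
  pair_symm {V} t s := (structureSheaf K Y).sep (U := V) _ _ fun y hy ↦ by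
    obtain ⟨W, h, u, v, hu, hv, hyW, eu, ev⟩ := (courantModel f S).exists_sct₂ t s hy
    refine ⟨W, h, hyW, ?_⟩
    change resO K h _ = resO K h _
    rw [resO_plusPair, resO_plusPair, ← eu, ← ev, plusPair_sct, plusPair_sct, tpr_symm]
  add_pair {V} t s r := (structureSheaf K Y).sep (U := V) _ _ fun y hy ↦ by
    obtain ⟨W, h, u, v, w, hu, hv, hw, hyW, eu, ev, ew⟩ := (courantModel f S).exists_sct₃ t s r hy
    refine ⟨W, h, hyW, ?_⟩
    change resO K h _ = resO K h (_ + _)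
    rw [map_add, resO_plusPair, resO_plusPair, resO_plusPair, map_add, ← eu, ← ev, ← ew,
      ← TripleModel.sct_add, plusPair_sct, plusPair_sct, plusPair_sct]
    exact (cartan K Y W).add_pr₃ _ u v w
  smul_pair {V} g t s := (structureSheaf K Y).sep (U := V) _ _ fun y hy ↦ by
    obtain ⟨W, h, u, v, hu, hv, hyW, eu, ev⟩ := (courantModel f S).exists_sct₂ t s hy
    refine ⟨W, h, hyW, ?_⟩
    change resO K h _ = resO K h (_ * _)
    rw [map_mul, resO_plusPair, resO_plusPair, PreMod.res_smul, ← eu, ← ev,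
      ← TripleModel.sct_smul, plusPair_sct, plusPair_sct]
    exact (cartan K Y W).smul_pr₃ _ _ u v
  anchor_coanchor α := (courantModel f S).anchor_sct (form_mem_raw f S α)
  leibniz := (courantModel f S).leibniz
  invariance {V} t s r := (structureSheaf K Y).sep (U := V) _ _ fun y hy ↦ by
    obtain ⟨W, h, u, v, w, hu, hv, hw, hyW, eu, ev, ew⟩ := (courantModel f S).exists_sct₃ t s r hy
    refine ⟨W, h, hyW, ?_⟩
    change resO K h (_ + _) = resO K h _
    rw [map_add, resO_app, resO_plusPair, resO_plusPair, resO_plusPair, TripleModel.res_br,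
      TripleModel.res_br, ← (courantModel f S).anchor.naturality, ← eu, ← ev, ← ew,
      TripleModel.br_sct, TripleModel.br_sct, plusPair_sct, plusPair_sct, plusPair_sct,
      TripleModel.anchor_sct]
    exact (cartan K Y W).pr₃_br₃ (S.toPaired.gpair_symm f) u v w (S.toPaired.app_gpair f hu)
  br_coanchor {V} t α β H := (plusPlus f S).sep _ _ fun y hy ↦ by
    obtain ⟨W, h, u, hu, hyW, eu⟩ := (courantModel f S).exists_sct t hy
    refine ⟨W, h, hyW, ?_⟩
    rw [TripleModel.res_br, ← (plusCoanchor f S).naturality, ← (plusCoanchor f S).naturality,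
      H.eq_lieD, res_lieD, ← (courantModel f S).anchor.naturality, ← eu, TripleModel.anchor_sct,
      plusCoanchor_app, plusCoanchor_app, TripleModel.br_sct]
    refine (courantModel f S).sct_congr _ _ (congrArg _ ?_) (map_zero ((cartan K Y W).bra u.2.2))
    refine Prod.ext ?_ (Prod.ext ?_ (map_zero ((cartan K Y W).bra u.2.2)))
    · have e : (cartan K Y W).ctr 0 u.1 = 0 := by
        have := (cartan K Y W).smul_ctr 0 0 u.1
        rwa [zero_smul, zero_smul] at this
      simp only [tbr, br₃, map_zero, add_zero, e, neg_zero, zero_add]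
      rfl
    · have e : (cartan K Y W).act 0 u.2.1 = 0 := by ext q; simp [act]
      simp only [tbr, br₃, map_zero, add_zero, e, sub_zero]
  pair_coanchor {V} t α := (structureSheaf K Y).sep (U := V) _ _ fun y hy ↦ by
    obtain ⟨W, h, u, hu, hyW, eu⟩ := (courantModel f S).exists_sct t hy
    refine ⟨W, h, hyW, ?_⟩
    change resO K h _ = resO K h _
    rw [resO_plusPair, resO_contract, ← (plusCoanchor f S).naturality,
      ← (courantModel f S).anchor.naturality, ← eu, TripleModel.anchor_sct, plusCoanchor_app,
      plusPair_sct]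
    simp only [tpr, pr₃, map_zero, LinearMap.zero_apply, add_zero]
    rfl
  br_add_br_swap {V} t s := (plusPlus f S).sep _ _ fun y hy ↦ by
    obtain ⟨W, h, u, v, hu, hv, hyW, eu, ev⟩ := (courantModel f S).exists_sct₂ t s hy
    refine ⟨W, h, hyW, ?_⟩
    have e : (formSheaf K Y).res h (dHom K Y V (plusPair f S t s)) =
        dHom K Y W (S.toPaired.tpr f u v) := by
      rw [res_dHom, resO_plusPair, ← eu, ← ev, plusPair_sct]
    refine Eq.trans ?_ ((congrArg _ e.symm).trans ((plusCoanchor f S).naturality h _))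
    rw [map_add, TripleModel.res_br, TripleModel.res_br, ← eu, ← ev, TripleModel.br_sct,
      TripleModel.br_sct, ← TripleModel.sct_add, plusCoanchor_app]
    refine (courantModel f S).sct_congr _ _ ?_ ?_
    · refine (cls_add _ _ _ _).trans (((courantModel f S).tcls_tbr_swap u v).trans ?_)
      rw [tcls_eq, Submodule.Quotient.mk_zero, map_zero, add_zero]
    · change lieB u.2.2 v.2.2 + lieB v.2.2 u.2.2 = 0
      rw [lieB_swap u.2.2, add_neg_cancel]

lemma courMk_pullSum {U : Opens X} (hU : V ≤ f.preim U) {k : ℕ} (α : (formSheaf K Y).sec V)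
    (g : Fin k → Y.O K V) (q : Fin k → Q.sec U) (ξ : (tangentSheaf K Y).sec V)
    (hs : (pullSum f hU g q, ξ) ∈ plusSub f S.anchor V) : ∃ hu,
    courMk f S α (pullSum f hU g q) ξ hs = (courantModel f S).sct (α, psum f hU g q, ξ) hu :=
  ⟨by rw [← mk_psum] at hs; exact hs, courMk_congr f S hs rfl (mk_psum f hU g q).symm rfl⟩

lemma isCourantInverseImage_plusCourant : IsCourantInverseImage f S (plusCourant f S) where
  anchor_mk {V} α s ξ hs := by
    obtain ⟨x, rfl⟩ := Submodule.Quotient.mk_surjective _ s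
    exact (courantModel f S).anchor_sct (u := (α, x, ξ)) hs
  coanchor_eq β := rfl
  pair_mk {U V} hU {k l} α g q ξ hs β h p η ht := by
    obtain ⟨hu, eu⟩ := courMk_pullSum f S hU α g q ξ hs
    obtain ⟨hv, ev⟩ := courMk_pullSum f S hU β h p η ht
    rw [eu, ev]
    refine (plusPair_sct f S hu hv).trans ?_
    exact congrArg _ (S.toPaired.pairTerm_psum f hU g q h p)
  br_mk {U V} hU {k l} α g q ξ hs β h p η ht := by
    obtain ⟨hu, eu⟩ := courMk_pullSum f S hU α g q ξ hs
    obtain ⟨hv, ev⟩ := courMk_pullSum f S hU β h p η ht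
    have e := mk_tbr_psum f S.toPaired hU α β ξ η g q h p
    have hr := S.toPaired.tbr_mem_raw f hu hv
    refine ⟨ctrD η α, lieD ξ β, lieB ξ η, ?_, isContractD_ctrD η α, isLieDeriv_lieD ξ β,
      isBracket_lieB ξ η, ?_⟩
    · have := hr
      rw [raw, Submodule.mem_comap, toPair_apply, e] at this
      exact this
    · rw [eu, ev]
      refine ((courantModel f S).br_sct hu hv).trans ?_
      exact courMk_congr f S hr (congrArg (-ctrD η α + lieD ξ β + ·)
        (S.toPaired.formTerm_psum f hU g q h p)) e rfl

lemma CourantStr.ext_of {R R' : CourantStr Q} (h : R.anchor = R'.anchor)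
    (h₀ : R.coanchor = R'.coanchor)
    (h₁ : ∀ {V : Opens X} (a b : Q.sec V), R.pair a b = R'.pair a b)
    (h₂ : ∀ {V : Opens X} (a b : Q.sec V), R.br a b = R'.br a b) : R = R' := by
  cases R; cases R'
  obtain rfl := h
  obtain rfl := h₀
  congr
  · funext V a b
    exact h₂ a b
  · funext V a b
    exact h₁ a b

/-- The forms ι_η dα and L_ξ β and the field [ξ,η] are determined by their defining properties, so
the prescribed formulas fix the pairing and the bracket on all local representatives. -/
lemma IsCourantInverseImage.unique {R R' : CourantStr (plusPlus f S)}
    (H : IsCourantInverseImage f S R) (H' : IsCourantInverseImage f S R') : R = R' := by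
  have key : ∀ {W : Opens Y} (α : (formSheaf K Y).sec W) (s : PSec f Q W)
      (ξ : (tangentSheaf K Y).sec W) (hs) (β : (formSheaf K Y).sec W)
      (t : PSec f Q W) (η : (tangentSheaf K Y).sec W) (ht),
      R.pair (courMk f S α s ξ hs) (courMk f S β t η ht) =
        R'.pair (courMk f S α s ξ hs) (courMk f S β t η ht) ∧
      R.br (courMk f S α s ξ hs) (courMk f S β t η ht) =
        R'.br (courMk f S α s ξ hs) (courMk f S β t η ht) := fun {W} α s ξ hs β t η ht ↦ by
    obtain ⟨U, hU, m, l, g, q, h, p, rfl, rfl⟩ := exists_pullSum₂ f s t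
    refine ⟨(H.pair_mk hU α g q ξ hs β h p η ht).trans (H'.pair_mk hU α g q ξ hs β h p η ht).symm,
      ?_⟩
    obtain ⟨α₁, β₁, ζ, hr, h1, h2, h3, e⟩ := H.br_mk hU α g q ξ hs β h p η ht
    obtain ⟨α₁', β₁', ζ', hr', h1', h2', h3', e'⟩ := H'.br_mk hU α g q ξ hs β h p η ht
    rw [e, e']
    refine courMk_congr f S _ ?_ rfl (h3.unique h3')
    rw [h1.eq_ctrD, h1'.eq_ctrD, h2.eq_lieD, h2'.eq_lieD]
  refine CourantStr.ext_of ?_ ?_ (fun {V} t s ↦ ?_) fun {V} t s ↦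
    (plusPlus f S).sep _ _ fun y hy ↦ ?_
  · refine (plusPlusPres f S).hom_ext fun V u ↦ ?_
    exact (H.anchor_mk _ _ _ u.2).trans (H'.anchor_mk _ _ _ u.2).symm
  · exact OMod.Hom.ext (funext fun V ↦ LinearMap.ext fun β ↦
      (H.coanchor_eq β).trans (H'.coanchor_eq β).symm)
  · refine (structureSheaf K Y).sep (U := V) _ _ fun y hy ↦ ?_
    obtain ⟨W, k, u, v, hu, hv, hyW, eu, ev⟩ := (courantModel f S).exists_sct₂ t s hy
    refine ⟨W, k, hyW, ?_⟩
    change resO K k _ = resO K k _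
    rw [R.res_pair, R'.res_pair, ← eu, ← ev]
    exact (key _ _ _ hu _ _ _ hv).1
  · obtain ⟨W, k, u, v, hu, hv, hyW, eu, ev⟩ := (courantModel f S).exists_sct₂ t s hy
    refine ⟨W, k, hyW, ?_⟩
    rw [R.res_br, R'.res_br, ← eu, ← ev]
    exact (key _ _ _ hu _ _ _ hv).2

end Courant

/-! ### Functoriality -/

section Functoriality

variable {𝕜 : Type} [RCLike 𝕜] {n : WithTop ℕ∞} {K : Type} [RCLike K] [NormedAlgebra 𝕜 K]
variable {X Y : Mfd.{u} 𝕜 n} (f : Mfd.Hom Y X) {M M' : OMod K X} (φ : OMod.Hom M M')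
variable {V W : Opens Y}

open CartanCalculus PairedBracket

/-- The map `∑ g_i ⊗ q_i ↦ ∑ g_i ⊗ φ(q_i)`. -/
def Pull.map (V : Opens Y) : PSec f M V →ₗ[Y.O K V] PSec f M' V :=
  Pull.lift (RingHom.id _) (fun {U} h q ↦ Pull.pure f M' h (φ.app U q))
    (fun h k h' q ↦ by rw [φ.naturality, pure_res])
    (fun h q q' ↦ by rw [map_add, pure_add])
    (fun h g q ↦ by rw [map_smul, pure_smul]; rfl)

lemma Pull.map_pure {U : Opens X} (h : V ≤ f.preim U) (q : M.sec U) :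
    Pull.map f φ V (Pull.pure f M h q) = Pull.pure f M' h (φ.app U q) := lift_pure ..

lemma Pull.anchorAt_map {σ : OMod.Hom M (tangentSheaf K X)} {σ' : OMod.Hom M' (tangentSheaf K X)}
    (hφ : ∀ {U : Opens X} (q : M.sec U), σ'.app U (φ.app U q) = σ.app U q) (y : V)
    (s : PSec f M V) : anchorAt σ' y (Pull.map f φ V s) = anchorAt σ y s := by
  induction s using Pull.induct with
  | zero => rw [map_zero, map_zero, map_zero]
  | add s t hs ht => rw [map_add, map_add, map_add, hs, ht]
  | smul h g q =>
    rw [map_smul, map_smulₛₗ, map_smulₛₗ, map_pure, anchorAt_pure, anchorAt_pure, hφ]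

/-- The image of a generator. -/
def gmap (q : Gen f M V) : Gen f M' V := ⟨q.1, φ.app _ q.2⟩

/-- The image of a triple. -/
def tmap (V : Opens Y) : Triple f M V →ₗ[Y.O K V] Triple f M' V :=
  LinearMap.prodMap LinearMap.id (LinearMap.prodMap (Finsupp.lmapDomain _ _ (gmap f φ)) LinearMap.id)

lemma tmap_apply (u : Triple f M V) :
    tmap f φ V u = (u.1, Finsupp.mapDomain (gmap f φ) u.2.1, u.2.2) := rfl

lemma mk_mapDomain_gmap (x : Gen f M V →₀ Y.O K V) :
    (Submodule.Quotient.mk (Finsupp.mapDomain (gmap f φ) x) : PSec f M' V) =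
      Pull.map f φ V (Submodule.Quotient.mk x) := by
  induction x using Finsupp.induction_linear with
  | zero => simp
  | add x z hx hz =>
    rw [Finsupp.mapDomain_add, Submodule.Quotient.mk_add, hx, hz, Submodule.Quotient.mk_add, map_add]
  | single q g =>
    rw [Finsupp.mapDomain_single, mk_single, mk_single, map_smul]
    exact congrArg (g • ·) (Pull.map_pure f φ q.1.2 q.2).symm

lemma tmap_mem_raw {σ : OMod.Hom M (tangentSheaf K X)} {σ' : OMod.Hom M' (tangentSheaf K X)}
    (hφ : ∀ {U : Opens X} (q : M.sec U), σ'.app U (φ.app U q) = σ.app U q) {u : Triple f M V}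
    (hu : u ∈ raw f σ V) : tmap f φ V u ∈ raw f σ' V := fun y ↦ by
  refine (congrArg (anchorAt σ' y) (mk_mapDomain_gmap f φ u.2.1)).trans ?_
  exact (Pull.anchorAt_map f φ hφ y _).trans (hu y)

lemma tres_tmap (k : W ≤ V) (u : Triple f M V) :
    tres f M' k (tmap f φ V u) = tmap f φ W (tres f M k u) := by
  refine Prod.ext rfl (Prod.ext ?_ rfl)
  change xres f M' k (Finsupp.mapDomain (gmap f φ) u.2.1) =
    Finsupp.mapDomain (gmap f φ) (xres f M k u.2.1)
  induction u.2.1 using Finsupp.induction_linear with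
  | zero => simp
  | add x z hx hz => rw [Finsupp.mapDomain_add, map_add, hx, hz, map_add, Finsupp.mapDomain_add]
  | single q g => rw [Finsupp.mapDomain_single, xres_single, xres_single, Finsupp.mapDomain_single]; rfl

lemma tmap_psum {U : Opens X} (hU : V ≤ f.preim U) {k : ℕ} (g : Fin k → Y.O K V)
    (q : Fin k → M.sec U) : Finsupp.mapDomain (gmap f φ) (psum f hU g q) =
      psum f hU g fun i ↦ φ.app U (q i) := by
  rw [psum, Finsupp.mapDomain_finsetSum, psum]
  refine Finset.sum_congr rfl fun i _ ↦ ?_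
  rw [Finsupp.mapDomain_single]
  rfl

lemma tmap_tmap {M'' : OMod K X} {ψ : OMod.Hom M' M''} {χ : OMod.Hom M M''}
    (h : ∀ {U : Opens X} (q : M.sec U), ψ.app U (φ.app U q) = χ.app U q) (u : Triple f M V) :
    tmap f ψ V (tmap f φ V u) = tmap f χ V u := by
  have e : gmap f ψ ∘ gmap f φ = (gmap f χ : Gen f M V → Gen f M'' V) :=
    funext fun q ↦ Sigma.ext rfl (heq_of_eq (h q.2))
  refine Prod.ext rfl (Prod.ext ?_ rfl)
  change Finsupp.mapDomain _ (Finsupp.mapDomain _ _) = Finsupp.mapDomain _ _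
  rw [← Finsupp.mapDomain_comp, e]

lemma tmap_id (u : Triple f M V) : tmap f (OMod.Hom.id M) V u = u :=
  Prod.ext rfl (Prod.ext Finsupp.mapDomain_id rfl)

variable [Fact (∞ ≤ n)]
variable {D : PairedBracket M} {D' : PairedBracket M'}

lemma mk_brTerm_mapDomain (hbr : ∀ {U : Opens X} (q p : M.sec U),
      φ.app U (D.br q p) = D'.br (φ.app U q) (φ.app U p)) (x z : Gen f M V →₀ Y.O K V) :
    (Submodule.Quotient.mk (brTerm (D'.gbr f) (Finsupp.mapDomain (gmap f φ) x)
      (Finsupp.mapDomain (gmap f φ) z)) : PSec f M' V) =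
        Pull.map f φ V (Submodule.Quotient.mk (brTerm (D.gbr f) x z)) := by
  induction x using Finsupp.induction_linear with
  | zero => simp
  | add x x' hx hx' =>
    rw [Finsupp.mapDomain_add, map_add, map_add, AddMonoidHom.add_apply, AddMonoidHom.add_apply,
      Submodule.Quotient.mk_add, hx, hx', Submodule.Quotient.mk_add, map_add]
  | single q g =>
    induction z using Finsupp.induction_linear with
    | zero => simp
    | add x x' hx hx' =>
      rw [Finsupp.mapDomain_add, map_add, map_add,
        Submodule.Quotient.mk_add, hx, hx', Submodule.Quotient.mk_add, map_add]
    | single p h =>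
      rw [Finsupp.mapDomain_single, Finsupp.mapDomain_single, brTerm_single, brTerm_single,
        mk_single, mk_single, map_smul]
      refine congrArg ((g * h) • ·) (Eq.trans ?_ (Pull.map_pure f φ _ _).symm)
      refine congrArg (Pull.pure f M' _) (Eq.trans ?_ (hbr _ _).symm)
      exact congrArg₂ D'.br (φ.naturality _ _).symm (φ.naturality _ _).symm

lemma gpair_gmap (hpair : ∀ {U : Opens X} (q p : M.sec U),
      D'.pair (φ.app U q) (φ.app U p) = D.pair q p) (q p : Gen f M V) :
    D'.gpair f (gmap f φ q) (gmap f φ p) = D.gpair f q p := by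
  refine congrArg (f.pullO K _) (Eq.trans ?_ (hpair _ _))
  exact congrArg₂ D'.pair (φ.naturality _ _).symm (φ.naturality _ _).symm

lemma pairTerm_mapDomain (hpair : ∀ {U : Opens X} (q p : M.sec U),
      D'.pair (φ.app U q) (φ.app U p) = D.pair q p) (x z : Gen f M V →₀ Y.O K V) :
    pairTerm (D'.gpair f) (Finsupp.mapDomain (gmap f φ) x) (Finsupp.mapDomain (gmap f φ) z) =
      pairTerm (D.gpair f) x z := by
  induction x using Finsupp.induction_linear with
  | zero => simp
  | add x x' hx hx' =>
    rw [Finsupp.mapDomain_add, map_add, map_add, AddMonoidHom.add_apply, AddMonoidHom.add_apply,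
      hx, hx']
  | single q g =>
    induction z using Finsupp.induction_linear with
    | zero => simp
    | add x x' hx hx' => rw [Finsupp.mapDomain_add, map_add, map_add, hx, hx']
    | single p h =>
      rw [Finsupp.mapDomain_single, Finsupp.mapDomain_single, pairTerm_single, pairTerm_single,
        gpair_gmap f φ hpair]

lemma formTerm_mapDomain (hpair : ∀ {U : Opens X} (q p : M.sec U),
      D'.pair (φ.app U q) (φ.app U p) = D.pair q p) (x z : Gen f M V →₀ Y.O K V) :
    (cartan K Y V).formTerm (D'.gpair f) (Finsupp.mapDomain (gmap f φ) x)
      (Finsupp.mapDomain (gmap f φ) z) = (cartan K Y V).formTerm (D.gpair f) x z := by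
  induction x using Finsupp.induction_linear with
  | zero => simp
  | add x x' hx hx' =>
    rw [Finsupp.mapDomain_add, map_add, map_add, AddMonoidHom.add_apply, AddMonoidHom.add_apply,
      hx, hx']
  | single q g =>
    induction z using Finsupp.induction_linear with
    | zero => simp
    | add x x' hx hx' => rw [Finsupp.mapDomain_add, map_add, map_add, hx, hx']
    | single p h =>
      rw [Finsupp.mapDomain_single, Finsupp.mapDomain_single, formTerm_single, formTerm_single,
        gpair_gmap f φ hpair]

lemma act_mapDomain (ξ : (tangentSheaf K Y).sec V) (x : Gen f M V →₀ Y.O K V) :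
    (cartan K Y V).act ξ (Finsupp.mapDomain (gmap f φ) x) =
      Finsupp.mapDomain (gmap f φ) ((cartan K Y V).act ξ x) := by
  induction x using Finsupp.induction_linear with
  | zero => simp
  | add x z hx hz => rw [Finsupp.mapDomain_add, map_add, hx, hz, map_add, Finsupp.mapDomain_add]
  | single q g => rw [Finsupp.mapDomain_single, act_single, act_single, Finsupp.mapDomain_single]

/-- A morphism of presented sheaves over `φ : M → M'`. -/
structure TripleModel.Map {N N' : OMod K Y} (𝔪 : TripleModel f D N) (𝔪' : TripleModel f D' N') :
    Prop where
  anchor_comp : ∀ {U : Opens X} (q : M.sec U), D'.anchor.app U (φ.app U q) = D.anchor.app U q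
  map_br : ∀ {U : Opens X} (q p : M.sec U), φ.app U (D.br q p) = D'.br (φ.app U q) (φ.app U p)
  -- This replaces preservation of the pairing. For the projection to f^+A it is trivial, as forms
  -- map to zero; for a morphism of extensions it follows because pairings are preserved.
  form : ∀ {V : Opens Y} (x z : Gen f M V →₀ Y.O K V),
    𝔪'.jΩ V ((cartan K Y V).formTerm (D'.gpair f) (Finsupp.mapDomain (gmap f φ) x)
      (Finsupp.mapDomain (gmap f φ) z)) = 𝔪'.jΩ V ((cartan K Y V).formTerm (D.gpair f) x z)
  tcls_eq_zero : ∀ {V : Opens Y} (u : Triple f M V), tcls f (𝔪.jΩ V) (𝔪.jP V) u = 0 →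
    tcls f (𝔪'.jΩ V) (𝔪'.jP V) (tmap f φ V u) = 0

namespace TripleModel.Map

variable {f φ} {N N' : OMod K Y} {𝔪 : TripleModel f D N} {𝔪' : TripleModel f D' N'}
  (H : TripleModel.Map f φ 𝔪 𝔪')

lemma exists_hom : ∃ ψ : OMod.Hom N N', ∀ {V : Opens Y} (u : Triple f M V)
    (hu : u ∈ raw f D.anchor V), ψ.app V (𝔪.sct u hu) =
      𝔪'.sct (tmap f φ V u) (tmap_mem_raw f φ H.anchor_comp hu) := by
  obtain ⟨ψ, h⟩ := 𝔪.θ.exists_hom (M' := N') (fun V ↦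
    { toFun := fun u ↦ 𝔪'.sct (tmap f φ V u.1) (tmap_mem_raw f φ H.anchor_comp u.2)
      map_add' := fun u v ↦ (congrArg (𝔪'.θ.app V) (Subtype.ext (map_add (tmap f φ V) u.1 v.1))).trans
        (𝔪'.sct_add _ _)
      map_smul' := fun g u ↦ (congrArg (𝔪'.θ.app V)
        (Subtype.ext (map_smul (tmap f φ V) g u.1))).trans (𝔪'.sct_smul g _) })
    (fun k u ↦ (𝔪'.res_sct k _).trans
      (congrArg (𝔪'.θ.app _) (Subtype.ext (tres_tmap f φ k u.1))))
    (fun {V} u hu ↦ N'.sep _ _ fun y hy ↦ by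
      obtain ⟨W, h, hyW, e1, e2⟩ := 𝔪.local_eq_zero u.1 u.2 hu y hy
      refine ⟨W, h, hyW, ?_⟩
      refine (𝔪'.res_sct h _).trans (Eq.trans ?_ (map_zero _).symm)
      refine 𝔪'.θ_eq_zero _ _ ?_ e2
      rw [tres_tmap]
      exact H.tcls_eq_zero _ e1)
  exact ⟨ψ, fun {V} u hu ↦ h V ⟨u, hu⟩⟩

/-- The morphism of sheaves. -/
def hom : OMod.Hom N N' := H.exists_hom.choose

lemma hom_sct {u : Triple f M V} (hu : u ∈ raw f D.anchor V) : H.hom.app V (𝔪.sct u hu) =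
    𝔪'.sct (tmap f φ V u) (tmap_mem_raw f φ H.anchor_comp hu) := H.exists_hom.choose_spec u hu

lemma hom_br (t s : N.sec V) : H.hom.app V (𝔪.br t s) = 𝔪'.br (H.hom.app V t) (H.hom.app V s) :=
  N'.sep _ _ fun y hy ↦ by
    obtain ⟨W, h, u, v, hu, hv, hyW, eu, ev⟩ := 𝔪.exists_sct₂ t s hy
    refine ⟨W, h, hyW, ?_⟩
    rw [← H.hom.naturality, res_br, res_br, ← H.hom.naturality, ← H.hom.naturality, ← eu, ← ev,
      br_sct, H.hom_sct, H.hom_sct, H.hom_sct, br_sct]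
    refine 𝔪'.sct_congr _ _ ?_ rfl
    rw [tcls_eq, tcls_eq]
    have e : (Submodule.Quotient.mk (tmap f φ W (D.tbr f u v)).2.1 : PSec f M' W) =
        Submodule.Quotient.mk (D'.tbr f (tmap f φ W u) (tmap f φ W v)).2.1 := by
      refine (mk_mapDomain_gmap f φ _).trans ?_
      change Pull.map f φ W (Submodule.Quotient.mk (_ + _ - _)) = Submodule.Quotient.mk (brTerm
        (D'.gbr f) (Finsupp.mapDomain (gmap f φ) u.2.1) (Finsupp.mapDomain (gmap f φ) v.2.1) +
          (cartan K Y W).act u.2.2 (Finsupp.mapDomain (gmap f φ) v.2.1) -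
          (cartan K Y W).act v.2.2 (Finsupp.mapDomain (gmap f φ) u.2.1))
      rw [Submodule.Quotient.mk_sub, Submodule.Quotient.mk_add, map_sub, map_add, act_mapDomain,
        act_mapDomain, Submodule.Quotient.mk_sub, Submodule.Quotient.mk_add,
        mk_brTerm_mapDomain f φ H.map_br, mk_mapDomain_gmap, mk_mapDomain_gmap]
    rw [e]
    refine congrArg (· + 𝔪'.jP W _) ?_
    refine (map_add (𝔪'.jΩ W) _ _).trans (Eq.trans ?_ (map_add (𝔪'.jΩ W) _ _).symm)
    exact congrArg (𝔪'.jΩ W (-(cartan K Y W).ctr v.2.2 u.1 + (cartan K Y W).lie u.2.2 v.1) + ·)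
      (H.form u.2.1 v.2.1).symm

lemma anchor_hom (t : N.sec V) : 𝔪'.anchor.app V (H.hom.app V t) = 𝔪.anchor.app V t :=
  (tangentSheaf K Y).sep _ _ fun y hy ↦ by
    obtain ⟨W, h, u, hu, hyW, eu⟩ := 𝔪.exists_sct t hy
    refine ⟨W, h, hyW, ?_⟩
    rw [← 𝔪.anchor.naturality, ← 𝔪'.anchor.naturality, ← H.hom.naturality, ← eu, H.hom_sct,
      anchor_sct, anchor_sct]
    rfl

end TripleModel.Map

end Functoriality

/-! ### Local splittings of Courant extensions -/

section Splitting

variable {𝕜 : Type} [RCLike 𝕜] {n : WithTop ℕ∞} {K : Type} [RCLike K] [NormedAlgebra 𝕜 K]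
variable {X Y : Mfd.{u} 𝕜 n}

open CartanCalculus PairedBracket

/-- A splitting of `0 → Ω¹ → Q → A → 0` over an open set. -/
structure LocalSplitting {Q A : OMod K X} (S : CourantStr Q) (p : OMod.Hom Q A) (U₀ : Opens X) where
  lift : ∀ {V : Opens X}, V ≤ U₀ → A.sec V →ₗ[X.O K V] Q.sec V
  lift_res : ∀ {V W : Opens X} (h : V ≤ U₀) (k : W ≤ V) (a : A.sec V),
    lift (k.trans h) (A.res k a) = Q.res k (lift h a)
  proj_lift : ∀ {V : Opens X} (h : V ≤ U₀) (a : A.sec V), p.app V (lift h a) = a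
  ret : ∀ {V : Opens X}, V ≤ U₀ → Q.sec V →ₗ[X.O K V] (formSheaf K X).sec V
  ret_res : ∀ {V W : Opens X} (h : V ≤ U₀) (k : W ≤ V) (q : Q.sec V),
    ret (k.trans h) (Q.res k q) = (formSheaf K X).res k (ret h q)
  coanchor_ret : ∀ {V : Opens X} (h : V ≤ U₀) (q : Q.sec V),
    S.coanchor.app V (ret h q) = q - lift h (p.app V q)
  ret_coanchor : ∀ {V : Opens X} (h : V ≤ U₀) (α : (formSheaf K X).sec V),
    ret h (S.coanchor.app V α) = α

variable {Q A : OMod K X} {S : CourantStr Q} {L : LieStr A} {p : OMod.Hom Q A}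

lemma IsCourantExtension.proj_coanchor (H : IsCourantExtension S L p) {U : Opens X}
    (α : (formSheaf K X).sec U) : p.app U (S.coanchor.app U α) = 0 :=
  (H.exact U _).2 ⟨α, rfl⟩

/-- Lift the finitely many basis sections of A to Q on a common neighbourhood and extend linearly.
Uniqueness of coordinates gives linearity and compatibility with restriction. -/
lemma IsCourantExtension.exists_lift (H : IsCourantExtension S L p) (hA : A.LocallyFree) (x : X) :
    ∃ (U₀ : Opens X) (lift : ∀ {V : Opens X}, V ≤ U₀ → A.sec V →ₗ[X.O K V] Q.sec V), x ∈ U₀ ∧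
      (∀ {V W : Opens X} (h : V ≤ U₀) (k : W ≤ V) (a : A.sec V),
        lift (k.trans h) (A.res k a) = Q.res k (lift h a)) ∧
      ∀ {V : Opens X} (h : V ≤ U₀) (a : A.sec V), p.app V (lift h a) = a := by
  obtain ⟨U, hx, r, e, he⟩ := hA x
  choose V hV q hxV hq using fun i ↦ H.surjective U (e i) x hx
  choose c hc hcu using he
  beta_reduce at hc hcu
  have hle : ∀ i, U ⊓ Finset.univ.inf V ≤ V i := fun i ↦
    inf_le_right.trans (Finset.inf_le (Finset.mem_univ i))
  refine ⟨U ⊓ Finset.univ.inf V, fun {W} h ↦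
    { toFun := fun a ↦ ∑ i, c W (h.trans inf_le_left) a i • Q.res (h.trans (hle i)) (q i)
      map_add' := fun a b ↦ ?_
      map_smul' := fun g a ↦ ?_ }, ⟨hx, ?_⟩, fun {W W'} h k a ↦ ?_, fun {W} h a ↦ ?_⟩
  · have e1 := hcu W (h.trans inf_le_left) (a + b)
      (c W (h.trans inf_le_left) a + c W (h.trans inf_le_left) b) (by
        simp only [Pi.add_apply, add_smul, Finset.sum_add_distrib]
        rw [← hc, ← hc])
    rw [← e1]
    simp only [Pi.add_apply, add_smul, Finset.sum_add_distrib]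
  · have e1 := hcu W (h.trans inf_le_left) (g • a) (g • c W (h.trans inf_le_left) a) (by
        simp only [Pi.smul_apply, smul_assoc, ← Finset.smul_sum]
        rw [← hc])
    rw [← e1]
    simp only [Pi.smul_apply, smul_assoc, ← Finset.smul_sum]
    rfl
  · rw [Opens.coe_finset_inf, Finset.inf_set_eq_iInter]
    exact Set.mem_iInter₂.2 fun i _ ↦ hxV i
  · have e1 := hcu W' ((k.trans h).trans inf_le_left) (A.res k a)
      (fun i ↦ resO K k (c W (h.trans inf_le_left) a i)) (by
        conv_lhs => rw [hc W (h.trans inf_le_left) a]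
        rw [map_sum]
        refine Finset.sum_congr rfl fun i _ ↦ ?_
        rw [PreMod.res_smul, A.res_res])
    change ∑ i, c W' ((k.trans h).trans inf_le_left) (A.res k a) i •
      Q.res ((k.trans h).trans (hle i)) (q i) =
        Q.res k (∑ i, c W (h.trans inf_le_left) a i • Q.res (h.trans (hle i)) (q i))
    rw [← e1, map_sum]
    refine Finset.sum_congr rfl fun i _ ↦ ?_
    rw [PreMod.res_smul, Q.res_res]
  · change p.app W (∑ i, c W (h.trans inf_le_left) a i • Q.res (h.trans (hle i)) (q i)) = a
    rw [map_sum]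
    conv_rhs => rw [hc W (h.trans inf_le_left) a]
    refine Finset.sum_congr rfl fun i _ ↦ ?_
    rw [map_smul, p.naturality, hq, A.res_res]

/-- The retraction sends q to the form whose image under π† is q minus the lift of p(q). It exists
and is unique on every smaller open, because exactness at Ω¹ and at Q holds for sections. -/
lemma IsCourantExtension.exists_localSplitting (H : IsCourantExtension S L p) (hA : A.LocallyFree)
    (x : X) : ∃ U₀ : Opens X, x ∈ U₀ ∧ Nonempty (LocalSplitting S p U₀) := by
  obtain ⟨U₀, lift, hx, h1, h2⟩ := H.exists_lift hA x
  have h3 : ∀ {V : Opens X} (h : V ≤ U₀) (q : Q.sec V), ∃ α,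
      S.coanchor.app V α = q - lift h (p.app V q) := fun {V} h q ↦
    (H.exact V _).1 (by rw [map_sub, h2, sub_self])
  choose ret hret using @h3
  refine ⟨U₀, hx, ⟨⟨lift, h1, h2, fun {V} h ↦
    { toFun := ret h
      map_add' := fun a b ↦ H.injective V ?_
      map_smul' := fun g a ↦ H.injective V ?_ }, fun {V W} h k q ↦ H.injective W ?_, hret,
      fun {V} h α ↦ H.injective V ?_⟩⟩⟩
  · rw [map_add, hret, hret, hret, map_add, map_add]
    abel
  · rw [RingHom.id_apply, map_smul, hret, hret, map_smul, map_smul, smul_sub]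
  · change S.coanchor.app W (ret _ _) = S.coanchor.app W ((formSheaf K X).res k (ret _ _))
    rw [hret, S.coanchor.naturality, hret, map_sub, p.naturality, h1]
  · change S.coanchor.app V (ret _ _) = _
    rw [hret, H.proj_coanchor, map_zero, sub_zero]

variable (f : Mfd.Hom Y X)

lemma Pull.pure_zero {M : OMod K X} {U : Opens X} {V : Opens Y} (h : V ≤ f.preim U) :
    Pull.pure f M h (0 : M.sec U) = 0 := by
  have := pure_smul (f := f) h 0 (0 : M.sec U)
  rwa [zero_smul, map_zero, zero_smul] at this

lemma Pull.pure_sub {M : OMod K X} {U : Opens X} {V : Opens Y} (h : V ≤ f.preim U) (q q' : M.sec U) :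
    Pull.pure f M h (q - q') = Pull.pure f M h q - Pull.pure f M h q' := by
  rw [eq_sub_iff_add_eq, ← pure_add, sub_add_cancel]

namespace LocalSplitting

variable {f} {U₀ : Opens X} (𝔰 : LocalSplitting S p U₀) {V : Opens Y} (hV : V ≤ f.preim U₀)

/-- The pullback of the splitting `A → Q`. -/
def pullLift : PSec f A V →ₗ[Y.O K V] PSec f Q V :=
  Pull.lift (RingHom.id _) (fun {U} h a ↦ Pull.pure f Q (le_preim_inf h hV)
      (𝔰.lift (inf_le_right : U ⊓ U₀ ≤ U₀) (A.res inf_le_left a)))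
    (fun {U U'} h k h' a ↦ by
      rw [A.res_res, ← pure_res (le_preim_inf h hV) (inf_le_inf_right U₀ k) (le_preim_inf h' hV),
        ← 𝔰.lift_res, A.res_res])
    (fun h q q' ↦ by rw [map_add, map_add, pure_add])
    (fun h g q ↦ by rw [PreMod.res_smul, map_smul, pure_smul]; rfl)

lemma pullLift_pure {U : Opens X} (h : V ≤ f.preim U) (a : A.sec U) :
    𝔰.pullLift hV (Pull.pure f A h a) = Pull.pure f Q (le_preim_inf h hV)
      (𝔰.lift (inf_le_right : U ⊓ U₀ ≤ U₀) (A.res inf_le_left a)) := lift_pure ..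

lemma map_pullLift (s : PSec f A V) : Pull.map f p V (𝔰.pullLift hV s) = s := by
  induction s using Pull.induct with
  | zero => rw [map_zero, map_zero]
  | add s t hs ht => rw [map_add, map_add, hs, ht]
  | smul h g a => rw [map_smul, map_smul, pullLift_pure, Pull.map_pure, 𝔰.proj_lift, pure_res]

variable [Fact (∞ ≤ n)]

/-- The pullback of the splitting `Q → Ω¹`. -/
def pullRet : PSec f Q V →ₗ[Y.O K V] (formSheaf K Y).sec V :=
  Pull.lift (RingHom.id _) (fun {U} h q ↦ f.pullForm (le_preim_inf h hV)
      (𝔰.ret (inf_le_right : U ⊓ U₀ ≤ U₀) (Q.res inf_le_left q)))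
    (fun {U U'} h k h' q ↦ by
      rw [Q.res_res, ← Q.res_res (inf_le_left : U' ⊓ U₀ ≤ U') (inf_le_inf_right U₀ k), 𝔰.ret_res]
      rfl)
    (fun h q q' ↦ by rw [map_add, map_add, pullForm_add])
    (fun h g q ↦ by rw [PreMod.res_smul, map_smul, pullForm_smul]; rfl)

lemma pullRet_pure {U : Opens X} (h : V ≤ f.preim U) (q : Q.sec U) :
    𝔰.pullRet hV (Pull.pure f Q h q) = f.pullForm (le_preim_inf h hV)
      (𝔰.ret (inf_le_right : U ⊓ U₀ ≤ U₀) (Q.res inf_le_left q)) := lift_pure ..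

/-- On a generator (f^*α, -1 ⊗ π†α) the two terms cancel, since the retraction inverts π†. Thus (β,
s) ↦ β + ρ(s), with ρ the pulled-back retraction, descends to the quotient; being the identity on
forms, it makes the co-anchor injective. -/
lemma pullRet_of_mem_relSub {β : (formSheaf K Y).sec V} {s : PSec f Q V}
    (h : (β, s) ∈ relSub f S V) : β + 𝔰.pullRet hV s = 0 := by
  have : relSub f S V ≤ LinearMap.ker (LinearMap.coprod LinearMap.id (𝔰.pullRet hV)) :=
    relSub_le f S fun {U} h α ↦ by
      rw [LinearMap.mem_ker, LinearMap.coprod_apply, map_neg, pullRet_pure, ← S.coanchor.naturality,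
        𝔰.ret_coanchor]
      exact add_neg_cancel _
  exact this h

/-- The splitting writes q as the lift of p(q) plus π† of its retraction, and the relations turn the
second summand into a form on Y. -/
lemma pullRet_mem_relSub (s : PSec f Q V) :
    (-𝔰.pullRet hV s, s - 𝔰.pullLift hV (Pull.map f p V s)) ∈ relSub f S V := by
  let F : PSec f Q V →ₗ[Y.O K V] (formSheaf K Y).sec V × PSec f Q V :=
    (-𝔰.pullRet hV).prod (LinearMap.id - (𝔰.pullLift hV).comp (Pull.map f p V))
  change F s ∈ relSub f S V
  induction s using Pull.induct with
  | zero => rw [map_zero]; exact zero_mem _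
  | add s t hs ht => rw [map_add]; exact add_mem hs ht
  | smul h g q =>
    rw [map_smul]
    refine Submodule.smul_mem _ g ?_
    change (-𝔰.pullRet hV _, Pull.pure f Q h q - 𝔰.pullLift hV (Pull.map f p V _)) ∈ relSub f S V
    rw [pullRet_pure, Pull.map_pure, pullLift_pure, ← pure_res (le_preim_inf h hV) inf_le_left h,
      ← pure_sub, ← p.naturality, ← 𝔰.coanchor_ret]
    have := neg_mem (pullForm_mem_relSub f S (le_preim_inf h hV) (𝔰.ret
      (inf_le_right : _ ⊓ U₀ ≤ U₀) (Q.res inf_le_left q)))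
    rwa [Prod.neg_mk, neg_neg] at this

end LocalSplitting

end Splitting

/-! ### The inverse image of a Courant extension -/

section Extension

variable {𝕜 : Type} [RCLike 𝕜] {n : WithTop ℕ∞} {K : Type} [RCLike K] [NormedAlgebra 𝕜 K]
variable {X Y : Mfd.{u} 𝕜 n} (f : Mfd.Hom Y X) [Fact (∞ ≤ n)] {V : Opens Y}
variable {Q A : OMod K X} {S : CourantStr Q} {L : LieStr A} {p : OMod.Hom Q A}

open CartanCalculus PairedBracket

/-- Forms are zero in the target and p π† = 0, so the relations that define f^{++}Q map to zero. -/
lemma IsCourantExtension.mapModel (H : IsCourantExtension S L p) :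
    TripleModel.Map f p (courantModel f S) (lieModel f L) where
  anchor_comp := H.anchor_comp
  map_br := H.map_br
  form x z := rfl
  tcls_eq_zero {V} u hu := by
    have h : relSub f S V ≤ LinearMap.ker ((Pull.map f p V).comp (LinearMap.snd _ _ _)) :=
      relSub_le f S fun {U} h α ↦ by
        rw [LinearMap.mem_ker, LinearMap.comp_apply, LinearMap.snd_apply, map_neg, Pull.map_pure,
          H.proj_coanchor, pure_zero, neg_zero]
    rw [tcls_eq]
    refine (zero_add _).trans ((mk_mapDomain_gmap f p u.2.1).trans ?_)
    exact h ((tcls_eq_zero_iff f S u).1 hu)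

/-- The projection `f^{++}Q → f^+A`. -/
def plusProj (H : IsCourantExtension S L p) : OMod.Hom (plusPlus f S) (plus f L.anchor) :=
  (H.mapModel f).hom

lemma isInducedProj_plusProj (H : IsCourantExtension S L p) :
    IsInducedProj f S L p (plusProj f H) := fun {U V} hU {k} α g q ξ hs ↦ by
  obtain ⟨hu, eu⟩ := courMk_pullSum f S hU α g q ξ hs
  have h := tmap_mem_raw f p (H.mapModel f).anchor_comp hu
  have e : (Submodule.Quotient.mk (Finsupp.mapDomain (gmap f p) (psum f hU g q)) : PSec f A V) =
      pullSum f hU g (fun i ↦ p.app U (q i)) := by rw [tmap_psum, mk_psum]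
  refine ⟨?_, ?_⟩
  · have h' : (Submodule.Quotient.mk (Finsupp.mapDomain (gmap f p) (psum f hU g q)), ξ) ∈
      plusSub f L.anchor V := h
    rwa [e] at h'
  · rw [eu]
    refine ((H.mapModel f).hom_sct hu).trans ?_
    exact plusMk_congr f h e rfl

lemma plusCoanchor_injective_of_splitting {U₀ : Opens X} (𝔰 : LocalSplitting S p U₀)
    (hV : V ≤ f.preim U₀) {β : (formSheaf K Y).sec V} (h : (plusCoanchor f S).app V β = 0) :
    β = 0 := by
  refine (formSheaf K Y).sep _ _ fun y hy ↦ ?_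
  obtain ⟨W, k, hyW, e1, e2⟩ := (courantModel f S).local_eq_zero _ (form_mem_raw f S β) h y hy
  refine ⟨W, k, hyW, ?_⟩
  have e3 := 𝔰.pullRet_of_mem_relSub (fun z hz ↦ hV (k hz)) ((tcls_eq_zero_iff f S _).1 e1)
  have e4 : (tres f Q k (β, 0, 0)).2.1 = 0 := map_zero _
  rw [e4, Submodule.Quotient.mk_zero, map_zero, add_zero] at e3
  exact e3.trans (map_zero _).symm

/-- When p(s) = 0 the lift in `pullRet_mem_relSub` disappears and s is equivalent to a form;
together with ξ = 0 this puts the section in the image of the co-anchor. -/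
lemma plusCoanchor_of_splitting {U₀ : Opens X} (𝔰 : LocalSplitting S p U₀) (hV : V ≤ f.preim U₀)
    {u : Triple f Q V} (hu : u ∈ raw f S.toPaired.anchor V)
    (h : Pull.map f p V (Submodule.Quotient.mk u.2.1) = 0) (h' : u.2.2 = 0) :
    (plusCoanchor f S).app V (u.1 + 𝔰.pullRet hV (Submodule.Quotient.mk u.2.1)) =
      (courantModel f S).sct u hu := by
  refine (courantModel f S).sct_congr _ _ ?_ h'.symm
  rw [tcls_eq, tcls_eq]
  have e := (Submodule.Quotient.mk_eq_zero _).2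
    (𝔰.pullRet_mem_relSub hV (Submodule.Quotient.mk u.2.1))
  rw [h, map_zero, sub_zero, ← relForm_add_relSec, map_neg, neg_add_eq_zero] at e
  refine Eq.trans ?_ (congrArg (relForm f S V u.1 + ·) e)
  change relForm f S V (_ + _) + relSec f S V (Submodule.Quotient.mk 0) = _
  rw [Submodule.Quotient.mk_zero, map_zero, add_zero, map_add]

lemma IsCourantExtension.plusCoanchor_injective (H : IsCourantExtension S L p)
    (hA : A.LocallyFree) (V : Opens Y) : Function.Injective ((plusCoanchor f S).app V) :=
  (injective_iff_map_eq_zero _).2 fun β hβ ↦ (formSheaf K Y).sep _ _ fun y hy ↦ by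
    obtain ⟨U₀, hx, ⟨𝔰⟩⟩ := H.exists_localSplitting hA (f y)
    refine ⟨V ⊓ f.preim U₀, inf_le_left, ⟨hy, hx⟩, ?_⟩
    rw [map_zero]
    refine plusCoanchor_injective_of_splitting f 𝔰 inf_le_right ?_
    rw [(plusCoanchor f S).naturality, hβ, map_zero]

/-- Splittings give preimages under the co-anchor only locally. Injectivity makes them agree on
overlaps, so they glue to a form on all of V. -/
lemma IsCourantExtension.exists_plusCoanchor (H : IsCourantExtension S L p) (hA : A.LocallyFree)
    {t : (plusPlus f S).sec V} (ht : (plusProj f H).app V t = 0) :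
    ∃ β, (plusCoanchor f S).app V β = t := by
  have hloc : ∀ y ∈ V, ∃ (W : Opens Y) (h : W ≤ V) (β : (formSheaf K Y).sec W), y ∈ W ∧
      (plusCoanchor f S).app W β = (plusPlus f S).res h t := fun y hy ↦ by
    obtain ⟨U₀, hx, ⟨𝔰⟩⟩ := H.exists_localSplitting hA (f y)
    obtain ⟨W, h, u, hu, hyW, eu⟩ := (courantModel f S).exists_sct
      ((plusPlus f S).res (inf_le_left : V ⊓ f.preim U₀ ≤ V) t) ⟨hy, hx⟩
    have e : (lieModel f L).sct (tmap f p W u) (tmap_mem_raw f p (H.mapModel f).anchor_comp hu) =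
        0 := by
      refine ((H.mapModel f).hom_sct hu).symm.trans ?_
      rw [eu, PreMod.res_res]
      exact ((plusProj f H).naturality _ t).trans ((congrArg _ ht).trans (map_zero _))
    obtain ⟨W', k, hyW', e1, e2⟩ := (lieModel f L).local_eq_zero _ _ e y hyW
    have e3 : Pull.map f p W' (Submodule.Quotient.mk (tres f Q k u).2.1) = 0 := by
      rw [tcls_eq, tres_tmap] at e1
      exact (mk_mapDomain_gmap f p _).symm.trans ((zero_add _).symm.trans e1)
    refine ⟨W', (k.trans h).trans inf_le_left, _, hyW', (plusCoanchor_of_splitting f 𝔰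
      ((k.trans h).trans inf_le_right) (tres_mem_raw f hu k) e3 e2).trans ?_⟩
    rw [← TripleModel.res_sct _ _ hu, eu, PreMod.res_res, PreMod.res_res]
  obtain ⟨β, hβ⟩ := (formSheaf K Y).exists_of_local (U := V)
    (fun {W} h β ↦ (plusCoanchor f S).app W β = (plusPlus f S).res h t)
    (fun h k β e ↦ by rw [(plusCoanchor f S).naturality, e, PreMod.res_res])
    (fun h β β' e e' ↦ H.plusCoanchor_injective f hA _ (e.trans e'.symm)) hloc
  refine ⟨β, (plusPlus f S).sep _ _ fun y hy ↦ ?_⟩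
  obtain ⟨W, h, γ, hyW, e⟩ := hloc y hy
  exact ⟨W, h, hyW, by rw [← (plusCoanchor f S).naturality, hβ h γ e, e]⟩

/-- For surjectivity, a local representative of a section of f^+A is lifted through the splitting.
The lift stays in the fibre product with the same vector field because p preserves anchors. -/
lemma isCourantExtension_plusProj (H : IsCourantExtension S L p) (hA : A.LocallyFree) :
    IsCourantExtension (plusCourant f S) (plusLie f L) (plusProj f H) where
  anchor_comp t := (H.mapModel f).anchor_hom t
  map_br t s := (H.mapModel f).hom_br t s
  injective V := H.plusCoanchor_injective f hA V
  exact V t := by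
    refine ⟨fun h ↦ H.exists_plusCoanchor f hA h, ?_⟩
    rintro ⟨β, rfl⟩
    refine ((H.mapModel f).hom_sct (form_mem_raw f S β)).trans
      ((lieModel f L).θ_eq_zero _ _ ?_ rfl)
    rw [tcls_eq, tmap_apply, Finsupp.mapDomain_zero, Submodule.Quotient.mk_zero, map_zero, add_zero]
    rfl
  surjective V a y hy := by
    obtain ⟨U₀, hx, ⟨𝔰⟩⟩ := H.exists_localSplitting hA (f y)
    obtain ⟨W, h, u, hu, hyW, eu⟩ := (lieModel f L).exists_sct
      ((plus f L.anchor).res (inf_le_left : V ⊓ f.preim U₀ ≤ V) a) ⟨hy, hx⟩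
    have hW : W ≤ f.preim U₀ := h.trans inf_le_right
    obtain ⟨x, ex⟩ := Submodule.Quotient.mk_surjective _
      (𝔰.pullLift hW (Submodule.Quotient.mk u.2.1))
    have e : Pull.map f p W (Submodule.Quotient.mk x) = Submodule.Quotient.mk u.2.1 := by
      rw [ex, 𝔰.map_pullLift]
    have hv : ((0, x, u.2.2) : Triple f Q W) ∈ raw f S.toPaired.anchor W := fun z ↦ by
      refine (Pull.anchorAt_map f p H.anchor_comp z _).symm.trans ?_
      refine (congrArg (anchorAt L.anchor z) e).trans (hu z)
    refine ⟨W, h.trans inf_le_left, (courantModel f S).sct _ hv, hyW, ?_⟩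
    refine ((H.mapModel f).hom_sct hv).trans (Eq.trans ?_ (eu.trans (PreMod.res_res _ _ _ _)))
    refine (lieModel f L).sct_congr _ _ ?_ rfl
    rw [tcls_eq, tcls_eq]
    exact congrArg (0 + ·) ((mk_mapDomain_gmap f p x).trans e)

end Extension

/-! ### The functor -/

section FunctorOnExtensions

variable {𝕜 : Type} [RCLike 𝕜] {n : WithTop ℕ∞} {K : Type} [RCLike K] [NormedAlgebra 𝕜 K]
variable {X Y : Mfd.{u} 𝕜 n} (f : Mfd.Hom Y X) [Fact (∞ ≤ n)] {V : Opens Y}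
variable {A : OMod K X} {L : LieStr A} {E E' E'' : CExt L}

open CartanCalculus PairedBracket

/-- A morphism commutes with the co-anchors, so it carries the generating relations for Q to those
for Q'; it preserves pairings, so the form terms are unchanged. -/
lemma CExt.Hom.mapModel (φ : CExt.Hom E E') :
    TripleModel.Map f φ.hom (courantModel f E.str) (courantModel f E'.str) where
  anchor_comp := φ.anchor_comp
  map_br := φ.map_br
  form x z := congrArg _ (formTerm_mapDomain f φ.hom φ.map_pair x z)
  tcls_eq_zero {V} u hu := by
    have h : relSub f E.str V ≤ (relSub f E'.str V).comap
        (LinearMap.prodMap LinearMap.id (Pull.map f φ.hom V)) :=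
      relSub_le f E.str fun {U} h α ↦ by
        rw [Submodule.mem_comap, LinearMap.prodMap_apply, map_neg, Pull.map_pure, φ.map_coanchor]
        exact pullForm_mem_relSub f E'.str h α
    refine (tcls_eq_zero_iff f E'.str _).2 ?_
    have h1 := h ((tcls_eq_zero_iff f E.str u).1 hu)
    exact (congrArg (fun z ↦ (u.1, z) ∈ relSub f E'.str V) (mk_mapDomain_gmap f φ.hom u.2.1)).mpr h1

/-- The morphism `f^{++}Q → f^{++}Q'`. -/
def plusMap (φ : CExt.Hom E E') : OMod.Hom (plusPlus f E.str) (plusPlus f E'.str) :=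
  (φ.mapModel f).hom

lemma plusMap_sct (φ : CExt.Hom E E') {u : Triple f E.mod V}
    (hu : u ∈ raw f E.str.toPaired.anchor V) :
    (plusMap f φ).app V ((courantModel f E.str).sct u hu) = (courantModel f E'.str).sct
      (tmap f φ.hom V u) (tmap_mem_raw f φ.hom (φ.mapModel f).anchor_comp hu) :=
  (φ.mapModel f).hom_sct hu

lemma isInducedMap_plusMap (φ : CExt.Hom E E') :
    IsInducedMap f E.str E'.str φ.hom (plusMap f φ) := fun {U V} hU {k} α g q ξ hs ↦ by
  obtain ⟨hu, eu⟩ := courMk_pullSum f E.str hU α g q ξ hs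
  have h := tmap_mem_raw f φ.hom (φ.mapModel f).anchor_comp hu
  have e : (Submodule.Quotient.mk (Finsupp.mapDomain (gmap f φ.hom) (psum f hU g q)) :
      PSec f E'.mod V) = pullSum f hU g (fun i ↦ φ.hom.app U (q i)) := by rw [tmap_psum, mk_psum]
  refine ⟨?_, ?_⟩
  · have h' : (Submodule.Quotient.mk (Finsupp.mapDomain (gmap f φ.hom) (psum f hU g q)), ξ) ∈
      plusSub f E'.str.anchor V := h
    rwa [e] at h'
  · rw [eu]
    refine (plusMap_sct f φ hu).trans ?_
    exact courMk_congr f E'.str h rfl e rfl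

lemma plusMap_pair (φ : CExt.Hom E E') (t s : (plusPlus f E.str).sec V) :
    plusPair f E'.str ((plusMap f φ).app V t) ((plusMap f φ).app V s) = plusPair f E.str t s :=
  (structureSheaf K Y).sep (U := V) _ _ fun y hy ↦ by
    obtain ⟨W, h, u, v, hu, hv, hyW, eu, ev⟩ := (courantModel f E.str).exists_sct₂ t s hy
    refine ⟨W, h, hyW, ?_⟩
    change resO K h _ = resO K h _
    rw [resO_plusPair, resO_plusPair, ← (plusMap f φ).naturality, ← (plusMap f φ).naturality, ← eu,
      ← ev, plusMap_sct, plusMap_sct, plusPair_sct, plusPair_sct]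
    exact congrArg (contractHom K Y W u.2.2 v.1 + contractHom K Y W v.2.2 u.1 + ·)
      (pairTerm_mapDomain f φ.hom φ.map_pair u.2.1 v.2.1)

lemma plusMap_coanchor (φ : CExt.Hom E E') (β : (formSheaf K Y).sec V) :
    (plusMap f φ).app V ((plusCoanchor f E.str).app V β) = (plusCoanchor f E'.str).app V β := by
  refine (plusMap_sct f φ (form_mem_raw f E.str β)).trans
    (congrArg ((courantModel f E'.str).θ.app V) (Subtype.ext ?_))
  exact Prod.ext rfl (Prod.ext (Finsupp.mapDomain_zero (f := gmap f φ.hom)) rfl)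

lemma plusProj_plusMap (φ : CExt.Hom E E') (t : (plusPlus f E.str).sec V) :
    (plusProj f E'.isExt).app V ((plusMap f φ).app V t) = (plusProj f E.isExt).app V t :=
  (plus f L.anchor).sep _ _ fun y hy ↦ by
    obtain ⟨W, h, u, hu, hyW, eu⟩ := (courantModel f E.str).exists_sct t hy
    refine ⟨W, h, hyW, ?_⟩
    rw [← OMod.Hom.naturality, ← OMod.Hom.naturality, ← OMod.Hom.naturality, ← eu, plusMap_sct]
    refine ((E'.isExt.mapModel f).hom_sct _).trans (Eq.trans ?_ ((E.isExt.mapModel f).hom_sct hu).symm)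
    exact congrArg ((lieModel f L).θ.app W) (Subtype.ext (tmap_tmap f φ.hom φ.proj_comp u))

/-- The inverse image of a Courant extension of a locally free Lie algebroid. -/
def plusExt (hA : A.LocallyFree) (E : CExt L) : CExt (plusLie f L) :=
  ⟨plusPlus f E.str, plusCourant f E.str, plusProj f E.isExt,
    isCourantExtension_plusProj f E.isExt hA⟩

/-- The inverse image of Courant extensions, as a functor. -/
def plusFunctor (L : LieStr A) (hA : A.LocallyFree) :
    CategoryTheory.Functor (CExt L) (CExt (plusLie f L)) where
  obj E := plusExt f hA E
  map {E E'} φ :=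
    { hom := plusMap f φ
      map_br := fun t s ↦ (CExt.Hom.mapModel f φ).hom_br t s
      map_pair := plusMap_pair f φ
      anchor_comp := fun t ↦ (CExt.Hom.mapModel f φ).anchor_hom t
      map_coanchor := plusMap_coanchor f φ
      proj_comp := plusProj_plusMap f φ }
  -- The functor identities can be checked on triples, where a morphism acts through the generators
  -- alone.
  map_id E := CExt.Hom.ext ((plusPlusPres f E.str).hom_ext fun V u ↦ by
    refine (plusMap_sct f _ u.2).trans (congrArg ((courantModel f E.str).θ.app V) (Subtype.ext ?_))
    exact tmap_id f u.1)
  map_comp {E E' E''} φ ψ := CExt.Hom.ext ((plusPlusPres f E.str).hom_ext fun V u ↦ by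
    refine (plusMap_sct f _ u.2).trans (Eq.trans ?_
      (congrArg ((plusMap f ψ).app V) (plusMap_sct f φ u.2)).symm)
    refine Eq.trans ?_ (plusMap_sct f ψ _).symm
    exact congrArg ((courantModel f E''.str).θ.app V)
      (Subtype.ext (tmap_tmap f (CExt.Hom.hom φ) (fun _ ↦ rfl) u.1).symm))

end FunctorOnExtensions

end

/-! ### Assembly of the structures, their uniqueness and the functor -/

theorem mainTheorem12 {𝕜 K : Type} [RCLike 𝕜] [RCLike K] [NormedAlgebra 𝕜 K] {n : WithTop ℕ∞}
    (hn : ∞ ≤ n) {X Y : Mfd.{u} 𝕜 n} (f : Mfd.Hom Y X) {A : OMod K X} (L : LieStr A)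
    (hA : A.LocallyFree) :
    ∃ B : LieStr (plus f L.anchor), IsLieInverseImage f L B ∧
      (∀ B', IsLieInverseImage f L B' → B' = B) ∧
      ∃ (R : ∀ E : CExt L, CourantStr (plusPlus f E.str))
        (r : ∀ E : CExt L, OMod.Hom (plusPlus f E.str) (plus f L.anchor))
        (hext : ∀ E : CExt L, IsCourantExtension (R E) B (r E)),
        (∀ E : CExt L, IsCourantInverseImage f E.str (R E)) ∧
        (∀ (E : CExt L) (R' : CourantStr (plusPlus f E.str)),
          IsCourantInverseImage f E.str R' → R' = R E) ∧
        (∀ E : CExt L, IsInducedProj f E.str L E.proj (r E)) ∧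
        ∃ (F : CategoryTheory.Functor (CExt L) (CExt B))
          (hF : ∀ E : CExt L, F.obj E = ⟨plusPlus f E.str, R E, r E, hext E⟩),
          ∀ (E E' : CExt L) (φ : E ⟶ E'),
            IsInducedMap f E.str E'.str (CExt.Hom.hom φ)
              (CExt.Hom.hom (CategoryTheory.CategoryStruct.comp
                (CategoryTheory.eqToHom (hF E).symm)
                (CategoryTheory.CategoryStruct.comp (F.map φ)
                  (CategoryTheory.eqToHom (hF E'))))) := by
  have : Fact (∞ ≤ n) := ⟨hn⟩
  refine ⟨plusLie f L, isLieInverseImage_plusLie f L,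
    fun B' h ↦ IsLieInverseImage.unique f L h (isLieInverseImage_plusLie f L),
    fun E ↦ plusCourant f E.str, fun E ↦ plusProj f E.isExt,
    fun E ↦ isCourantExtension_plusProj f E.isExt hA,
    fun E ↦ isCourantInverseImage_plusCourant f E.str,
    fun E R' h ↦ IsCourantInverseImage.unique f E.str h (isCourantInverseImage_plusCourant f E.str),
    fun E ↦ isInducedProj_plusProj f E.isExt, plusFunctor f L hA, fun _ ↦ rfl, fun E E' φ ↦ ?_⟩
  -- The identifications of objects hold by definition, so the `eqToHom`s are identities and the
  -- composite reduces to `plusMap`.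
  exact isInducedMap_plusMap f φ
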